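/- **Theorem 2.4.** Let $\{Y_n\}_{n\ge1}$ be a stationary Gaussian sequence with mean $0$, variance $1$ and covariance function $r_n=\operatorname{Cov}(Y_1,Y_{n+1})$ satisfying $r_n\log n\to0$. Let $1\le r\le d$ be integers, let $\{Y_{nj}\}_{n\ge1}$, $j=1,\dots,d$, be independent copies of $\{Y_n\}_{n\ge1}$, and let $O_n^{(r)}$ be the $r$-th largest of $Y_{n1},\dots,Y_{nd}$, so that $O_n^{(1)}=\max_j Y_{nj}$ and $O_n^{(d)}=\min_j Y_{nj}$. Let $\{\widehat O_n^{(r)}\}_{n\ge1}$ be an independent copy of the sequence $\{O_n^{(r)}\}_{n\ge1}$. Let $\{\varepsilon_n\}_{n\ge1}$ be a sequence of $\{0,1\}$-valued random variables, independent of the pair of sequences $(\{O_n^{(r)}\},\{\widehat O_n^{(r)}\})$, such that $\frac1n\sum_{k=1}^n\varepsilon_k\to\lambda$ in probability for some random variable $\lambda$ with $\lambda\in[0,1]$ almost surely. Put $$O_n^{(r)}(\varepsilon)=\varepsilon_nO_n^{(r)}+(1-\varepsilon_n)\widehat O_n^{(r)},\qquad M_n(O^{(r)})=\max_{1\le k\le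 n}O_k^{(r)},\qquad M_n(O^{(r)}(\varepsilon))=\max_{1\le k\le n}O_k^{(r)}(\varepsilon).$$ Then for all $x,y\in\mathbb R$ $$\lim_{n\to\infty}P\left[M_n(O^{(r)}(\varepsilon))\le a_n^{-1}x+b_n,\ M_n(O^{(r)})\le a_n^{-1}y+b_n\right]=\exp\left(-e^{-\min\{x,y\}}\right)\,E\exp\left(-(1-\lambda)e^{-\max\{x,y\}}\right),$$ where $$a_n=(2r\log n)^{1/2},\qquad b_n=\frac{a_n}{r}+a_n^{-1}\log\left(\Bigl(\frac{a_n}{r}\Bigr)^{-r}C_d^r(2\pi)^{-r/2}\right),\qquad C_d^r=\frac{d!}{r!\,(d-r)!}.$$ -/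

import Mathlib

open MeasureTheory ProbabilityTheory Filter Topology

namespace RandomReplacing

/-! Sequences indexed by `1, 2, 3, …` are indexed here by `ℕ`: the entry `k` is the
member number `k + 1`, so the first `n` members are the entries `k < n`. -/

/-- `Y` is a stationary standard Gaussian sequence with covariance function `ρ`: all its
finite-dimensional laws are Gaussian, every `Y i` has mean `0` and variance `1`, and the
covariance of two members depends only on their distance. -/
structure IsStdStationaryGaussian {Ω : Type*} [MeasurableSpace Ω] (P : Measure Ω)
    (Y : ℕ → Ω → ℝ) (ρ : ℕ → ℝ) : Prop where
  gaussian : IsGaussianProcess Y P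
  mean_zero : ∀ i, ∫ ω, Y i ω ∂P = 0
  variance_one : ∀ i, variance (Y i) P = 1
  covariance_eq : ∀ i k, covariance (Y i) (Y (i + k)) P = ρ k

/-- The sequence `Z` has the same law (as a random element of `ℕ → ℝ`) as `X`. -/
def IsCopy {Ω : Type*} [MeasurableSpace Ω] (P : Measure Ω) (Z X : ℕ → Ω → ℝ) : Prop :=
  IdentDistrib (fun ω n => Z n ω) (fun ω n => X n ω) P P

/-- The `r`-th largest of the numbers `x 0, …, x (d - 1)`, counted with multiplicity, for
`1 ≤ r ≤ d`: `Tuple.sort x` arranges them in increasing order, so `r = 1` is the maximum and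
`r = d` the minimum. -/
noncomputable def upperOrderStat {d : ℕ} (x : Fin d → ℝ) (r : ℕ) (hr : 1 ≤ r ∧ r ≤ d) : ℝ :=
  x (Tuple.sort x ⟨d - r, by omega⟩)

/-- The `r`-th order statistics sequence of the `d` sequences `Y 0, …, Y (d - 1)`. -/
noncomputable def orderStatSeq {Ω : Type*} {d : ℕ} (Y : Fin d → ℕ → Ω → ℝ) (r : ℕ)
    (hr : 1 ≤ r ∧ r ≤ d) : ℕ → Ω → ℝ :=
  fun n ω => upperOrderStat (fun j => Y j n ω) r hr

/-- The random replacing sequence `ε X + (1 - ε) X'`. -/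
def replaced {Ω : Type*} (ε X X' : ℕ → Ω → ℝ) : ℕ → Ω → ℝ :=
  fun n ω => ε n ω * X n ω + (1 - ε n ω) * X' n ω

/-- The maximum of the first `n` members of the sequence `X` (meaningful for `n ≥ 1`). -/
noncomputable def partialMax {Ω : Type*} (X : ℕ → Ω → ℝ) (n : ℕ) (ω : Ω) : ℝ :=
  ⨆ k : Fin n, X k ω

/-- `a_n = (2 r log n)^{1/2}`. -/
noncomputable def scaleConst (r n : ℕ) : ℝ := Real.sqrt (2 * r * Real.log n)

/-- `b_n = a_n / r + a_n⁻¹ log ((a_n / r)^{-r} C(d, r) (2π)^{-r/2})`. -/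
noncomputable def centerConst (d r n : ℕ) : ℝ :=
  scaleConst r n / r + (scaleConst r n)⁻¹ *
    Real.log (((scaleConst r n / r) ^ r)⁻¹ * (d.choose r : ℝ) *
      (2 * Real.pi) ^ (-(r : ℝ) / 2))

end RandomReplacing

/-!
The `r`-th order statistic of `d` independent stationary Gaussian sequences is a function of the
rows `X k` of a Gaussian array whose columns are independent copies of the sequence. The proof
compares this array with an array of independent standard normal variables and then conditions on
the replacement indicators.

*Comparison.* For a product `∏ g k (X k)` of smooth cutoffs of the rows, the derivative of its
expectation along the path `cos θ • Z + sin θ • X`, from the independent array `Z` to `X`, is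
computed by Gaussian integration by parts (`integral_mul_eq_of_hasGaussianLaw`). Only pairs of
distinct rows contribute. A pair contributes at most `|ρ (k - k')|` times the squared gradient
bound of the cutoffs times the probability that both order statistics are large
(`abs_integral_prod_sub_le`).

The last probability is bounded by expanding each order statistic over the `r`-subsets of the
columns. The columns are independent, and in each column the pair of entries is rotated into
two independent normal variables, whose laws are dominated by multiples of a common normal law
(`measureReal_pair_le`, `measureReal_upperOrderStat_pair_le`). At the levels `x / a_n + b_n` the
sum of these bounds over all pairs, even multiplied by `a_n ^ 2`, tends to zero because
`ρ n * log n → 0` (`tendsto_correlation_sum`, `tendsto_pair_sum`). The factor `a_n ^ 2` pays for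
cutoffs whose transition takes place on the scale `κ / a_n`, the scale on which the levels depend
on `x`. Replacing indicators by such cutoffs therefore costs a change of `x` by `κ`, which is
negligible for small `κ`. This gives asymptotic independence at two levels, uniformly in the
assignment of levels to the indices (`eventually_abs_measureReal_sub_prod_le`).

*Tail of one order statistic.* The Mills ratio gives `n * P (O > x / a_n + b_n) → exp (-x)` for
the order statistic of independent normal variables (`tendsto_mul_orderTail`).

*Conditioning.* Given that the members in `A` are not replaced, the event says that the members
in `A` stay below both levels, that the others stay below the second one, and that the
corresponding members of the independent copy stay below the first one. Its conditional
probability is uniformly close to `limitValue x y (A.card / n)`, a continuous function of the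
frequency of the unreplaced members. The frequency converges in measure, and bounded convergence
finishes the proof.
-/

namespace RandomReplacing

open scoped NNReal

/-! ### Order statistics -/

/-- The `r`-th largest number exceeds `u` if and only if some `r` of the numbers do. -/
theorem lt_upperOrderStat_iff {d : ℕ} (x : Fin d → ℝ) (r : ℕ) (hr : 1 ≤ r ∧ r ≤ d) (u : ℝ) :
    u < upperOrderStat x r hr ↔
      ∃ A ∈ Finset.powersetCard r (Finset.univ : Finset (Fin d)), ∀ l ∈ A, u < x l := by
  have hmono := Tuple.monotone_sort x
  constructor
  · intro h
    refine ⟨(Finset.Ici (⟨d - r, by omega⟩ : Fin d)).map (Tuple.sort x).toEmbedding, ?_, ?_⟩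
    · rw [Finset.mem_powersetCard]
      refine ⟨Finset.subset_univ _, ?_⟩
      rw [Finset.card_map, Fin.card_Ici]
      simp only
      omega
    · intro l hl
      obtain ⟨i, hi, rfl⟩ := Finset.mem_map.1 hl
      exact h.trans_le (hmono (Finset.mem_Ici.1 hi))
  · rintro ⟨A, hA, h⟩
    rw [Finset.mem_powersetCard] at hA
    by_contra! hle
    have hsub : A.map (Tuple.sort x).symm.toEmbedding ⊆
        Finset.Ioi (⟨d - r, by omega⟩ : Fin d) := by
      intro i hi
      obtain ⟨l, hl, rfl⟩ := Finset.mem_map.1 hi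
      rw [Finset.mem_Ioi]
      by_contra! hlt
      have h1 := hmono hlt
      have h2 := h l hl
      simp only [Function.comp_apply, Equiv.coe_toEmbedding, Equiv.apply_symm_apply] at h1
      exact absurd (h2.trans_le h1) (not_lt.2 hle)
    have hcard := Finset.card_le_card hsub
    rw [Finset.card_map, Fin.card_Ioi, hA.2] at hcard
    simp only at hcard
    omega

theorem measurable_upperOrderStat {d : ℕ} (r : ℕ) (hr : 1 ≤ r ∧ r ≤ d) :
    Measurable (fun x : Fin d → ℝ => upperOrderStat x r hr) := by
  refine measurable_of_Ioi fun u => ?_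
  have : (fun x : Fin d → ℝ => upperOrderStat x r hr) ⁻¹' Set.Ioi u =
      ⋃ A ∈ Finset.powersetCard r (Finset.univ : Finset (Fin d)),
        ⋂ l ∈ A, {x : Fin d → ℝ | u < x l} := by
    ext x
    simp only [Set.mem_preimage, Set.mem_Ioi, lt_upperOrderStat_iff, Set.mem_iUnion,
      Set.mem_iInter, Set.mem_ofPred_eq, exists_prop]
  rw [this]
  exact Finset.measurableSet_biUnion _ fun A _ => Finset.measurableSet_biInter _ fun l _ =>
    measurableSet_lt measurable_const (measurable_pi_apply l)

/-! ### Gaussian integration by parts -/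

theorem hasDerivAt_gaussianPDFReal_zero {v : ℝ≥0} (hv : v ≠ 0) (s : ℝ) :
    HasDerivAt (gaussianPDFReal 0 v) (-(s / v) * gaussianPDFReal 0 v s) s := by
  have hv' : (v : ℝ) ≠ 0 := by exact_mod_cast hv
  rw [gaussianPDFReal_def]
  have h1 : HasDerivAt (fun x : ℝ => -(x - 0) ^ 2 / (2 * (v : ℝ))) (-(s / v)) s := by
    have := (((hasDerivAt_id s).sub_const (0 : ℝ)).pow 2).neg.div_const (2 * (v : ℝ))
    refine this.congr_deriv ?_
    simp
    field_simp
  refine (h1.exp.const_mul (√(2 * Real.pi * v))⁻¹).congr_deriv ?_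
  ring

/-- Stein identity for a centred normal law. -/
theorem integral_mul_gaussianReal_eq {v : ℝ≥0} {h h' : ℝ → ℝ}
    (hd : ∀ s, HasDerivAt h (h' s) s) {B : ℝ} (hB : ∀ s, |h s| ≤ B) (hB' : ∀ s, |h' s| ≤ B) :
    ∫ s, s * h s ∂(gaussianReal 0 v) = v * ∫ s, h' s ∂(gaussianReal 0 v) := by
  rcases eq_or_ne v 0 with rfl | hv
  · simp [gaussianReal_zero_var]
  have hv' : (v : ℝ) ≠ 0 := by exact_mod_cast hv
  have hmeas : Measurable h :=
    (continuous_iff_continuousAt.2 fun s => (hd s).continuousAt).measurable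
  have hmeas' : Measurable h' := by
    have : h' = deriv h := funext fun s => (hd s).deriv.symm
    rw [this]; exact measurable_deriv h
  have hid : Integrable (fun s : ℝ => s * gaussianPDFReal 0 v s) := by
    have : Integrable (fun s : ℝ => s) (gaussianReal 0 v) :=
      (memLp_id_gaussianReal (μ := 0) (v := v) 1).integrable le_rfl
    rw [gaussianReal_of_var_ne_zero _ hv, gaussianPDF_def] at this
    rw [integrable_withDensity_iff (by fun_prop) (by simp)] at this
    simpa [ENNReal.toReal_ofReal (gaussianPDFReal_nonneg 0 v _)] using this
  have key := integral_mul_deriv_eq_deriv_mul_of_integrable (u := h) (u' := h')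
    (v := gaussianPDFReal 0 v) (v' := fun s => -(s / v) * gaussianPDFReal 0 v s)
    (fun s _ => hd s) (fun s _ => hasDerivAt_gaussianPDFReal_zero hv s)
    ?_ ?_ ?_
  · rw [integral_gaussianReal_eq_integral_smul hv, integral_gaussianReal_eq_integral_smul hv]
    simp only [smul_eq_mul]
    have e1 : ∫ s, h s * (-(s / v) * gaussianPDFReal 0 v s) =
        -(v : ℝ)⁻¹ * ∫ s, gaussianPDFReal 0 v s * (s * h s) := by
      rw [← integral_const_mul]
      congr 1; ext s; field_simp
    have e2 : ∫ s, h' s * gaussianPDFReal 0 v s = ∫ s, gaussianPDFReal 0 v s * h' s := by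
      congr 1; ext s; ring
    rw [e1, e2] at key
    rw [neg_mul, neg_inj] at key
    rw [← key, ← mul_assoc, mul_inv_cancel₀ hv', one_mul]
  · have := (hid.const_mul (-(v : ℝ)⁻¹)).bdd_mul (c := B) hmeas.aestronglyMeasurable
      (Eventually.of_forall fun s => by simpa using hB s)
    refine this.congr (Eventually.of_forall fun s => ?_)
    simp only [Pi.mul_apply]
    field_simp
  · exact (integrable_gaussianPDFReal 0 v).bdd_mul (c := B) hmeas'.aestronglyMeasurable
      (Eventually.of_forall fun s => by simpa using hB' s)
  · exact (integrable_gaussianPDFReal 0 v).bdd_mul (c := B) hmeas.aestronglyMeasurable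
      (Eventually.of_forall fun s => by simpa using hB s)

/-- Gaussian integration by parts: if `V` is a centred real variable jointly Gaussian with `X`, and
`c` is the vector of covariances of `V` with `X`, then `E (V * F X)` is the expectation of the
derivative `F'` of `F` in direction `c`. Only differentiability along this direction is used. -/
theorem integral_mul_eq_of_hasGaussianLaw {Ω E : Type*} [MeasurableSpace Ω] {P : Measure Ω}
    [NormedAddCommGroup E] [NormedSpace ℝ E] [MeasurableSpace E] [BorelSpace E]
    [SecondCountableTopology E] [CompleteSpace E]
    {V : Ω → ℝ} {X : Ω → E} (hVX : HasGaussianLaw (fun ω => (V ω, X ω)) P)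
    (hV : ∫ ω, V ω ∂P = 0) {c : E}
    (hc : ∀ L : E →L[ℝ] ℝ, covariance V (fun ω => L (X ω)) P = L c)
    {F F' : E → ℝ} (hF : Measurable F) (hF' : Measurable F')
    (hd : ∀ x s, HasDerivAt (fun t : ℝ => F (x + t • c)) (F' (x + s • c)) s)
    {B : ℝ} (hB : ∀ x, |F x| ≤ B) (hB' : ∀ x, |F' x| ≤ B) :
    ∫ ω, V ω * F (X ω) ∂P = ∫ ω, F' (X ω) ∂P := by
  have hprob := hVX.isProbabilityMeasure
  have hVm := hVX.fst.aemeasurable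
  have hV2 := hVX.fst.memLp_two
  have hL2 : ∀ L : E →L[ℝ] ℝ, MemLp (fun ω => L (X ω)) 2 P := fun L =>
    (hVX.snd.map_fun L).memLp_two
  rcases eq_or_ne (variance V P) 0 with hv | hv
  · have hV0 : V =ᵐ[P] 0 := by
      have := ae_eq_integral_of_variance_eq_zero hV2 hv
      rw [hV] at this
      exact this
    have hc0 : c = 0 := by
      refine SeparatingDual.eq_zero_of_forall_dual_eq_zero (R := ℝ) fun L => ?_
      rw [← hc L, covariance]
      refine integral_eq_zero_of_ae ?_
      filter_upwards [hV0] with ω hω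
      simp [hω, hV]
    have hF0 : ∀ x, F' x = 0 := fun x => by
      have := hd x 0
      simp only [hc0, smul_zero, add_zero] at this
      exact this.unique (hasDerivAt_const _ _)
    simp only [hF0, integral_zero]
    refine integral_eq_zero_of_ae ?_
    filter_upwards [hV0] with ω hω
    simp [hω]
  set v := variance V P with hvdef
  have hv0 : 0 ≤ v := variance_nonneg _ _
  -- decompose `X = W + V • (v⁻¹ • c)` with `W` independent of `V`
  set W : Ω → E := fun ω => X ω - V ω • (v⁻¹ • c) with hW
  have hVW : HasGaussianLaw (fun ω => (V ω, W ω)) P := by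
    let T : ℝ × E →L[ℝ] ℝ × E := (ContinuousLinearMap.fst ℝ ℝ E).prod
      (ContinuousLinearMap.snd ℝ ℝ E -
        (ContinuousLinearMap.fst ℝ ℝ E).smulRight (v⁻¹ • c))
    exact hVX.map T
  have hind : IndepFun V W P := by
    refine hVW.indepFun_of_covariance_strongDual fun L₁ L₂ => ?_
    have h1 : L₁ ∘ V = fun ω => L₁ 1 * V ω := by
      ext ω
      simp only [Function.comp_apply]
      conv_lhs => rw [← mul_one (V ω), ← smul_eq_mul, map_smul, smul_eq_mul, mul_comm]
    have h2 : L₂ ∘ W = fun ω => L₂ (X ω) - (v⁻¹ * L₂ c) * V ω := by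
      ext ω
      simp only [Function.comp_apply, hW, map_sub, map_smul, smul_eq_mul]
      ring
    rw [h1, h2, covariance_const_mul_left, covariance_fun_sub_right hV2 (hL2 L₂)
      (hV2.const_mul _), hc, covariance_const_mul_right, covariance_self hVm, ← hvdef]
    field_simp
    ring
  have hWm := hVW.snd.aemeasurable
  have hlawV : P.map V = gaussianReal 0 v.toNNReal := by
    rw [hVX.fst.map_eq_gaussianReal, hV]
  have hjoint : P.map (fun ω => (V ω, W ω)) = (gaussianReal 0 v.toNNReal).prod (P.map W) := by
    rw [(indepFun_iff_map_prod_eq_prod_map_map hVm hWm).1 hind, hlawV]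
  have hpW : IsProbabilityMeasure (P.map W) := Measure.isProbabilityMeasure_map hWm
  have hmeas : Measurable (fun p : ℝ × E => p.2 + p.1 • (v⁻¹ • c)) := by fun_prop
  have hXW : ∀ ω, X ω = W ω + V ω • (v⁻¹ • c) := fun ω => by simp [hW]
  have hint : Integrable (fun p : ℝ × E => p.1 * F (p.2 + p.1 • (v⁻¹ • c)))
      ((gaussianReal 0 v.toNNReal).prod (P.map W)) := by
    have h1 : Integrable (fun p : ℝ × E => p.1) ((gaussianReal 0 v.toNNReal).prod (P.map W)) :=
      ((memLp_id_gaussianReal (μ := 0) (v := v.toNNReal) 1).integrable le_rfl).comp_fst _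
    have := h1.bdd_mul (c := B) (hF.comp hmeas).aestronglyMeasurable
      (Eventually.of_forall fun s => by simpa using hB _)
    refine this.congr (Eventually.of_forall fun s => ?_)
    simp [mul_comm]
  have hint' : Integrable (fun p : ℝ × E => F' (p.2 + p.1 • (v⁻¹ • c)))
      ((gaussianReal 0 v.toNNReal).prod (P.map W)) :=
    Integrable.of_bound (hF'.comp hmeas).aestronglyMeasurable B
      (Eventually.of_forall fun s => by simpa using hB' _)
  calc ∫ ω, V ω * F (X ω) ∂P
      = ∫ p, p.1 * F (p.2 + p.1 • (v⁻¹ • c)) ∂(P.map (fun ω => (V ω, W ω))) := by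
        rw [integral_map (by fun_prop) (by fun_prop)]
        simp only [← hXW]
    _ = ∫ w, ∫ s, s * F (w + s • (v⁻¹ • c)) ∂(gaussianReal 0 v.toNNReal) ∂(P.map W) := by
        rw [hjoint, integral_prod_symm _ hint]
    _ = ∫ w, ∫ s, F' (w + s • (v⁻¹ • c)) ∂(gaussianReal 0 v.toNNReal) ∂(P.map W) := by
        congr 1
        ext w
        have hder : ∀ s, HasDerivAt (fun s : ℝ => F (w + s • (v⁻¹ • c)))
            (v⁻¹ * F' (w + s • (v⁻¹ • c))) s := fun s => by
          have h1 := hd w (s * v⁻¹)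
          have h2 : HasDerivAt (fun s : ℝ => s * v⁻¹) v⁻¹ s := by
            simpa using (hasDerivAt_id s).mul_const v⁻¹
          have := h1.comp s h2
          simp only [Function.comp_def, mul_smul] at this
          rw [mul_comm]
          exact this
        have hBpos : 0 ≤ B := (abs_nonneg _).trans (hB 0)
        rw [integral_mul_gaussianReal_eq hder (B := max B (v⁻¹ * B))
          (fun s => (hB _).trans (le_max_left _ _)) (fun s => ?_), integral_const_mul,
          Real.coe_toNNReal _ hv0, ← mul_assoc, mul_inv_cancel₀ hv, one_mul]
        rw [abs_mul, abs_of_nonneg (inv_nonneg.2 hv0)]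
        exact (mul_le_mul_of_nonneg_left (hB' _) (inv_nonneg.2 hv0)).trans (le_max_right _ _)
    _ = ∫ p, F' (p.2 + p.1 • (v⁻¹ • c)) ∂(P.map (fun ω => (V ω, W ω))) := by
        rw [hjoint, integral_prod_symm _ hint']
    _ = ∫ ω, F' (X ω) ∂P := by
        have hm' : Measurable (fun p : ℝ × E => F' (p.2 + p.1 • (v⁻¹ • c))) := hF'.comp hmeas
        rw [integral_map (by fun_prop) hm'.aestronglyMeasurable]
        simp only [← hXW]

/-- The covariances with the entries of an array determine those with all linear functionals. -/
theorem covariance_dual_eq {Ω κ ι : Type*} [MeasurableSpace Ω] {P : Measure Ω}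
    [IsProbabilityMeasure P] [Fintype κ] [Fintype ι] [DecidableEq κ] [DecidableEq ι]
    {V : Ω → ℝ} {X : Ω → κ → ι → ℝ} (hV : MemLp V 2 P)
    (hX : ∀ k l, MemLp (fun ω => X ω k l) 2 P) {c : κ → ι → ℝ}
    (hc : ∀ k l, covariance V (fun ω => X ω k l) P = c k l) (L : (κ → ι → ℝ) →L[ℝ] ℝ) :
    covariance V (fun ω => L (X ω)) P = L c := by
  have hL : ∀ x : κ → ι → ℝ, L x = ∑ k, ∑ l, L (Pi.single k (Pi.single l 1)) * x k l := by
    intro x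
    have hx : x = ∑ k, ∑ l, x k l • Pi.single k (Pi.single l (1 : ℝ)) := by
      ext k l
      simp [Finset.sum_apply, Pi.single_apply, ite_apply]
    conv_lhs => rw [hx]
    simp only [map_sum, map_smul, smul_eq_mul, mul_comm]
  have h1 : (fun ω => L (X ω)) =
      fun ω => ∑ k, ∑ l, L (Pi.single k (Pi.single l 1)) * X ω k l := by
    ext ω; exact hL _
  rw [h1, covariance_fun_sum_right (fun k => memLp_finsetSum _ fun l _ => (hX k l).const_mul _) hV,
    hL c]
  refine Finset.sum_congr rfl fun k _ => ?_
  rw [covariance_fun_sum_right (fun l => (hX k l).const_mul _) hV]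
  refine Finset.sum_congr rfl fun l _ => ?_
  rw [covariance_const_mul_right, hc]

theorem fderiv_apply_eq_sum {ι : Type*} [Fintype ι] [DecidableEq ι] (T : (ι → ℝ) →L[ℝ] ℝ)
    (v : ι → ℝ) : T v = ∑ l, v l * T (Pi.single l 1) := by
  have hv : v = ∑ l, v l • Pi.single l (1 : ℝ) := by
    ext l
    simp [Finset.sum_apply, Pi.single_apply]
  conv_lhs => rw [hv]
  simp only [map_sum, map_smul, smul_eq_mul]

/-- The partial derivative of `∏ k, g k (x k)` with respect to the entry `x k l`. -/
noncomputable def prodPartial {κ ι : Type*} [Fintype κ] [DecidableEq κ] [Fintype ι]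
    [DecidableEq ι] (g : κ → (ι → ℝ) → ℝ) (k : κ) (l : ι) (x : κ → ι → ℝ) : ℝ :=
  fderiv ℝ (g k) (x k) (Pi.single l 1) * ∏ k' ∈ Finset.univ.erase k, g k' (x k')

theorem hasDerivAt_finset_prod_comp {κ ι : Type*} [DecidableEq κ] [Fintype ι] [Finite κ]
    {g : κ → (ι → ℝ) → ℝ} (hg : ∀ k, ContDiff ℝ 1 (g k)) (s : Finset κ)
    {y : ℝ → κ → ι → ℝ} {y' : κ → ι → ℝ} {t : ℝ} (hy : HasDerivAt y y' t) :
    HasDerivAt (fun t => ∏ k ∈ s, g k (y t k))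
      (∑ k ∈ s, (∏ k' ∈ s.erase k, g k' (y t k')) * fderiv ℝ (g k) (y t k) (y' k)) t := by
  have h1 : ∀ k ∈ s, HasDerivAt (fun t => g k (y t k)) (fderiv ℝ (g k) (y t k) (y' k)) t := by
    intro k _
    have h2 : HasFDerivAt (g k) (fderiv ℝ (g k) (y t k)) (y t k) :=
      ((hg k).differentiable (by simp)).differentiableAt.hasFDerivAt
    exact h2.comp_hasDerivAt t (hasDerivAt_pi.1 hy k)
  have := HasDerivAt.fun_finsetProd h1
  simpa only [smul_eq_mul] using this

theorem hasDerivAt_prod_comp {κ ι : Type*} [Fintype κ] [DecidableEq κ] [Fintype ι]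
    [DecidableEq ι] {g : κ → (ι → ℝ) → ℝ} (hg : ∀ k, ContDiff ℝ 1 (g k))
    {y : ℝ → κ → ι → ℝ} {y' : κ → ι → ℝ} {t : ℝ} (hy : HasDerivAt y y' t) :
    HasDerivAt (fun t => ∏ k, g k (y t k)) (∑ k, ∑ l, y' k l * prodPartial g k l (y t)) t := by
  refine (hasDerivAt_finset_prod_comp hg Finset.univ hy).congr_deriv ?_
  refine Finset.sum_congr rfl fun k _ => ?_
  rw [fderiv_apply_eq_sum, Finset.mul_sum]
  refine Finset.sum_congr rfl fun l _ => ?_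
  rw [prodPartial]
  ring

theorem abs_prod_le_one {κ : Type*} (s : Finset κ) {a : κ → ℝ} (h0 : ∀ k, 0 ≤ a k)
    (h1 : ∀ k, a k ≤ 1) : |∏ k ∈ s, a k| ≤ 1 := by
  rw [abs_of_nonneg (Finset.prod_nonneg fun k _ => h0 k)]
  exact Finset.prod_le_one (fun k _ => h0 k) fun k _ => h1 k

/-! ### Comparison along a path of Gaussian arrays -/

section Interpolation

variable {Ω κ ι : Type*} [MeasurableSpace Ω] {P : Measure Ω}

/-- The point with angle `θ` on the quarter circle from `Z` (at `θ = 0`) to `X` (at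
`θ = π / 2`). -/
noncomputable def interp (X Z : Ω → κ → ι → ℝ) (θ : ℝ) (ω : Ω) : κ → ι → ℝ :=
  Real.cos θ • Z ω + Real.sin θ • X ω

theorem hasGaussianLaw_interp [Fintype κ] [Fintype ι] {X Z : Ω → κ → ι → ℝ}
    (hXZ : HasGaussianLaw (fun ω => (X ω, Z ω)) P) (θ : ℝ) :
    HasGaussianLaw (interp X Z θ) P := by
  let T : (κ → ι → ℝ) × (κ → ι → ℝ) →L[ℝ] (κ → ι → ℝ) :=
    Real.cos θ • ContinuousLinearMap.snd ℝ _ _ + Real.sin θ • ContinuousLinearMap.fst ℝ _ _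
  exact hXZ.map T

theorem covariance_interp [IsProbabilityMeasure P] {X Z : Ω → κ → ι → ℝ}
    (hX : ∀ k l, MemLp (fun ω => X ω k l) 2 P) (hZ : ∀ k l, MemLp (fun ω => Z ω k l) 2 P)
    (hcXZ : ∀ k l k' l', covariance (fun ω => X ω k l) (fun ω => Z ω k' l') P = 0)
    (a b : ℝ) (θ : ℝ) (k : κ) (l : ι) (k' : κ) (l' : ι) :
    covariance (fun ω => a * Z ω k l + b * X ω k l) (fun ω => interp X Z θ ω k' l') P =
      a * Real.cos θ * covariance (fun ω => Z ω k l) (fun ω => Z ω k' l') P +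
      b * Real.sin θ * covariance (fun ω => X ω k l) (fun ω => X ω k' l') P := by
  have h0 : covariance (fun ω => Z ω k l) (fun ω => X ω k' l') P = 0 := by
    rw [covariance_comm, hcXZ]
  have e : (fun ω => interp X Z θ ω k' l') =
      (fun ω => Real.cos θ * Z ω k' l') + fun ω => Real.sin θ * X ω k' l' := by
    ext ω; simp [interp]
  have e' : (fun ω => a * Z ω k l + b * X ω k l) =
      (fun ω => a * Z ω k l) + fun ω => b * X ω k l := rfl
  rw [e, e', covariance_add_left ((hZ k l).const_mul _) ((hX k l).const_mul _)
    (((hZ k' l').const_mul _).add ((hX k' l').const_mul _)),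
    covariance_add_right ((hZ k l).const_mul _) ((hZ k' l').const_mul _) ((hX k' l').const_mul _),
    covariance_add_right ((hX k l).const_mul _) ((hZ k' l').const_mul _) ((hX k' l').const_mul _)]
  simp only [covariance_const_mul_left, covariance_const_mul_right, hcXZ, h0]
  ring

variable [Fintype κ] [Fintype ι] [DecidableEq κ] [DecidableEq ι]

theorem abs_prodPartial_le {g : κ → (ι → ℝ) → ℝ} (h0 : ∀ k x, 0 ≤ g k x)
    (h1 : ∀ k x, g k x ≤ 1) {L : ℝ} (hL : ∀ k x l, |fderiv ℝ (g k) x (Pi.single l 1)| ≤ L)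
    (k : κ) (l : ι) (x : κ → ι → ℝ) : |prodPartial g k l x| ≤ L := by
  rw [prodPartial, abs_mul]
  calc _ ≤ L * 1 := mul_le_mul (hL _ _ _) (abs_prod_le_one _ (fun k => h0 k _) fun k => h1 k _)
        (abs_nonneg _) ((abs_nonneg _).trans (hL k (x k) l))
    _ = L := mul_one L

theorem continuous_prodPartial {g : κ → (ι → ℝ) → ℝ} (hg : ∀ k, ContDiff ℝ 1 (g k))
    (k : κ) (l : ι) : Continuous (prodPartial g k l) := by
  have h1 : ∀ k, Continuous (fun x : κ → ι → ℝ => g k (x k)) := fun k =>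
    (hg k).continuous.comp (continuous_apply k)
  have h2 : Continuous (fun x : κ → ι → ℝ => fderiv ℝ (g k) (x k) (Pi.single l 1)) :=
    (((hg k).continuous_fderiv (by simp)).comp (continuous_apply k)).clm_apply continuous_const
  exact h2.mul (continuous_finsetProd _ fun k _ => h1 k)

/-- The derivative of `prodPartial g k l` in a direction that leaves the row `k` fixed, so that no
second derivative of `g k` occurs. -/
theorem hasDerivAt_prodPartial {g : κ → (ι → ℝ) → ℝ} (hg : ∀ k, ContDiff ℝ 1 (g k))
    (k : κ) (l : ι) {c : κ → ι → ℝ} (hc : c k = 0) (x : κ → ι → ℝ) (s : ℝ) :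
    HasDerivAt (fun t : ℝ => prodPartial g k l (x + t • c))
      (fderiv ℝ (g k) ((x + s • c) k) (Pi.single l 1) * ∑ k' ∈ Finset.univ.erase k,
        (∏ k'' ∈ (Finset.univ.erase k).erase k', g k'' ((x + s • c) k'')) *
          fderiv ℝ (g k') ((x + s • c) k') (c k')) s := by
  have hy : HasDerivAt (fun t : ℝ => x + t • c) c s := by
    simpa using ((hasDerivAt_id s).smul_const c).const_add x
  have hk : ∀ t : ℝ, (x + t • c) k = x k := fun t => by simp [hc]
  have := (hasDerivAt_finset_prod_comp hg (Finset.univ.erase k) hy).const_mul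
    (fderiv ℝ (g k) (x k) (Pi.single l 1))
  simp only [prodPartial, hk]
  exact this

open Finset in
/-- One term of the derivative along the path. The variable `V` is correlated only with the other
entries of its column and not with its own row `k`, so integration by parts differentiates a
second factor `g k'`, never `g k` twice. -/
theorem abs_integral_mul_prodPartial_le {V : Ω → ℝ} {X : Ω → κ → ι → ℝ}
    (hVX : HasGaussianLaw (fun ω => (V ω, X ω)) P) (hXm : Measurable X)
    (hV : ∫ ω, V ω ∂P = 0) (k : κ) (l : ι) (R : κ → ℝ)
    (hc : ∀ k' l', covariance V (fun ω => X ω k' l') P = if k' ≠ k ∧ l' = l then R k' else 0)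
    {g : κ → (ι → ℝ) → ℝ} (hg : ∀ k, ContDiff ℝ 1 (g k)) (h0 : ∀ k x, 0 ≤ g k x)
    (h1 : ∀ k x, g k x ≤ 1) {B : κ → Set (ι → ℝ)} (hB : ∀ k, MeasurableSet (B k))
    {L : ℝ} (hL0 : 0 ≤ L)
    (hL : ∀ k x l, |fderiv ℝ (g k) x (Pi.single l 1)| ≤ (B k).indicator (fun _ => L) x) :
    |∫ ω, V ω * prodPartial g k l (X ω) ∂P| ≤
      ∑ k' ∈ univ.erase k, |R k'| * L ^ 2 * P.real {ω | X ω k ∈ B k ∧ X ω k' ∈ B k'} := by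
  have hprob := hVX.isProbabilityMeasure
  have hL' : ∀ k x l, |fderiv ℝ (g k) x (Pi.single l 1)| ≤ L := fun k x l =>
    (hL k x l).trans (Set.indicator_le_self' (fun _ _ => hL0) x)
  set c : κ → ι → ℝ := fun k' => if k' ≠ k then Pi.single l (R k') else 0 with hcdef
  have hck : c k = 0 := by simp [hcdef]
  have hck' : ∀ k', k' ≠ k → c k' = Pi.single l (R k') := fun k' h => by simp [hcdef, h]
  set F' : (κ → ι → ℝ) → ℝ := fun x => fderiv ℝ (g k) (x k) (Pi.single l 1) *
    ∑ k' ∈ univ.erase k, (∏ k'' ∈ (univ.erase k).erase k', g k'' (x k'')) *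
      fderiv ℝ (g k') (x k') (c k') with hF'
  have hsingle : ∀ k' ∈ univ.erase k, ∀ x, fderiv ℝ (g k') x (c k') =
      R k' * fderiv ℝ (g k') x (Pi.single l 1) := by
    intro k' hk' x
    rw [hck' k' (ne_of_mem_erase hk')]
    have : (Pi.single l (R k') : ι → ℝ) = R k' • Pi.single l (1 : ℝ) := by
      rw [← Pi.single_smul]; simp
    rw [this, map_smul, smul_eq_mul]
  have hbound : ∀ x, |F' x| ≤ ∑ k' ∈ univ.erase k,
      |R k'| * L ^ 2 * ({x | x k ∈ B k ∧ x k' ∈ B k'} : Set (κ → ι → ℝ)).indicator 1 x := by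
    intro x
    simp only [hF']
    rw [mul_sum]
    refine (abs_sum_le_sum_abs _ _).trans (sum_le_sum fun k' hk' => ?_)
    rw [hsingle k' hk', abs_mul, abs_mul, abs_mul]
    have a1 := hL k (x k) l
    have a2 := hL k' (x k') l
    have a3 := abs_prod_le_one ((univ.erase k).erase k') (fun k => h0 k (x k)) fun k => h1 k (x k)
    calc _ ≤ (B k).indicator (fun _ => L) (x k) *
            (1 * (|R k'| * (B k').indicator (fun _ => L) (x k'))) := by
          gcongr
          exact Set.indicator_nonneg (fun _ _ => hL0) _
      _ = _ := by
          by_cases c1 : x k ∈ B k <;> by_cases c2 : x k' ∈ B k' <;>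
            simp [Set.indicator, c1, c2]
          ring
  have hbound' : ∀ x, |F' x| ≤ ∑ k' ∈ univ.erase k, |R k'| * L ^ 2 := fun x =>
    (hbound x).trans (sum_le_sum fun k' _ => by
      refine mul_le_of_le_one_right (by positivity) ?_
      exact Set.indicator_le_self' (fun _ _ => zero_le_one) x)
  have hcontg : ∀ k, Continuous (fun x : κ → ι → ℝ => g k (x k)) := fun k =>
    (hg k).continuous.comp (continuous_apply k)
  have hcontd : ∀ k, ∀ v : ι → ℝ, Continuous (fun x : κ → ι → ℝ => fderiv ℝ (g k) (x k) v) :=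
    fun k v =>
    (((hg k).continuous_fderiv (by simp)).comp (continuous_apply k)).clm_apply continuous_const
  have hF'cont : Continuous F' :=
    (hcontd k _).mul (continuous_finsetSum _ fun k' _ =>
      (continuous_finsetProd _ fun k'' _ => hcontg k'').mul (hcontd k' _))
  have key : ∫ ω, V ω * prodPartial g k l (X ω) ∂P = ∫ ω, F' (X ω) ∂P := by
    refine integral_mul_eq_of_hasGaussianLaw hVX hV (c := c) (fun T => ?_)
      (continuous_prodPartial hg k l).measurable hF'cont.measurable
      (fun x s => hasDerivAt_prodPartial hg k l hck x s)
      (B := max L (∑ k' ∈ univ.erase k, |R k'| * L ^ 2))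
      (fun x => (abs_prodPartial_le h0 h1 hL' k l x).trans (le_max_left _ _))
      (fun x => (hbound' x).trans (le_max_right _ _))
    refine covariance_dual_eq hVX.fst.memLp_two (fun k l => ((hVX.snd.eval k).eval l).memLp_two)
      (fun k' l' => ?_) T
    rw [hc k' l']
    by_cases hk : k' = k
    · simp [hk, hck]
    · simp [hk, hck' k' hk, Pi.single_apply]
  rw [key]
  have hset : ∀ k', MeasurableSet ({x | x k ∈ B k ∧ x k' ∈ B k'} : Set (κ → ι → ℝ)) := fun k' =>
    ((hB k).preimage (measurable_pi_apply k)).inter ((hB k').preimage (measurable_pi_apply k'))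
  have hind : ∀ k', Integrable (fun ω => |R k'| * L ^ 2 *
      ({x | x k ∈ B k ∧ x k' ∈ B k'} : Set (κ → ι → ℝ)).indicator 1 (X ω)) P := fun k' => by
    refine Integrable.const_mul ?_ _
    refine Integrable.of_bound ?_ 1 (Eventually.of_forall fun ω => ?_)
    · exact ((measurable_one.indicator (hset k')).comp hXm).aestronglyMeasurable
    · by_cases hω : X ω ∈ ({x | x k ∈ B k ∧ x k' ∈ B k'} : Set (κ → ι → ℝ)) <;> simp [hω]
  calc |∫ ω, F' (X ω) ∂P| ≤ ∫ ω, |F' (X ω)| ∂P := abs_integral_le_integral_abs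
    _ ≤ ∫ ω, ∑ k' ∈ univ.erase k, |R k'| * L ^ 2 *
          ({x | x k ∈ B k ∧ x k' ∈ B k'} : Set (κ → ι → ℝ)).indicator 1 (X ω) ∂P :=
        integral_mono_of_nonneg (Eventually.of_forall fun _ => abs_nonneg _)
          (integrable_finsetSum _ fun k' _ => hind k') (Eventually.of_forall fun ω => hbound _)
    _ = _ := by
        rw [integral_finsetSum _ fun k' _ => hind k']
        refine sum_congr rfl fun k' _ => ?_
        rw [integral_const_mul]
        congr 1
        have : (fun ω => ({x | x k ∈ B k ∧ x k' ∈ B k'} : Set (κ → ι → ℝ)).indicator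
            (1 : (κ → ι → ℝ) → ℝ) (X ω)) =
            ({ω | X ω k ∈ B k ∧ X ω k' ∈ B k'} : Set Ω).indicator 1 := by
          ext ω; simp [Set.indicator]
        rw [this]
        exact integral_indicator_one (hXm (hset k'))

open Finset in
/-- Comparison of the expectations of a product of smooth cutoffs of the rows, for an array `X`
with independent columns of covariance `R` and an array `Z` of independent standard normal
variables. The set `B k` supports the gradient of `g k`, and `q k k'` bounds, along the path, the
probability that the rows `k` and `k'` lie in these sets. The factor `2` is a bound for the length
`π / 2` of the path. -/
theorem abs_integral_prod_sub_le {X Z : Ω → κ → ι → ℝ}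
    (hXZ : HasGaussianLaw (fun ω => (X ω, Z ω)) P) (hXm : Measurable X) (hZm : Measurable Z)
    (hX0 : ∀ k l, ∫ ω, X ω k l ∂P = 0) (hZ0 : ∀ k l, ∫ ω, Z ω k l ∂P = 0)
    (R : κ → κ → ℝ) (hR : ∀ k, R k k = 1)
    (hcX : ∀ k l k' l', covariance (fun ω => X ω k l) (fun ω => X ω k' l') P =
      if l' = l then R k k' else 0)
    (hcZ : ∀ k l k' l', covariance (fun ω => Z ω k l) (fun ω => Z ω k' l') P =
      if l' = l ∧ k' = k then 1 else 0)
    (hcXZ : ∀ k l k' l', covariance (fun ω => X ω k l) (fun ω => Z ω k' l') P = 0)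
    {g : κ → (ι → ℝ) → ℝ} (hg : ∀ k, ContDiff ℝ 1 (g k)) (h0 : ∀ k x, 0 ≤ g k x)
    (h1 : ∀ k x, g k x ≤ 1) {B : κ → Set (ι → ℝ)} (hB : ∀ k, MeasurableSet (B k))
    {L : ℝ} (hL0 : 0 ≤ L)
    (hL : ∀ k x l, |fderiv ℝ (g k) x (Pi.single l 1)| ≤ (B k).indicator (fun _ => L) x)
    (q : κ → κ → ℝ)
    (hq : ∀ θ k k', k ≠ k' →
      P.real {ω | interp X Z θ ω k ∈ B k ∧ interp X Z θ ω k' ∈ B k'} ≤ q k k') :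
    |∫ ω, ∏ k, g k (X ω k) ∂P - ∫ ω, ∏ k, g k (Z ω k) ∂P| ≤
      2 * (Fintype.card ι * L ^ 2 * ∑ k, ∑ k' ∈ univ.erase k, |R k k'| * q k k') := by
  have hprob := hXZ.isProbabilityMeasure
  have hX2 : ∀ k l, MemLp (fun ω => X ω k l) 2 P := fun k l =>
    ((hXZ.fst.eval k).eval l).memLp_two
  have hZ2 : ∀ k l, MemLp (fun ω => Z ω k l) 2 P := fun k l =>
    ((hXZ.snd.eval k).eval l).memLp_two
  have hL' : ∀ k x l, |fderiv ℝ (g k) x (Pi.single l 1)| ≤ L := fun k x l =>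
    (hL k x l).trans (Set.indicator_le_self' (fun _ _ => hL0) x)
  have hIm : ∀ θ, Measurable (interp X Z θ) := fun θ =>
    (hZm.const_smul (Real.cos θ)).add (hXm.const_smul (Real.sin θ))
  -- the velocity of the interpolation path
  set V : ℝ → Ω → κ → ι → ℝ := fun θ ω => -Real.sin θ • Z ω + Real.cos θ • X ω with hV
  have hVm : ∀ θ, Measurable (V θ) := fun θ =>
    (hZm.const_smul (-Real.sin θ)).add (hXm.const_smul (Real.cos θ))
  have hder : ∀ ω θ, HasDerivAt (fun θ => interp X Z θ ω) (V θ ω) θ := fun ω θ =>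
    ((Real.hasDerivAt_cos θ).smul_const (Z ω)).add ((Real.hasDerivAt_sin θ).smul_const (X ω))
  have hcontf : Continuous (fun x : κ → ι → ℝ => ∏ k, g k (x k)) :=
    continuous_finsetProd _ fun k _ => (hg k).continuous.comp (continuous_apply k)
  have hVint : ∀ θ k l, Integrable (fun ω => V θ ω k l) P := fun θ k l => by
    have a1 := (((hZ2 k l).integrable one_le_two).const_mul (-Real.sin θ)).add
      (((hX2 k l).integrable one_le_two).const_mul (Real.cos θ))
    exact a1
  have hterm : ∀ θ k l, Integrable (fun ω => V θ ω k l * prodPartial g k l (interp X Z θ ω)) P :=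
    fun θ k l => by
    have := (hVint θ k l).bdd_mul (c := L)
      (((continuous_prodPartial hg k l).measurable.comp (hIm θ)).aestronglyMeasurable)
      (Eventually.of_forall fun ω => by
        simpa using abs_prodPartial_le h0 h1 hL' k l (interp X Z θ ω))
    refine this.congr (Eventually.of_forall fun ω => ?_)
    simp [mul_comm]
  -- derivative of the interpolated expectation
  have hφ : ∀ θ, HasDerivAt (fun θ => ∫ ω, ∏ k, g k (interp X Z θ ω k) ∂P)
      (∫ ω, ∑ k, ∑ l, V θ ω k l * prodPartial g k l (interp X Z θ ω) ∂P) θ := by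
    intro θ
    refine (hasDerivAt_integral_of_dominated_loc_of_deriv_le (s := Set.univ)
      (F := fun θ ω => ∏ k, g k (interp X Z θ ω k))
      (F' := fun θ ω => ∑ k, ∑ l, V θ ω k l * prodPartial g k l (interp X Z θ ω))
      (bound := fun ω => ∑ k, ∑ l, (|Z ω k l| + |X ω k l|) * L) Filter.univ_mem
      (Eventually.of_forall fun θ => (hcontf.measurable.comp (hIm θ)).aestronglyMeasurable)
      ?_ ?_ ?_ ?_ ?_).2
    · refine Integrable.of_bound (hcontf.measurable.comp (hIm θ)).aestronglyMeasurable 1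
        (Eventually.of_forall fun ω => ?_)
      exact abs_prod_le_one _ (fun k => h0 k _) fun k => h1 k _
    · exact (integrable_finsetSum _ fun k _ => integrable_finsetSum _ fun l _ =>
        hterm θ k l).aestronglyMeasurable
    · refine Eventually.of_forall fun ω θ _ => ?_
      refine (norm_sum_le _ _).trans (sum_le_sum fun k _ => (norm_sum_le _ _).trans
        (sum_le_sum fun l _ => ?_))
      rw [Real.norm_eq_abs, abs_mul]
      refine mul_le_mul ?_ (abs_prodPartial_le h0 h1 hL' k l _) (abs_nonneg _) (by positivity)
      have e : V θ ω k l = -Real.sin θ * Z ω k l + Real.cos θ * X ω k l := by simp [hV]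
      rw [e]
      refine (abs_add_le _ _).trans ?_
      rw [abs_mul, abs_mul, abs_neg]
      exact add_le_add (mul_le_of_le_one_left (abs_nonneg _) (Real.abs_sin_le_one θ))
        (mul_le_of_le_one_left (abs_nonneg _) (Real.abs_cos_le_one θ))
    · exact integrable_finsetSum _ fun k _ => integrable_finsetSum _ fun l _ =>
        (((hZ2 k l).integrable one_le_two).abs.add
          ((hX2 k l).integrable one_le_two).abs).mul_const L
    · exact Eventually.of_forall fun ω θ _ => hasDerivAt_prod_comp hg (hder ω θ)
  set C := Fintype.card ι * L ^ 2 * ∑ k, ∑ k' ∈ univ.erase k, |R k k'| * q k k' with hC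
  have hφ' : ∀ θ, ‖∫ ω, ∑ k, ∑ l, V θ ω k l * prodPartial g k l (interp X Z θ ω) ∂P‖ ≤ C := by
    intro θ
    rw [integral_finsetSum _ fun k _ => integrable_finsetSum _ fun l _ => hterm θ k l]
    have hCeq : C = ∑ k, ∑ _l : ι, ∑ k' ∈ univ.erase k, |R k k'| * L ^ 2 * q k k' := by
      rw [hC, mul_sum]
      refine sum_congr rfl fun k _ => ?_
      rw [sum_const, card_univ, nsmul_eq_mul, mul_assoc, mul_sum]
      congr 1
      refine sum_congr rfl fun k' _ => ?_
      ring
    rw [hCeq]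
    refine (norm_sum_le _ _).trans (sum_le_sum fun k _ => ?_)
    rw [integral_finsetSum _ fun l _ => hterm θ k l]
    refine (norm_sum_le _ _).trans (sum_le_sum fun l _ => ?_)
    rw [Real.norm_eq_abs]
    have hlaw : HasGaussianLaw (fun ω => (V θ ω k l, interp X Z θ ω)) P := by
      let T1 : (κ → ι → ℝ) × (κ → ι → ℝ) →L[ℝ] (κ → ι → ℝ) :=
        Real.cos θ • ContinuousLinearMap.snd ℝ _ _ + Real.sin θ • ContinuousLinearMap.fst ℝ _ _
      let T2 : (κ → ι → ℝ) × (κ → ι → ℝ) →L[ℝ] (κ → ι → ℝ) :=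
        (-Real.sin θ) • ContinuousLinearMap.snd ℝ _ _ +
          Real.cos θ • ContinuousLinearMap.fst ℝ _ _
      let T3 : (κ → ι → ℝ) × (κ → ι → ℝ) →L[ℝ] ℝ :=
        ((ContinuousLinearMap.proj (R := ℝ) (φ := fun _ : ι => ℝ) l).comp
          (ContinuousLinearMap.proj (R := ℝ) (φ := fun _ : κ => ι → ℝ) k)).comp T2
      exact hXZ.map (T3.prod T1)
    refine (abs_integral_mul_prodPartial_le hlaw (hIm θ) ?_ k l
      (fun k' => Real.sin θ * Real.cos θ * R k k') ?_ hg h0 h1 hB hL0 hL).trans ?_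
    · have : ∀ ω, V θ ω k l = -Real.sin θ * Z ω k l + Real.cos θ * X ω k l := fun ω => by
        simp [hV]
      simp only [this]
      rw [integral_add (((hZ2 k l).integrable one_le_two).const_mul _)
        (((hX2 k l).integrable one_le_two).const_mul _), integral_const_mul, integral_const_mul,
        hX0, hZ0]
      simp
    · intro k' l'
      have := covariance_interp hX2 hZ2 hcXZ (-Real.sin θ) (Real.cos θ) θ k l k' l'
      have e : (fun ω => V θ ω k l) =
          fun ω => -Real.sin θ * Z ω k l + Real.cos θ * X ω k l := by
        ext ω; simp [hV]
      rw [e, this, hcX, hcZ]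
      by_cases c1 : l' = l <;> by_cases c2 : k' = k <;> simp [c1, c2, hR, mul_comm]
    · refine sum_le_sum fun k' hk' => ?_
      refine mul_le_mul ?_ (hq θ k k' (ne_of_mem_erase hk').symm) measureReal_nonneg
        (by positivity)
      refine mul_le_mul_of_nonneg_right ?_ (by positivity)
      rw [abs_mul, abs_mul]
      exact mul_le_of_le_one_left (abs_nonneg _)
        (mul_le_one₀ (Real.abs_sin_le_one θ) (abs_nonneg _) (Real.abs_cos_le_one θ))
  have hC0 : 0 ≤ C := (norm_nonneg _).trans (hφ' 0)
  have hmv := Convex.norm_image_sub_le_of_norm_hasDerivWithin_le (s := Set.univ)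
    (f := fun θ => ∫ ω, ∏ k, g k (interp X Z θ ω k) ∂P)
    (x := 0) (y := Real.pi / 2) (fun θ _ => (hφ θ).hasDerivWithinAt) (fun θ _ => hφ' θ)
    convex_univ (Set.mem_univ _) (Set.mem_univ _)
  simp only [interp, Real.cos_pi_div_two, Real.sin_pi_div_two, Real.cos_zero, Real.sin_zero,
    zero_smul, one_smul, zero_add, add_zero, sub_zero, Real.norm_eq_abs] at hmv
  refine hmv.trans ?_
  rw [abs_of_nonneg (by positivity), mul_comm]
  exact mul_le_mul_of_nonneg_right (by linarith [Real.pi_le_four]) hC0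

end Interpolation

/-! ### The standard normal tail -/

/-- The upper tail `P(N > t)` of a standard normal variable `N`. -/
noncomputable def gaussTail (t : ℝ) : ℝ := (gaussianReal 0 1).real (Set.Ioi t)

theorem gaussTail_nonneg (t : ℝ) : 0 ≤ gaussTail t := measureReal_nonneg

theorem gaussTail_antitone : Antitone gaussTail := fun _ _ h =>
  measureReal_mono (Set.Ioi_subset_Ioi h)

theorem gaussianPDFReal_zero_one (t : ℝ) :
    gaussianPDFReal 0 1 t = (√(2 * Real.pi))⁻¹ * Real.exp (-(t ^ 2 / 2)) := by
  simp [gaussianPDFReal_def, neg_div]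

theorem continuous_gaussianPDFReal_zero_one : Continuous (gaussianPDFReal 0 1) := by
  simp only [funext gaussianPDFReal_zero_one]
  fun_prop

theorem hasDerivAt_gaussTail (t : ℝ) : HasDerivAt gaussTail (-gaussianPDFReal 0 1 t) t := by
  have h : ∀ t, gaussTail t = gaussTail 0 - ∫ s in (0 : ℝ)..t, gaussianPDFReal 0 1 s := by
    intro t
    have e : ∀ t, gaussTail t = ∫ s in Set.Ioi t, gaussianPDFReal 0 1 s := fun t => by
      rw [gaussTail, Measure.real, gaussianReal_apply_eq_integral 0 one_ne_zero,
        ENNReal.toReal_ofReal (integral_nonneg fun s => gaussianPDFReal_nonneg 0 1 s)]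
    rw [e, e, ← intervalIntegral.integral_Ioi_sub_Ioi'
      (integrable_gaussianPDFReal 0 1).integrableOn (integrable_gaussianPDFReal 0 1).integrableOn]
    ring
  have h1 := (intervalIntegral.integral_hasDerivAt_right
    (continuous_gaussianPDFReal_zero_one.intervalIntegrable 0 t)
    (continuous_gaussianPDFReal_zero_one.stronglyMeasurableAtFilter _ _)
    continuous_gaussianPDFReal_zero_one.continuousAt).const_sub (gaussTail 0)
  rwa [← funext h] at h1

theorem tendsto_gaussTail_atTop : Tendsto gaussTail atTop (𝓝 0) := by
  have h : gaussTail = fun t => 1 - cdf (gaussianReal 0 1) t := by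
    ext t
    rw [gaussTail, cdf_eq_real, ← Set.compl_Iic, probReal_compl_eq_one_sub measurableSet_Iic]
  rw [h]
  simpa using (tendsto_cdf_atTop (gaussianReal 0 1)).const_sub 1

theorem tendsto_gaussianPDFReal_atTop : Tendsto (gaussianPDFReal 0 1) atTop (𝓝 0) := by
  simp only [funext gaussianPDFReal_zero_one]
  have h : Tendsto (fun t : ℝ => -(t ^ 2 / 2)) atTop atBot :=
    tendsto_neg_atTop_atBot.comp ((tendsto_pow_atTop two_ne_zero).atTop_div_const two_pos)
  simpa using (Real.tendsto_exp_atBot.comp h).const_mul (√(2 * Real.pi))⁻¹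

/-- Asymptotics of the Mills ratio. -/
theorem tendsto_gaussTail_div : Tendsto (fun t => gaussTail t / (gaussianPDFReal 0 1 t / t))
    atTop (𝓝 1) := by
  have hpos : ∀ t, 0 < gaussianPDFReal 0 1 t := fun t => gaussianPDFReal_pos 0 1 t one_ne_zero
  refine HasDerivAt.lhopital_zero_atTop (f' := fun t => -gaussianPDFReal 0 1 t)
    (g' := fun t => -(gaussianPDFReal 0 1 t * (1 + (t ^ 2)⁻¹)))
    (Eventually.of_forall hasDerivAt_gaussTail) ?_ ?_ tendsto_gaussTail_atTop ?_ ?_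
  · filter_upwards [eventually_gt_atTop 0] with t ht
    refine ((hasDerivAt_gaussianPDFReal_zero one_ne_zero t).div (hasDerivAt_id t)
      ht.ne').congr_deriv ?_
    simp only [NNReal.coe_one, id]
    field_simp
    ring
  · filter_upwards with t
    have := hpos t
    have : (0 : ℝ) < 1 + (t ^ 2)⁻¹ := by positivity
    exact (neg_neg_of_pos (by positivity)).ne
  · simpa [div_eq_mul_inv] using tendsto_gaussianPDFReal_atTop.mul tendsto_inv_atTop_zero
  · have h : Tendsto (fun t : ℝ => (1 + (t ^ 2)⁻¹)⁻¹) atTop (𝓝 (1 + 0)⁻¹) :=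
      ((tendsto_inv_atTop_zero.comp (tendsto_pow_atTop two_ne_zero)).const_add 1).inv₀ (by simp)
    simp only [add_zero, inv_one] at h
    refine h.congr fun t => ?_
    have := (hpos t).ne'
    have : (0 : ℝ) < 1 + (t ^ 2)⁻¹ := by positivity
    field_simp

theorem eventually_gaussTail_le :
    ∀ᶠ t in atTop, gaussTail t ≤ t⁻¹ * Real.exp (-(t ^ 2 / 2)) := by
  have hpi : (1 : ℝ) < √(2 * Real.pi) := by
    rw [Real.lt_sqrt zero_le_one]
    linarith [Real.pi_gt_three]
  filter_upwards [eventually_gt_atTop 0, tendsto_gaussTail_div.eventually_le_const hpi]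
    with t ht h
  have hpos : 0 < gaussianPDFReal 0 1 t := gaussianPDFReal_pos 0 1 t one_ne_zero
  rw [div_le_iff₀ (by positivity), gaussianPDFReal_zero_one] at h
  refine h.trans_eq ?_
  field_simp

theorem gaussianReal_le_smul {v w : ℝ≥0} (hv : v ≠ 0) (hvw : v ≤ w) :
    gaussianReal 0 v ≤ ENNReal.ofReal (√(w / v)) • gaussianReal 0 w := by
  have hw : w ≠ 0 := (lt_of_lt_of_le (pos_iff_ne_zero.2 hv) hvw).ne'
  have hv' : (0 : ℝ) < v := by exact_mod_cast pos_iff_ne_zero.2 hv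
  have hw' : (0 : ℝ) < w := by exact_mod_cast pos_iff_ne_zero.2 hw
  have hvw' : (v : ℝ) ≤ w := by exact_mod_cast hvw
  rw [gaussianReal_of_var_ne_zero 0 hv, gaussianReal_of_var_ne_zero 0 hw,
    ← withDensity_smul _ (measurable_gaussianPDF 0 w)]
  refine withDensity_mono (Eventually.of_forall fun x => ?_)
  simp only [gaussianPDF, Pi.smul_apply, smul_eq_mul]
  rw [← ENNReal.ofReal_mul (Real.sqrt_nonneg _)]
  refine ENNReal.ofReal_le_ofReal ?_
  simp only [gaussianPDFReal_def]
  have e : √(w / v : ℝ) * (√(2 * Real.pi * w))⁻¹ = (√(2 * Real.pi * v))⁻¹ := by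
    rw [← Real.sqrt_inv, ← Real.sqrt_inv, ← Real.sqrt_mul (by positivity)]
    congr 1
    field_simp
  rw [← mul_assoc, e]
  refine mul_le_mul_of_nonneg_left (Real.exp_le_exp.2 ?_) (by positivity)
  rw [neg_div, neg_div, neg_le_neg_iff]
  gcongr

theorem gaussianReal_Ioi {w : ℝ≥0} (hw : w ≠ 0) (u : ℝ) :
    gaussianReal 0 w (Set.Ioi u) = ENNReal.ofReal (gaussTail (u / √w)) := by
  have hw' : (0 : ℝ) < w := by exact_mod_cast pos_iff_ne_zero.2 hw
  have h := gaussianReal_map_const_mul (μ := 0) (v := 1) (√(w : ℝ))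
  have e : NNReal.mk (√(w : ℝ) ^ 2) (sq_nonneg _) * 1 = w := by
    ext; simp [Real.sq_sqrt hw'.le]
  rw [e, mul_zero] at h
  rw [← h, Measure.map_apply (by fun_prop) measurableSet_Ioi, gaussTail, ofReal_measureReal]
  congr 1
  ext x
  simp only [Set.mem_preimage, Set.mem_Ioi]
  rw [div_lt_iff₀' (Real.sqrt_pos.2 hw')]

theorem covariance_add_sub_eq {Ω : Type*} [MeasurableSpace Ω] {P : Measure Ω}
    [IsProbabilityMeasure P] {A B : Ω → ℝ} (mA : MemLp A 2 P) (mB : MemLp B 2 P) :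
    covariance (fun ω => A ω + B ω) (fun ω => A ω - B ω) P = variance A P - variance B P := by
  have a0 := covariance_add_left mA mB (mA.sub mB)
  have a1 := covariance_sub_right mA mA mB
  rw [covariance_self mA.1.aemeasurable] at a1
  change covariance (A + B) (A - B) P = _
  rw [a0, a1, covariance_sub_right mB mA mB, covariance_comm B A,
    covariance_self mB.1.aemeasurable]
  ring

theorem gaussianReal_prod_rotated {w : ℝ≥0} (hw : w ≠ 0) (u : ℝ) :
    (gaussianReal 0 w).prod (gaussianReal 0 w)
      {p | u < (√2)⁻¹ * (p.1 + p.2) ∧ u < (√2)⁻¹ * (p.1 - p.2)} =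
      ENNReal.ofReal (gaussTail (u / √w) ^ 2) := by
  set μ := (gaussianReal 0 w).prod (gaussianReal 0 w) with hμ
  have h2 : (√2 : ℝ)⁻¹ * (√2)⁻¹ = 1 / 2 := by
    rw [← mul_inv, Real.mul_self_sqrt zero_le_two, one_div]
  let T1 : ℝ × ℝ →L[ℝ] ℝ :=
    (√2)⁻¹ • (ContinuousLinearMap.fst ℝ ℝ ℝ + ContinuousLinearMap.snd ℝ ℝ ℝ)
  let T2 : ℝ × ℝ →L[ℝ] ℝ :=
    (√2)⁻¹ • (ContinuousLinearMap.fst ℝ ℝ ℝ - ContinuousLinearMap.snd ℝ ℝ ℝ)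
  have hid : HasGaussianLaw (fun p : ℝ × ℝ => p) μ := IsGaussian.hasGaussianLaw_id
  have hlaw : HasGaussianLaw (fun p => (T1 p, T2 p)) μ := hid.map (T1.prod T2)
  have m1 : MemLp (fun p : ℝ × ℝ => p.1) 2 μ := hid.fst.memLp_two
  have m2 : MemLp (fun p : ℝ × ℝ => p.2) 2 μ := hid.snd.memLp_two
  have hind0 : IndepFun (fun p : ℝ × ℝ => p.1) (fun p => p.2) μ :=
    indepFun_prod measurable_id measurable_id
  have c0 : covariance (fun p : ℝ × ℝ => p.1) (fun p => p.2) μ = 0 :=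
    hind0.covariance_eq_zero m1 m2
  have map1 : μ.map (fun p : ℝ × ℝ => p.1) = gaussianReal 0 w := by
    rw [hμ]; exact measurePreserving_fst.map_eq
  have map2 : μ.map (fun p : ℝ × ℝ => p.2) = gaussianReal 0 w := by
    rw [hμ]; exact measurePreserving_snd.map_eq
  have v1 : variance (fun p : ℝ × ℝ => p.1) μ = w := by
    rw [← variance_id_map (by fun_prop), map1, variance_id_gaussianReal]
  have v2 : variance (fun p : ℝ × ℝ => p.2) μ = w := by
    rw [← variance_id_map (by fun_prop), map2, variance_id_gaussianReal]
  have i1 : ∫ p : ℝ × ℝ, p.1 ∂μ = 0 := by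
    have := integral_map (μ := μ) (φ := fun p : ℝ × ℝ => p.1) (f := fun x : ℝ => x)
      (by fun_prop) (by fun_prop)
    rw [← this, map1, integral_id_gaussianReal]
  have i2 : ∫ p : ℝ × ℝ, p.2 ∂μ = 0 := by
    have := integral_map (μ := μ) (φ := fun p : ℝ × ℝ => p.2) (f := fun x : ℝ => x)
      (by fun_prop) (by fun_prop)
    rw [← this, map2, integral_id_gaussianReal]
  have e1 : ∀ p, T1 p = (√2)⁻¹ * (p.1 + p.2) := fun p => rfl
  have e2 : ∀ p, T2 p = (√2)⁻¹ * (p.1 - p.2) := fun p => rfl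
  have hcov : covariance (fun p => T1 p) (fun p => T2 p) μ = 0 := by
    simp only [e1, e2, covariance_const_mul_left, covariance_const_mul_right]
    rw [covariance_add_sub_eq m1 m2, v1, v2]
    ring
  have hind := hlaw.indepFun_of_covariance_eq_zero hcov
  have hmarg : ∀ T : ℝ × ℝ →L[ℝ] ℝ, ∫ p, T p ∂μ = 0 → variance (fun p => T p) μ = w →
      μ {p | u < T p} = ENNReal.ofReal (gaussTail (u / √w)) := by
    intro T hT hv
    have hm := (hid.map_fun T).map_eq_gaussianReal
    rw [hT, hv, Real.toNNReal_coe] at hm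
    rw [← gaussianReal_Ioi hw, ← hm, Measure.map_apply T.measurable measurableSet_Ioi]
    rfl
  have hm1 := hmarg T1 (by
    simp only [e1]
    rw [integral_const_mul, integral_add (m1.integrable one_le_two) (m2.integrable one_le_two),
      i1, i2]; simp) (by
    simp only [e1]
    rw [variance_const_mul, variance_fun_add m1 m2, v1, v2, c0, sq, h2]; ring)
  have hm2 := hmarg T2 (by
    simp only [e2]
    rw [integral_const_mul, integral_sub (m1.integrable one_le_two) (m2.integrable one_le_two),
      i1, i2]; simp) (by
    simp only [e2]
    rw [variance_const_mul, variance_fun_sub m1 m2, v1, v2, c0, sq, h2]; ring)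
  have := hind.measure_inter_preimage_eq_mul (Set.Ioi u) (Set.Ioi u) measurableSet_Ioi
    measurableSet_Ioi
  have e : {p : ℝ × ℝ | u < (√2)⁻¹ * (p.1 + p.2) ∧ u < (√2)⁻¹ * (p.1 - p.2)} =
      (fun p => T1 p) ⁻¹' Set.Ioi u ∩ (fun p => T2 p) ⁻¹' Set.Ioi u := rfl
  rw [e, this, sq, ENNReal.ofReal_mul (gaussTail_nonneg _)]
  exact congrArg₂ _ hm1 hm2

/-- The probability that two correlated standard normal variables `A` and `B` both exceed `u`. The
variables `(A + B) / √2` and `(A - B) / √2` are independent with variances `1 ± Cov(A, B)` in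
`[1 - q, 1 + q]`, so their densities are at most `√((1 + q) / (1 - q))` times that of variance
`1 + q`. For two independent variables of that variance, the inverse rotation gives back an
independent pair. -/
theorem measureReal_pair_le {Ω : Type*} [MeasurableSpace Ω] {P : Measure Ω} {A B : Ω → ℝ}
    (hAB : HasGaussianLaw (fun ω => (A ω, B ω)) P)
    (hA0 : ∫ ω, A ω ∂P = 0) (hB0 : ∫ ω, B ω ∂P = 0) (hA1 : variance A P = 1)
    (hB1 : variance B P = 1) {q : ℝ} (hq : |covariance A B P| ≤ q) (hq1 : q < 1) (u : ℝ) :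
    P.real {ω | u < A ω ∧ u < B ω} ≤
      (1 + q) / (1 - q) * gaussTail (u / √(1 + q)) ^ 2 := by
  have hprob := hAB.isProbabilityMeasure
  have hq0 : 0 ≤ q := (abs_nonneg _).trans hq
  set c := covariance A B P with hc
  obtain ⟨hcl, hcu⟩ := abs_le.1 hq
  have h2 : (√2 : ℝ)⁻¹ * (√2)⁻¹ = 1 / 2 := by
    rw [← mul_inv, Real.mul_self_sqrt zero_le_two, one_div]
  have mA : MemLp A 2 P := hAB.fst.memLp_two
  have mB : MemLp B 2 P := hAB.snd.memLp_two
  let T1 : ℝ × ℝ →L[ℝ] ℝ :=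
    (√2)⁻¹ • (ContinuousLinearMap.fst ℝ ℝ ℝ + ContinuousLinearMap.snd ℝ ℝ ℝ)
  let T2 : ℝ × ℝ →L[ℝ] ℝ :=
    (√2)⁻¹ • (ContinuousLinearMap.fst ℝ ℝ ℝ - ContinuousLinearMap.snd ℝ ℝ ℝ)
  set U : Ω → ℝ := fun ω => (√2)⁻¹ * (A ω + B ω) with hU
  set V : Ω → ℝ := fun ω => (√2)⁻¹ * (A ω - B ω) with hV
  have hUV : HasGaussianLaw (fun ω => (U ω, V ω)) P := hAB.map (T1.prod T2)
  have hcov : covariance U V P = 0 := by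
    simp only [hU, hV, covariance_const_mul_left, covariance_const_mul_right]
    rw [covariance_add_sub_eq mA mB, hA1, hB1]
    ring
  have hind := hUV.indepFun_of_covariance_eq_zero hcov
  have vU : variance U P = 1 + c := by
    simp only [hU]
    rw [variance_const_mul, variance_fun_add mA mB, hA1, hB1, sq, h2]; ring
  have vV : variance V P = 1 - c := by
    simp only [hV]
    rw [variance_const_mul, variance_fun_sub mA mB, hA1, hB1, sq, h2]; ring
  have iU : ∫ ω, U ω ∂P = 0 := by
    simp only [hU]
    rw [integral_const_mul, integral_add (mA.integrable one_le_two) (mB.integrable one_le_two),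
      hA0, hB0]; simp
  have iV : ∫ ω, V ω ∂P = 0 := by
    simp only [hV]
    rw [integral_const_mul, integral_sub (mA.integrable one_le_two) (mB.integrable one_le_two),
      hA0, hB0]; simp
  set w : ℝ≥0 := (1 + q).toNNReal with hw
  have hwr : (w : ℝ) = 1 + q := Real.coe_toNNReal _ (by linarith)
  have hw0 : w ≠ 0 := by
    rw [hw]; exact (Real.toNNReal_pos.2 (by linarith)).ne'
  set K := ENNReal.ofReal √((1 + q) / (1 - q)) with hK
  have hdom : ∀ v : ℝ, 1 - q ≤ v → v ≤ 1 + q → gaussianReal 0 v.toNNReal ≤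
      K • gaussianReal 0 w := by
    intro v hv1 hv2
    have hv0 : 0 < v := by linarith
    refine (gaussianReal_le_smul (Real.toNNReal_pos.2 hv0).ne'
      (Real.toNNReal_le_toNNReal hv2)).trans ?_
    refine Measure.le_iff.2 fun s _ => ?_
    rw [Measure.smul_apply, Measure.smul_apply, smul_eq_mul, smul_eq_mul]
    refine mul_le_mul_left (ENNReal.ofReal_le_ofReal (Real.sqrt_le_sqrt ?_)) _
    rw [Real.coe_toNNReal _ hv0.le, Real.coe_toNNReal _ (by linarith)]
    exact div_le_div_of_nonneg_left (by linarith) (by linarith) hv1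
  have hUm := hUV.fst.aemeasurable
  have hVm := hUV.snd.aemeasurable
  have hjoint : P.map (fun ω => (U ω, V ω)) ≤
      (K • gaussianReal 0 w).prod (K • gaussianReal 0 w) := by
    rw [(indepFun_iff_map_prod_eq_prod_map_map hUm hVm).1 hind, hUV.fst.map_eq_gaussianReal,
      hUV.snd.map_eq_gaussianReal, iU, iV, vU, vV]
    exact Measure.prod_mono (hdom _ (by linarith) (by linarith))
      (hdom _ (by linarith) (by linarith))
  set S : Set (ℝ × ℝ) := {p | u < (√2)⁻¹ * (p.1 + p.2) ∧ u < (√2)⁻¹ * (p.1 - p.2)} with hS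
  have hSm : MeasurableSet S := by
    have s1 : MeasurableSet {p : ℝ × ℝ | u < (√2)⁻¹ * (p.1 + p.2)} :=
      measurableSet_lt measurable_const (by fun_prop)
    have s2 : MeasurableSet {p : ℝ × ℝ | u < (√2)⁻¹ * (p.1 - p.2)} :=
      measurableSet_lt measurable_const (by fun_prop)
    exact s1.inter s2
  have hset : {ω | u < A ω ∧ u < B ω} = (fun ω => (U ω, V ω)) ⁻¹' S := by
    ext ω
    have e1 : (√2)⁻¹ * (U ω + V ω) = A ω := by
      simp only [hU, hV]
      calc _ = ((√2)⁻¹ * (√2)⁻¹) * (2 * A ω) := by ring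
        _ = A ω := by rw [h2]; ring
    have e2 : (√2)⁻¹ * (U ω - V ω) = B ω := by
      simp only [hU, hV]
      calc _ = ((√2)⁻¹ * (√2)⁻¹) * (2 * B ω) := by ring
        _ = B ω := by rw [h2]; ring
    simp only [hS, Set.mem_preimage, Set.mem_ofPred_eq, e1, e2]
  have hfin : P {ω | u < A ω ∧ u < B ω} ≤
      ENNReal.ofReal ((1 + q) / (1 - q) * gaussTail (u / √(1 + q)) ^ 2) := by
    rw [hset, ← Measure.map_apply_of_aemeasurable (hUm.prodMk hVm) hSm]
    refine (hjoint S).trans_eq ?_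
    rw [Measure.prod_smul_left, Measure.prod_smul_right, Measure.smul_apply, Measure.smul_apply,
      gaussianReal_prod_rotated hw0, hwr, smul_eq_mul, smul_eq_mul, ← mul_assoc, hK,
      ← ENNReal.ofReal_mul (Real.sqrt_nonneg _), Real.mul_self_sqrt
        (div_nonneg (by linarith) (by linarith)), ENNReal.ofReal_mul
        (div_nonneg (by linarith) (by linarith))]
  refine ENNReal.toReal_le_of_le_ofReal ?_ hfin
  have : 0 ≤ (1 + q) / (1 - q) := div_nonneg (by linarith) (by linarith)
  positivity

/-! ### Joint exceedances of two order statistics -/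

theorem measureReal_lt_eq_gaussTail {Ω : Type*} [MeasurableSpace Ω] {P : Measure Ω} {A : Ω → ℝ}
    (hA : HasGaussianLaw A P) (hA0 : ∫ ω, A ω ∂P = 0) (hA1 : variance A P = 1) (u : ℝ) :
    P.real {ω | u < A ω} = gaussTail u := by
  have h := hA.map_eq_gaussianReal
  rw [hA0, hA1, Real.toNNReal_one] at h
  rw [gaussTail, ← h, measureReal_def, measureReal_def,
    Measure.map_apply_of_aemeasurable hA.aemeasurable measurableSet_Ioi]
  rfl

/-- The probability that the order statistics of two rows `k`, `k'` both exceed `u`: some `r`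
entries of either row do, and the columns are independent. -/
theorem measureReal_upperOrderStat_pair_le {Ω κ : Type*} [MeasurableSpace Ω] {P : Measure Ω}
    [Fintype κ] {d r : ℕ} (hr : 1 ≤ r ∧ r ≤ d) {W : Ω → κ → Fin d → ℝ}
    (hW : HasGaussianLaw W P) (h0 : ∀ k l, ∫ ω, W ω k l ∂P = 0)
    (h1 : ∀ k l, variance (fun ω => W ω k l) P = 1)
    (hne : ∀ k l k' l', l ≠ l' → covariance (fun ω => W ω k l) (fun ω => W ω k' l') P = 0)
    {k k' : κ} {q : ℝ} (hq : ∀ l, |covariance (fun ω => W ω k l) (fun ω => W ω k' l) P| ≤ q)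
    (hq1 : q < 1) {u : ℝ} (hu : 0 ≤ u) :
    P.real {ω | u < upperOrderStat (W ω k) r hr ∧ u < upperOrderStat (W ω k') r hr} ≤
      (d.choose r : ℝ) ^ 2 * ((1 + q) / (1 - q) * gaussTail (u / √(1 + q)) ^ 2) ^ r := by
  classical
  have hprob := hW.isProbabilityMeasure
  have hq0 : 0 ≤ q := (abs_nonneg _).trans (hq ⟨0, by omega⟩)
  set s := √((1 + q) / (1 - q)) * gaussTail (u / √(1 + q)) with hs
  have hK : 1 ≤ (1 + q) / (1 - q) := by
    rw [le_div_iff₀ (by linarith)]; linarith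
  have hs2 : (1 + q) / (1 - q) * gaussTail (u / √(1 + q)) ^ 2 = s ^ 2 := by
    rw [hs, mul_pow, Real.sq_sqrt (by linarith)]
  have hs0 : 0 ≤ s := mul_nonneg (Real.sqrt_nonneg _) (gaussTail_nonneg _)
  have hsingle : gaussTail u ≤ s := by
    have h2 : 1 ≤ √(1 + q) := Real.one_le_sqrt.2 (by linarith)
    calc gaussTail u ≤ gaussTail (u / √(1 + q)) := gaussTail_antitone (div_le_self hu h2)
      _ ≤ s := le_mul_of_one_le_left (gaussTail_nonneg _) (Real.one_le_sqrt.2 hK)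
  -- the pair of entries of a column
  let pick : Bool → κ := fun b => if b then k else k'
  have hcol : HasGaussianLaw (fun ω (l : Fin d) (b : Bool) => W ω (pick b) l) P := by
    let T : (κ → Fin d → ℝ) →L[ℝ] (Fin d → Bool → ℝ) :=
      ContinuousLinearMap.pi fun l => ContinuousLinearMap.pi fun b =>
        (ContinuousLinearMap.proj (R := ℝ) (φ := fun _ : Fin d => ℝ) l).comp
          (ContinuousLinearMap.proj (R := ℝ) (φ := fun _ : κ => Fin d → ℝ) (pick b))
    exact hW.map T
  have hind : iIndepFun (fun (l : Fin d) ω (b : Bool) => W ω (pick b) l) P :=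
    hcol.iIndepFun_of_covariance_eval (X := fun l b ω => W ω (pick b) l)
      fun l l' hll b b' => hne _ _ _ _ hll
  have hAB : ∀ A ∈ Finset.powersetCard r (Finset.univ : Finset (Fin d)),
      ∀ B ∈ Finset.powersetCard r (Finset.univ : Finset (Fin d)),
      P.real {ω | (∀ l ∈ A, u < W ω k l) ∧ ∀ l ∈ B, u < W ω k' l} ≤ (s ^ 2) ^ r := by
    intro A hA B hB
    rw [Finset.mem_powersetCard] at hA hB
    let S : Fin d → Set (Bool → ℝ) := fun l =>
      {p | (l ∈ A → u < p true) ∧ (l ∈ B → u < p false)}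
    have hS : ∀ l, MeasurableSet (S l) := fun l => by
      have s1 : MeasurableSet {p : Bool → ℝ | l ∈ A → u < p true} := by
        by_cases h : l ∈ A
        · simpa [h] using measurableSet_lt measurable_const (measurable_pi_apply true)
        · simp [h]
      have s2 : MeasurableSet {p : Bool → ℝ | l ∈ B → u < p false} := by
        by_cases h : l ∈ B
        · simpa [h] using measurableSet_lt measurable_const (measurable_pi_apply false)
        · simp [h]
      exact s1.inter s2
    have hset : {ω | (∀ l ∈ A, u < W ω k l) ∧ ∀ l ∈ B, u < W ω k' l} =
        ⋂ l ∈ (Finset.univ : Finset (Fin d)),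
          (fun ω (b : Bool) => W ω (pick b) l) ⁻¹' (S l) := by
      ext ω
      simp only [Set.mem_iInter, Finset.mem_univ, forall_true_left, Set.mem_preimage, S, pick,
        Set.mem_ofPred_eq, if_true, Bool.false_eq_true, if_false]
      exact forall_and.symm
    have hprod := hind.measure_inter_preimage_eq_mul Finset.univ (sets := S) fun l _ => hS l
    rw [measureReal_def, hset, hprod, ENNReal.toReal_prod]
    -- a column in both `A` and `B` gives the factor `s ^ 2`, a column in one of them at most `s`
    have hfac : ∀ l, (P ((fun ω (b : Bool) => W ω (pick b) l) ⁻¹' (S l))).toReal ≤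
        s ^ (if l ∈ A then 1 else 0) * s ^ (if l ∈ B then 1 else 0) := by
      intro l
      have g1 : ∀ k, P.real {ω | u < W ω k l} = gaussTail u := fun k =>
        measureReal_lt_eq_gaussTail ((hW.eval k).eval l) (h0 k l) (h1 k l) u
      by_cases hlA : l ∈ A <;> by_cases hlB : l ∈ B
      · have hp : HasGaussianLaw (fun ω => (W ω k l, W ω k' l)) P := by
          have := hcol.eval l
          exact this.prodMk (X := fun b ω => W ω (pick b) l) true false
        have := measureReal_pair_le hp (h0 k l) (h0 k' l) (h1 k l) (h1 k' l) (hq l) hq1 u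
        rw [hs2, sq] at this
        simpa [S, pick, hlA, hlB, measureReal_def] using this
      · have := (g1 k).le.trans hsingle
        simpa [S, pick, hlA, hlB, measureReal_def] using this
      · have := (g1 k').le.trans hsingle
        simpa [S, pick, hlA, hlB, measureReal_def] using this
      · simp [S, hlA, hlB]
    refine (Finset.prod_le_prod (fun l _ => ENNReal.toReal_nonneg) fun l _ => hfac l).trans_eq ?_
    rw [Finset.prod_mul_distrib, Finset.prod_pow_eq_pow_sum, Finset.prod_pow_eq_pow_sum]
    simp only [Finset.sum_boole, Finset.filter_mem_eq_inter, Finset.univ_inter, hA.2, hB.2,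
      Nat.cast_id]
    rw [← pow_add, ← pow_mul, two_mul]
  rw [hs2]
  set 𝒜 := Finset.powersetCard r (Finset.univ : Finset (Fin d)) with h𝒜
  have hsub : {ω | u < upperOrderStat (W ω k) r hr ∧ u < upperOrderStat (W ω k') r hr} ⊆
      ⋃ p ∈ 𝒜 ×ˢ 𝒜, {ω | (∀ l ∈ p.1, u < W ω k l) ∧ ∀ l ∈ p.2, u < W ω k' l} := by
    rintro ω ⟨hk, hk'⟩
    obtain ⟨A, hA, hA'⟩ := (lt_upperOrderStat_iff _ r hr u).1 hk
    obtain ⟨B, hB, hB'⟩ := (lt_upperOrderStat_iff _ r hr u).1 hk'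
    exact Set.mem_biUnion (x := (A, B)) (Finset.mem_product.2 ⟨hA, hB⟩) ⟨hA', hB'⟩
  calc _ ≤ P.real (⋃ p ∈ 𝒜 ×ˢ 𝒜,
          {ω | (∀ l ∈ p.1, u < W ω k l) ∧ ∀ l ∈ p.2, u < W ω k' l}) :=
        measureReal_mono hsub (measure_ne_top _ _)
    _ ≤ ∑ p ∈ 𝒜 ×ˢ 𝒜, P.real {ω | (∀ l ∈ p.1, u < W ω k l) ∧ ∀ l ∈ p.2, u < W ω k' l} :=
        measureReal_biUnion_finset_le _ _
    _ ≤ ∑ _p ∈ 𝒜 ×ˢ 𝒜, (s ^ 2) ^ r := Finset.sum_le_sum fun p hp =>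
        hAB p.1 (Finset.mem_product.1 hp).1 p.2 (Finset.mem_product.1 hp).2
    _ = _ := by
        rw [Finset.sum_const, Finset.card_product, h𝒜, Finset.card_powersetCard,
          Finset.card_univ, Fintype.card_fin, nsmul_eq_mul]
        push_cast
        ring

/-! ### Smooth cutoffs of an order statistic -/

theorem exists_bound_deriv_smoothTransition : ∃ D, ∀ x, |deriv Real.smoothTransition x| ≤ D := by
  have hc : Continuous (deriv Real.smoothTransition) :=
    (Real.smoothTransition.contDiff (n := 1)).continuous_deriv (by simp)
  obtain ⟨D, hD⟩ := (isCompact_Icc (a := (0 : ℝ)) (b := 1)).exists_bound_of_continuousOn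
    hc.continuousOn
  have hD0 : 0 ≤ D := (norm_nonneg _).trans (hD 0 (by simp))
  refine ⟨D, fun x => ?_⟩
  by_cases hx : x ∈ Set.Icc (0 : ℝ) 1
  · exact hD x hx
  · rw [Set.mem_Icc, not_and_or, not_le, not_le] at hx
    have : deriv Real.smoothTransition x = 0 := by
      rcases hx with hx | hx
      · have : Real.smoothTransition =ᶠ[𝓝 x] fun _ => 0 := by
          filter_upwards [Iio_mem_nhds hx] with y hy
          exact Real.smoothTransition.zero_of_nonpos (le_of_lt hy)
        rw [this.deriv_eq, deriv_const]
      · have : Real.smoothTransition =ᶠ[𝓝 x] fun _ => 1 := by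
          filter_upwards [Ioi_mem_nhds hx] with y hy
          exact Real.smoothTransition.one_of_one_le (le_of_lt hy)
        rw [this.deriv_eq, deriv_const]
    rw [this, abs_zero]
    exact hD0

/-- A smooth function that is `1` if every set of `r` indices contains some `l` with `x l ≤ 0`, and
`0` if there are `r` indices with `1 ≤ x l`. -/
noncomputable def smoothIndicator (d r : ℕ) (x : Fin d → ℝ) : ℝ :=
  ∏ A ∈ Finset.powersetCard r (Finset.univ : Finset (Fin d)),
    (1 - ∏ l ∈ A, Real.smoothTransition (x l))

theorem contDiff_smoothIndicator (d r : ℕ) : ContDiff ℝ 1 (smoothIndicator d r) :=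
  contDiff_prod fun _ _ => contDiff_const.sub (contDiff_prod fun l _ =>
    Real.smoothTransition.contDiff.comp (contDiff_apply ℝ ℝ l))

theorem smoothIndicator_factor_mem {d : ℕ} (A : Finset (Fin d)) (x : Fin d → ℝ) :
    0 ≤ 1 - ∏ l ∈ A, Real.smoothTransition (x l) ∧
      1 - ∏ l ∈ A, Real.smoothTransition (x l) ≤ 1 := by
  have h0 : 0 ≤ ∏ l ∈ A, Real.smoothTransition (x l) :=
    Finset.prod_nonneg fun l _ => Real.smoothTransition.nonneg _
  have h1 : ∏ l ∈ A, Real.smoothTransition (x l) ≤ 1 :=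
    Finset.prod_le_one (fun l _ => Real.smoothTransition.nonneg _)
      fun l _ => Real.smoothTransition.le_one _
  constructor <;> linarith

theorem smoothIndicator_nonneg (d r : ℕ) (x : Fin d → ℝ) : 0 ≤ smoothIndicator d r x :=
  Finset.prod_nonneg fun A _ => (smoothIndicator_factor_mem A x).1

theorem smoothIndicator_le_one (d r : ℕ) (x : Fin d → ℝ) : smoothIndicator d r x ≤ 1 :=
  Finset.prod_le_one (fun A _ => (smoothIndicator_factor_mem A x).1)
    fun A _ => (smoothIndicator_factor_mem A x).2

theorem smoothIndicator_eq_one {d r : ℕ} {x : Fin d → ℝ}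
    (h : ∀ A ∈ Finset.powersetCard r (Finset.univ : Finset (Fin d)), ∃ l ∈ A, x l ≤ 0) :
    smoothIndicator d r x = 1 := by
  refine Finset.prod_eq_one fun A hA => ?_
  obtain ⟨l, hl, hx⟩ := h A hA
  rw [Finset.prod_eq_zero hl (Real.smoothTransition.zero_of_nonpos hx), sub_zero]

theorem smoothIndicator_eq_zero {d r : ℕ} {x : Fin d → ℝ}
    (h : ∃ A ∈ Finset.powersetCard r (Finset.univ : Finset (Fin d)), ∀ l ∈ A, 1 ≤ x l) :
    smoothIndicator d r x = 0 := by
  obtain ⟨A, hA, hx⟩ := h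
  refine Finset.prod_eq_zero hA ?_
  rw [Finset.prod_eq_one fun l hl => Real.smoothTransition.one_of_one_le (hx l hl), sub_self]

/-- The function is a polynomial of the numbers `Real.smoothTransition (x l)`, which stay in the
compact interval `[0, 1]`. -/
theorem exists_bound_fderiv_smoothIndicator (d r : ℕ) :
    ∃ L, 0 ≤ L ∧ ∀ x l, |fderiv ℝ (smoothIndicator d r) x (Pi.single l 1)| ≤ L := by
  obtain ⟨D, hD⟩ := exists_bound_deriv_smoothTransition
  have hD0 : 0 ≤ D := (abs_nonneg _).trans (hD 0)
  let H : (Fin d → ℝ) → ℝ := fun σ =>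
    ∏ A ∈ Finset.powersetCard r (Finset.univ : Finset (Fin d)), (1 - ∏ l ∈ A, σ l)
  have hH : ContDiff ℝ 1 H := contDiff_prod fun _ _ => contDiff_const.sub
    (contDiff_prod fun l _ => contDiff_apply ℝ ℝ l)
  obtain ⟨M, hM⟩ := (isCompact_Icc (a := (0 : Fin d → ℝ)) (b := 1)).exists_bound_of_continuousOn
    (hH.continuous_fderiv (by simp)).continuousOn
  have hM0 : 0 ≤ M := (norm_nonneg _).trans (hM 0 (by simp))
  refine ⟨M * D, by positivity, fun x l => ?_⟩
  let σ : Fin d → ℝ := fun l => Real.smoothTransition (x l)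
  have hσ : σ ∈ Set.Icc (0 : Fin d → ℝ) 1 :=
    ⟨fun l => Real.smoothTransition.nonneg _, fun l => Real.smoothTransition.le_one _⟩
  have hy : HasDerivAt (fun t : ℝ => x + t • (Pi.single l 1 : Fin d → ℝ)) (Pi.single l 1) 0 := by
    simpa using ((hasDerivAt_id (0 : ℝ)).smul_const (Pi.single l 1 : Fin d → ℝ)).const_add x
  have h1 : HasDerivAt (fun t : ℝ => smoothIndicator d r (x + t • (Pi.single l 1 : Fin d → ℝ)))
      (fderiv ℝ (smoothIndicator d r) x (Pi.single l 1)) 0 := by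
    have h2 : HasFDerivAt (smoothIndicator d r) (fderiv ℝ (smoothIndicator d r) x)
        (x + (0 : ℝ) • (Pi.single l 1 : Fin d → ℝ)) := by
      simpa using ((contDiff_smoothIndicator d r).differentiable
        (by simp)).differentiableAt.hasFDerivAt
    exact h2.comp_hasDerivAt 0 hy
  have h3 : HasDerivAt (fun t : ℝ => (fun m => Real.smoothTransition
      ((x + t • (Pi.single l 1 : Fin d → ℝ)) m) : Fin d → ℝ))
      (fun m => deriv Real.smoothTransition (x m) * (Pi.single l 1 : Fin d → ℝ) m) 0 := by
    refine hasDerivAt_pi.2 fun m => ?_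
    have h4 : HasDerivAt Real.smoothTransition (deriv Real.smoothTransition (x m))
        ((x + (0 : ℝ) • (Pi.single l 1 : Fin d → ℝ)) m) := by
      simpa using ((Real.smoothTransition.contDiff (n := 1)).differentiable
        (by simp)).differentiableAt.hasDerivAt
    exact h4.comp 0 (hasDerivAt_pi.1 hy m)
  have h5 : HasDerivAt (fun t : ℝ => smoothIndicator d r (x + t • (Pi.single l 1 : Fin d → ℝ)))
      (fderiv ℝ H σ
        (fun m => deriv Real.smoothTransition (x m) * (Pi.single l 1 : Fin d → ℝ) m)) 0 := by
    have h6 : HasFDerivAt H (fderiv ℝ H σ) (fun m => Real.smoothTransition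
        ((x + (0 : ℝ) • (Pi.single l 1 : Fin d → ℝ)) m)) := by
      have e : (fun m => Real.smoothTransition
        ((x + (0 : ℝ) • (Pi.single l 1 : Fin d → ℝ)) m)) = σ := by simp [σ]
      rw [e]
      exact (hH.differentiable (by simp)).differentiableAt.hasFDerivAt
    exact h6.comp_hasDerivAt 0 h3
  rw [h1.unique h5, ← Real.norm_eq_abs]
  refine ((fderiv ℝ H σ).le_opNorm _).trans (mul_le_mul (hM σ hσ) ?_ (norm_nonneg _) hM0)
  refine (pi_norm_le_iff_of_nonneg hD0).2 fun m => ?_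
  rw [norm_mul]
  refine (mul_le_of_le_one_right (norm_nonneg _) ?_).trans (hD _)
  rw [Pi.single_apply]
  split_ifs <;> simp

/-- Smooth cutoffs between `1` for order statistics at most `v` and `0` for those above `v + w`,
with partial derivatives bounded by a constant times `1 / w`. -/
theorem exists_smooth_cutoff {d r : ℕ} (hr : 1 ≤ r ∧ r ≤ d) :
    ∃ L : ℝ, 0 ≤ L ∧ ∀ v w : ℝ, 0 < w → ∃ g : (Fin d → ℝ) → ℝ, ContDiff ℝ 1 g ∧
      (∀ x, 0 ≤ g x) ∧ (∀ x, g x ≤ 1) ∧ (∀ x, upperOrderStat x r hr ≤ v → g x = 1) ∧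
      (∀ x, v + w < upperOrderStat x r hr → g x = 0) ∧
      ∀ x l, |fderiv ℝ g x (Pi.single l 1)| ≤
        ({x | v < upperOrderStat x r hr} : Set (Fin d → ℝ)).indicator (fun _ => L / w) x := by
  obtain ⟨L, hL0, hL⟩ := exists_bound_fderiv_smoothIndicator d r
  refine ⟨L, hL0, fun v w hw => ?_⟩
  let T : (Fin d → ℝ) → Fin d → ℝ := fun x => w⁻¹ • (x - fun _ => v)
  have hT : ContDiff ℝ 1 T := (contDiff_id.sub contDiff_const).const_smul w⁻¹
  have hTl : ∀ x l, T x l = (x l - v) / w := fun x l => by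
    simp [T, div_eq_inv_mul]
  have hone : ∀ x, upperOrderStat x r hr ≤ v → smoothIndicator d r (T x) = 1 := by
    intro x hx
    refine smoothIndicator_eq_one fun A hA => ?_
    by_contra! hcon
    refine not_lt.2 hx ((lt_upperOrderStat_iff x r hr v).2 ⟨A, hA, fun l hl => ?_⟩)
    have := hcon l hl
    rw [hTl, lt_div_iff₀ hw] at this
    linarith
  refine ⟨fun x => smoothIndicator d r (T x), (contDiff_smoothIndicator d r).comp hT,
    fun x => smoothIndicator_nonneg d r _, fun x => smoothIndicator_le_one d r _, hone, ?_, ?_⟩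
  · intro x hx
    obtain ⟨A, hA, hAx⟩ := (lt_upperOrderStat_iff x r hr _).1 hx
    refine smoothIndicator_eq_zero ⟨A, hA, fun l hl => ?_⟩
    rw [hTl, le_div_iff₀ hw]
    linarith [hAx l hl]
  · intro x l
    by_cases hx : v < upperOrderStat x r hr
    · rw [Set.indicator_of_mem (by exact hx)]
      have hTd : HasFDerivAt T (w⁻¹ • ContinuousLinearMap.id ℝ (Fin d → ℝ)) x :=
        ((hasFDerivAt_id x).sub_const _).const_smul w⁻¹
      have hd : HasFDerivAt (smoothIndicator d r) (fderiv ℝ (smoothIndicator d r) (T x)) (T x) :=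
        ((contDiff_smoothIndicator d r).differentiable (by simp)).differentiableAt.hasFDerivAt
      have hcomp := (hd.comp x hTd).fderiv
      have hcomp' : fderiv ℝ (fun x => smoothIndicator d r (T x)) x (Pi.single l 1) =
          w⁻¹ * fderiv ℝ (smoothIndicator d r) (T x) (Pi.single l 1) := by
        rw [Function.comp_def] at hcomp
        rw [hcomp]
        simp
      rw [hcomp', abs_mul, abs_of_pos (inv_pos.2 hw), div_eq_inv_mul]
      exact mul_le_mul_of_nonneg_left (hL _ _) (inv_pos.2 hw).le
    · rw [Set.indicator_of_notMem (by exact hx)]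
      -- the cutoff attains its maximal value `1` here, so the derivative vanishes
      have hmax : IsLocalMax (fun x => smoothIndicator d r (T x)) x :=
        Eventually.of_forall fun y => by
          simp only [hone x (not_lt.1 hx)]
          exact smoothIndicator_le_one d r _
      rw [hmax.fderiv_eq_zero]
      simp

/-! ### The levels -/

/-- The level `x / a_n + b_n`. -/
noncomputable def level (d r n : ℕ) (x : ℝ) : ℝ := (scaleConst r n)⁻¹ * x + centerConst d r n

theorem tendsto_log_natCast : Tendsto (fun n : ℕ => Real.log n) atTop atTop :=
  Real.tendsto_log_atTop.comp tendsto_natCast_atTop_atTop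

theorem tendsto_scaleConst {r : ℕ} (hr : 1 ≤ r) : Tendsto (scaleConst r) atTop atTop := by
  have hr' : (0 : ℝ) < 2 * r := by positivity
  exact Real.tendsto_sqrt_atTop.comp (tendsto_log_natCast.const_mul_atTop hr')

theorem scaleConst_sq (r : ℕ) {n : ℕ} (hn : 1 ≤ n) :
    scaleConst r n ^ 2 = 2 * r * Real.log n := by
  rw [scaleConst, Real.sq_sqrt]
  have : 0 ≤ Real.log n := Real.log_nonneg (by exact_mod_cast hn)
  positivity

/-- The logarithm in `centerConst`. -/
noncomputable def logConst (d r n : ℕ) : ℝ :=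
  Real.log (((scaleConst r n / r) ^ r)⁻¹ * (d.choose r : ℝ) * (2 * Real.pi) ^ (-(r : ℝ) / 2))

theorem level_eq (d r n : ℕ) (x : ℝ) :
    level d r n x = scaleConst r n / r + (logConst d r n + x) / scaleConst r n := by
  rw [level, centerConst, logConst]
  ring

theorem tendsto_logConst_atBot {d r : ℕ} (hr : 1 ≤ r ∧ r ≤ d) :
    Tendsto (logConst d r) atTop atBot := by
  have hC : (0 : ℝ) < d.choose r := by exact_mod_cast Nat.choose_pos hr.2
  have hr0 : (0 : ℝ) < r := by exact_mod_cast hr.1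
  have h0 : Tendsto (fun n => (scaleConst r n / r) ^ r) atTop atTop :=
    (tendsto_pow_atTop (by omega)).comp ((tendsto_scaleConst hr.1).atTop_div_const hr0)
  have h1 : Tendsto (fun n => ((scaleConst r n / r) ^ r)⁻¹ * (d.choose r : ℝ) *
      (2 * Real.pi) ^ (-(r : ℝ) / 2)) atTop (𝓝[≠] 0) := by
    refine tendsto_nhdsWithin_iff.2 ⟨?_, ?_⟩
    · simpa using ((tendsto_inv_atTop_zero.comp h0).mul_const (d.choose r : ℝ)).mul_const
        ((2 * Real.pi) ^ (-(r : ℝ) / 2))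
    · filter_upwards [h0.eventually_gt_atTop 0] with n hn
      have : (0 : ℝ) < (2 * Real.pi) ^ (-(r : ℝ) / 2) := Real.rpow_pos_of_pos (by positivity) _
      exact (by positivity : (0 : ℝ) < ((scaleConst r n / r) ^ r)⁻¹ * (d.choose r : ℝ) *
        (2 * Real.pi) ^ (-(r : ℝ) / 2)).ne'
  exact Real.tendsto_log_nhdsNE_zero.comp h1

theorem tendsto_logConst_add_div {d r : ℕ} (hr : 1 ≤ r ∧ r ≤ d) (x : ℝ) :
    Tendsto (fun n => (logConst d r n + x) / scaleConst r n) atTop (𝓝 0) := by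
  have hC : (0 : ℝ) < d.choose r := by exact_mod_cast Nat.choose_pos hr.2
  have hr0 : (0 : ℝ) < r := by exact_mod_cast hr.1
  have hpi : (0 : ℝ) < (2 * Real.pi) ^ (-(r : ℝ) / 2) := Real.rpow_pos_of_pos (by positivity) _
  set K := Real.log ((d.choose r : ℝ) * (2 * Real.pi) ^ (-(r : ℝ) / 2)) + x + r * Real.log r
    with hK
  have h1 : Tendsto (fun n => -(r : ℝ) * (Real.log (scaleConst r n) / scaleConst r n) +
      K / scaleConst r n) atTop (𝓝 0) := by
    have a1 : Tendsto (fun a : ℝ => Real.log a / a) atTop (𝓝 0) := by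
      simpa using Real.tendsto_pow_log_div_mul_add_atTop 1 0 1 one_ne_zero
    have a2 := ((a1.comp (tendsto_scaleConst hr.1)).const_mul (-(r : ℝ))).add
      ((tendsto_scaleConst hr.1).const_div_atTop K)
    simpa using a2
  refine h1.congr' ?_
  filter_upwards [(tendsto_scaleConst hr.1).eventually_gt_atTop 0] with n hn
  have e : logConst d r n = -(r : ℝ) * (Real.log (scaleConst r n) - Real.log r) +
      Real.log ((d.choose r : ℝ) * (2 * Real.pi) ^ (-(r : ℝ) / 2)) := by
    rw [logConst, mul_assoc, Real.log_mul (by positivity) (by positivity), Real.log_inv,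
      Real.log_pow, Real.log_div hn.ne' hr0.ne']
    ring
  rw [e, hK]
  field_simp
  ring

theorem tendsto_level_div {d r : ℕ} (hr : 1 ≤ r ∧ r ≤ d) (x : ℝ) :
    Tendsto (fun n => level d r n x / (scaleConst r n / r)) atTop (𝓝 1) := by
  have hr0 : (0 : ℝ) < r := by exact_mod_cast hr.1
  have h1 : Tendsto (fun n => 1 + (logConst d r n + x) / scaleConst r n *
      (r / scaleConst r n)) atTop (𝓝 1) := by
    simpa using ((tendsto_logConst_add_div hr x).mul
      ((tendsto_scaleConst hr.1).const_div_atTop (r : ℝ))).const_add 1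
  refine h1.congr' ?_
  filter_upwards [(tendsto_scaleConst hr.1).eventually_gt_atTop 0] with n hn
  rw [level_eq]
  field_simp

theorem tendsto_level_atTop {d r : ℕ} (hr : 1 ≤ r ∧ r ≤ d) (x : ℝ) :
    Tendsto (fun n => level d r n x) atTop atTop := by
  have hr0 : (0 : ℝ) < r := by exact_mod_cast hr.1
  simp only [level_eq]
  exact ((tendsto_scaleConst hr.1).atTop_div_const hr0).atTop_add (tendsto_logConst_add_div hr x)

theorem mul_level_sq {d r : ℕ} (hr : 1 ≤ r ∧ r ≤ d) (x : ℝ) :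
    ∀ᶠ n in atTop, r * level d r n x ^ 2 = 2 * Real.log n + 2 * (logConst d r n + x) +
      r * ((logConst d r n + x) / scaleConst r n) ^ 2 := by
  have hr0 : (0 : ℝ) < r := by exact_mod_cast hr.1
  filter_upwards [(tendsto_scaleConst hr.1).eventually_gt_atTop 0, eventually_ge_atTop 1]
    with n hn hn1
  have hsq := scaleConst_sq r hn1
  have : Real.log n = scaleConst r n ^ 2 / (2 * r) := by rw [hsq]; field_simp
  rw [level_eq, this]
  field_simp
  ring

theorem eventually_mul_level_sq_le {d r : ℕ} (hr : 1 ≤ r ∧ r ≤ d) (x : ℝ) :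
    ∀ᶠ n in atTop, r * level d r n x ^ 2 ≤ 2 * Real.log n := by
  have h1 : ∀ᶠ n in atTop, r * ((logConst d r n + x) / scaleConst r n) ^ 2 ≤ (1 : ℝ) := by
    have := ((tendsto_logConst_add_div hr x).pow 2).const_mul (r : ℝ)
    simp only [ne_eq, OfNat.ofNat_ne_zero, not_false_eq_true, zero_pow, mul_zero] at this
    exact this.eventually_le_const one_pos
  filter_upwards [mul_level_sq hr x, h1, (tendsto_logConst_atBot hr).eventually_le_atBot (-1 - x)]
    with n hn h1 h2
  rw [hn]
  linarith

theorem tendsto_mul_level_pow {d r : ℕ} (hr : 1 ≤ r ∧ r ≤ d) (x : ℝ) :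
    Tendsto (fun n : ℕ => (n : ℝ) *
      ((level d r n x)⁻¹ * Real.exp (-(level d r n x ^ 2 / 2))) ^ r) atTop
      (𝓝 (Real.exp (-x) / ((d.choose r : ℝ) * (2 * Real.pi) ^ (-(r : ℝ) / 2)))) := by
  have hr0 : (0 : ℝ) < r := by exact_mod_cast hr.1
  have hC : (0 : ℝ) < d.choose r := by exact_mod_cast Nat.choose_pos hr.2
  have hpi : (0 : ℝ) < (2 * Real.pi) ^ (-(r : ℝ) / 2) := Real.rpow_pos_of_pos (by positivity) _
  have h1 : Tendsto (fun n => ((level d r n x / (scaleConst r n / r))⁻¹) ^ r *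
      (Real.exp (-(r / 2 * ((logConst d r n + x) / scaleConst r n) ^ 2)) *
      (Real.exp (-x) / ((d.choose r : ℝ) * (2 * Real.pi) ^ (-(r : ℝ) / 2))))) atTop
      (𝓝 (1⁻¹ ^ r * (Real.exp (-(r / 2 * 0 ^ 2)) *
      (Real.exp (-x) / ((d.choose r : ℝ) * (2 * Real.pi) ^ (-(r : ℝ) / 2)))))) :=
    (((tendsto_level_div hr x).inv₀ one_ne_zero).pow r).mul
      (((Real.continuous_exp.tendsto _).comp
        (((tendsto_logConst_add_div hr x).pow 2).const_mul _).neg).mul_const _)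
  simp only [inv_one, one_pow, ne_eq, OfNat.ofNat_ne_zero, not_false_eq_true, zero_pow, mul_zero,
    neg_zero, Real.exp_zero, one_mul] at h1
  refine h1.congr' ?_
  filter_upwards [mul_level_sq hr x, (tendsto_scaleConst hr.1).eventually_gt_atTop 0,
    (tendsto_level_atTop hr x).eventually_gt_atTop 0, eventually_gt_atTop 0] with n hn ha hu hn0
  have hn0' : (0 : ℝ) < n := by exact_mod_cast hn0
  have e1 : Real.exp (-(level d r n x ^ 2 / 2)) ^ r = (n : ℝ)⁻¹ * Real.exp (-logConst d r n) *
      Real.exp (-x) * Real.exp (-(r / 2 * ((logConst d r n + x) / scaleConst r n) ^ 2)) := by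
    have hlog : (n : ℝ)⁻¹ = Real.exp (-Real.log n) := by
      rw [Real.exp_neg, Real.exp_log hn0']
    rw [← Real.exp_nat_mul, hlog, ← Real.exp_add, ← Real.exp_add, ← Real.exp_add]
    congr 1
    linarith
  have e2 : Real.exp (-logConst d r n) = (scaleConst r n / r) ^ r /
      ((d.choose r : ℝ) * (2 * Real.pi) ^ (-(r : ℝ) / 2)) := by
    rw [Real.exp_neg, logConst, Real.exp_log (by positivity)]
    field_simp
  rw [mul_pow, e1, e2, inv_div, div_pow, inv_pow]
  field_simp

theorem tendsto_mul_gaussTail_level {d r : ℕ} (hr : 1 ≤ r ∧ r ≤ d) (x : ℝ) :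
    Tendsto (fun n : ℕ => (n : ℝ) * ((d.choose r : ℝ) * gaussTail (level d r n x) ^ r)) atTop
      (𝓝 (Real.exp (-x))) := by
  have hC : (0 : ℝ) < d.choose r := by exact_mod_cast Nat.choose_pos hr.2
  have hpi : (0 : ℝ) < (2 * Real.pi) ^ (-(r : ℝ) / 2) := Real.rpow_pos_of_pos (by positivity) _
  have h1 := (((tendsto_gaussTail_div.comp (tendsto_level_atTop hr x)).pow r).mul
    (tendsto_mul_level_pow hr x)).const_mul
      ((d.choose r : ℝ) * (2 * Real.pi) ^ (-(r : ℝ) / 2))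
  have e : (d.choose r : ℝ) * (2 * Real.pi) ^ (-(r : ℝ) / 2) * (1 ^ r *
      (Real.exp (-x) / ((d.choose r : ℝ) * (2 * Real.pi) ^ (-(r : ℝ) / 2)))) =
      Real.exp (-x) := by
    rw [one_pow]; field_simp
  rw [e] at h1
  refine h1.congr' ?_
  filter_upwards [(tendsto_level_atTop hr x).eventually_gt_atTop 0] with n hu
  have hpdf : 0 < gaussianPDFReal 0 1 (level d r n x) := gaussianPDFReal_pos 0 1 _ one_ne_zero
  have e2 : (2 * Real.pi) ^ (-(r : ℝ) / 2) = (√(2 * Real.pi))⁻¹ ^ r := by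
    rw [Real.sqrt_eq_rpow, ← Real.rpow_neg (by positivity), ← Real.rpow_natCast,
      ← Real.rpow_mul (by positivity)]
    congr 1
    ring
  have e3 : gaussianPDFReal 0 1 (level d r n x) / level d r n x =
      (√(2 * Real.pi))⁻¹ *
        ((level d r n x)⁻¹ * Real.exp (-(level d r n x ^ 2 / 2))) := by
    rw [gaussianPDFReal_zero_one]; ring
  have h4 : gaussTail (level d r n x) ^ r =
      (gaussTail (level d r n x) / (gaussianPDFReal 0 1 (level d r n x) / level d r n x)) ^ r *
      (gaussianPDFReal 0 1 (level d r n x) / level d r n x) ^ r := by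
    rw [← mul_pow, div_mul_cancel₀]
    positivity
  rw [h4]
  have e5 : (gaussianPDFReal 0 1 (level d r n x) / level d r n x) ^ r =
      (√(2 * Real.pi))⁻¹ ^ r *
        ((level d r n x)⁻¹ * Real.exp (-(level d r n x ^ 2 / 2))) ^ r := by
    rw [e3, mul_pow]
  rw [e5, e2]
  simp only [Function.comp_apply]
  ring

/-! ### Tail of the order statistic of independent normal variables -/

/-- The probability that the `r`-th largest of `d` independent standard normal variables exceeds
`u`. -/
noncomputable def orderTail (d r : ℕ) (hr : 1 ≤ r ∧ r ≤ d) (u : ℝ) : ℝ :=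
  (Measure.pi (fun _ : Fin d => gaussianReal 0 1)).real {x | u < upperOrderStat x r hr}

theorem orderTail_le {d r : ℕ} (hr : 1 ≤ r ∧ r ≤ d) (u : ℝ) :
    orderTail d r hr u ≤ (d.choose r : ℝ) * gaussTail u ^ r := by
  classical
  set 𝒜 := Finset.powersetCard r (Finset.univ : Finset (Fin d)) with h𝒜
  have hsub : {x : Fin d → ℝ | u < upperOrderStat x r hr} ⊆
      ⋃ A ∈ 𝒜, Set.univ.pi fun l => if l ∈ A then Set.Ioi u else Set.univ := by
    intro x hx
    obtain ⟨A, hA, hAx⟩ := (lt_upperOrderStat_iff x r hr u).1 hx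
    refine Set.mem_biUnion (by exact hA) fun l _ => ?_
    by_cases hl : l ∈ A
    · simpa [hl] using hAx l hl
    · simp [hl]
  have hone : ∀ A ∈ 𝒜, (Measure.pi (fun _ : Fin d => gaussianReal 0 1)).real
      (Set.univ.pi fun l => if l ∈ A then Set.Ioi u else Set.univ) = gaussTail u ^ r := by
    intro A hA
    rw [measureReal_def, Measure.pi_pi, ENNReal.toReal_prod]
    have : ∀ l, (gaussianReal 0 1 (if l ∈ A then Set.Ioi u else Set.univ)).toReal =
        if l ∈ A then gaussTail u else 1 := fun l => by
      split_ifs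
      · rfl
      · simp
    simp only [this, Finset.prod_ite_mem, Finset.univ_inter, Finset.prod_const,
      (Finset.mem_powersetCard.1 hA).2]
  calc orderTail d r hr u ≤ _ := measureReal_mono hsub (measure_ne_top _ _)
    _ ≤ ∑ A ∈ 𝒜, _ := measureReal_biUnion_finset_le _ _
    _ = _ := by
      rw [Finset.sum_congr rfl hone, Finset.sum_const, h𝒜, Finset.card_powersetCard,
        Finset.card_univ, Fintype.card_fin, nsmul_eq_mul]

theorem le_orderTail {d r : ℕ} (hr : 1 ≤ r ∧ r ≤ d) (u : ℝ) :
    (d.choose r : ℝ) * gaussTail u ^ r * (1 - gaussTail u) ^ (d - r) ≤ orderTail d r hr u := by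
  classical
  set 𝒜 := Finset.powersetCard r (Finset.univ : Finset (Fin d)) with h𝒜
  let S : Finset (Fin d) → Set (Fin d → ℝ) := fun A =>
    Set.univ.pi fun l => if l ∈ A then Set.Ioi u else Set.Iic u
  have hmem : ∀ A x, x ∈ S A ↔ ∀ l, (l ∈ A ↔ u < x l) := by
    intro A x
    simp only [S, Set.mem_pi, Set.mem_univ, forall_true_left]
    refine forall_congr' fun l => ?_
    by_cases hl : l ∈ A <;> simp [hl]
  have hsub : (⋃ A ∈ 𝒜, S A) ⊆ {x : Fin d → ℝ | u < upperOrderStat x r hr} := by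
    intro x hx
    obtain ⟨A, hA, hAx⟩ := Set.mem_iUnion₂.1 hx
    exact (lt_upperOrderStat_iff x r hr u).2 ⟨A, hA, fun l hl => ((hmem A x).1 hAx l).1 hl⟩
  have hone : ∀ A ∈ 𝒜, (Measure.pi (fun _ : Fin d => gaussianReal 0 1)).real (S A) =
      gaussTail u ^ r * (1 - gaussTail u) ^ (d - r) := by
    intro A hA
    rw [measureReal_def, Measure.pi_pi, ENNReal.toReal_prod]
    have : ∀ l, (gaussianReal 0 1 (if l ∈ A then Set.Ioi u else Set.Iic u)).toReal =
        if l ∈ A then gaussTail u else 1 - gaussTail u := fun l => by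
      split_ifs
      · rfl
      · rw [gaussTail, ← Set.compl_Iic, probReal_compl_eq_one_sub measurableSet_Iic]
        simp [measureReal_def]
    simp only [this]
    rw [Finset.prod_ite, Finset.prod_const, Finset.prod_const]
    have c1 : (Finset.univ.filter fun l => l ∈ A).card = r := by
      rw [Finset.filter_mem_eq_inter, Finset.univ_inter, (Finset.mem_powersetCard.1 hA).2]
    have c2 : (Finset.univ.filter fun l => l ∉ A).card = d - r := by
      have : (Finset.univ.filter fun l => l ∉ A) = Aᶜ := by ext; simp
      rw [this, Finset.card_compl, Fintype.card_fin, (Finset.mem_powersetCard.1 hA).2]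
    rw [c1, c2]
  have hdisj : (𝒜 : Set (Finset (Fin d))).PairwiseDisjoint S := by
    intro A _ B _ hAB
    refine Set.disjoint_left.2 fun x hA hB => hAB ?_
    ext l
    rw [((hmem A x).1 hA l), ((hmem B x).1 hB l)]
  have hmeas : ∀ A ∈ 𝒜, MeasurableSet (S A) := fun A _ =>
    MeasurableSet.univ_pi fun l => by
      split_ifs
      · exact measurableSet_Ioi
      · exact measurableSet_Iic
  have := measureReal_biUnion_finset (μ := Measure.pi (fun _ : Fin d => gaussianReal 0 1))
    hdisj hmeas
  rw [Finset.sum_congr rfl hone, Finset.sum_const, h𝒜, Finset.card_powersetCard,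
        Finset.card_univ, Fintype.card_fin, nsmul_eq_mul, ← mul_assoc] at this
  rw [← this]
  exact measureReal_mono hsub (measure_ne_top _ _)

theorem tendsto_mul_orderTail {d r : ℕ} (hr : 1 ≤ r ∧ r ≤ d) (x : ℝ) :
    Tendsto (fun n : ℕ => (n : ℝ) * orderTail d r hr (level d r n x)) atTop
      (𝓝 (Real.exp (-x))) := by
  have h1 := tendsto_mul_gaussTail_level hr x
  have h2 := h1.mul (((tendsto_gaussTail_atTop.comp (tendsto_level_atTop hr x)).const_sub 1).pow
    (d - r))
  simp only [sub_zero, one_pow, mul_one] at h2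
  refine tendsto_of_tendsto_of_tendsto_of_le_of_le h2 h1 (fun n => ?_) fun n => ?_
  · simp only [Function.comp_apply]
    rw [mul_assoc]
    exact mul_le_mul_of_nonneg_left (le_orderTail hr _) (Nat.cast_nonneg n)
  · exact mul_le_mul_of_nonneg_left (orderTail_le hr _) (Nat.cast_nonneg n)

/-! ### Summation of the pair bounds -/

theorem tendsto_log_mul_exp_neg {α : ℝ} (hα : 0 < α) :
    Tendsto (fun n : ℕ => Real.log n * Real.exp (-α * Real.log n)) atTop (𝓝 0) := by
  have h : Tendsto (fun t : ℝ => t * Real.exp (-α * t)) atTop (𝓝 0) := by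
    have := (Real.tendsto_pow_mul_exp_neg_atTop_nhds_zero 1).comp
      (tendsto_id.const_mul_atTop hα)
    have := this.const_mul α⁻¹
    simp only [mul_zero] at this
    refine this.congr fun t => ?_
    simp only [Function.comp_apply, id, pow_one]
    rw [← mul_assoc, ← mul_assoc, inv_mul_cancel₀ hα.ne', one_mul, neg_mul]
  exact h.comp tendsto_log_natCast

/-- Berman's estimate for the sum of the correlations weighted by the growth of the pair bounds. The
lags below a small power of `n` are few and their terms are bounded by `n ^ β` with `β < 1`. For
larger lags `log m` is comparable to `log n`, so `|ρ m| * log n` is small. -/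
theorem tendsto_correlation_sum {ρ : ℕ → ℝ} {δ : ℝ} (hδ1 : δ < 1) (hδ : ∀ m, 1 ≤ m → |ρ m| ≤ δ)
    (hρ : Tendsto (fun n : ℕ => ρ n * Real.log n) atTop (𝓝 0)) :
    Tendsto (fun n : ℕ => Real.log n / n * ∑ m ∈ Finset.Ico 1 n,
      |ρ m| * Real.exp (2 * (|ρ m| / (1 + |ρ m|)) * Real.log n)) atTop (𝓝 0) := by
  have hδ0 : 0 ≤ δ := (abs_nonneg _).trans (hδ 1 le_rfl)
  set β := 2 * (δ / (1 + δ)) with hβ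
  -- `exp (α * log n) = n ^ α` separates small lags from large ones
  have hβ0 : 0 ≤ β := by positivity
  have hβ1 : β < 1 := by
    rw [hβ, ← mul_div_assoc, div_lt_one (by linarith)]; linarith
  set α := (1 - β) / 2 with hα
  have hα0 : 0 < α := by rw [hα]; linarith
  rw [Metric.tendsto_atTop]
  intro η hη
  -- choose `ε` with `ε / α * exp (2 ε / α) < η / 2`
  obtain ⟨ε, hε0, hε⟩ : ∃ ε > 0, ε / α * Real.exp (2 * (ε / α)) < η / 2 := by
    have hc : Tendsto (fun ε : ℝ => ε / α * Real.exp (2 * (ε / α))) (𝓝[>] 0) (𝓝 0) := by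
      have : Continuous (fun ε : ℝ => ε / α * Real.exp (2 * (ε / α))) := by fun_prop
      have h := this.tendsto 0
      simp only [zero_div, zero_mul] at h
      exact h.mono_left nhdsWithin_le_nhds
    obtain ⟨ε, h1, h2⟩ := ((hc.eventually_lt_const (half_pos hη)).and
      self_mem_nhdsWithin).exists
    exact ⟨ε, h2, h1⟩
  obtain ⟨M, hM⟩ := Metric.tendsto_atTop.1 hρ ε hε0
  have hlarge : ∀ᶠ n : ℕ in atTop, (M : ℝ) ≤ Real.exp (α * Real.log n) :=
    (Real.tendsto_exp_atTop.comp (tendsto_log_natCast.const_mul_atTop hα0)).eventually_ge_atTop _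
  have hsmall := (tendsto_log_mul_exp_neg hα0).eventually_lt_const (half_pos hη)
  obtain ⟨N, hN⟩ := eventually_atTop.1 ((hlarge.and hsmall).and (eventually_ge_atTop 3))
  refine ⟨N, fun n hn => ?_⟩
  obtain ⟨⟨hl, hs⟩, hn3⟩ := hN n hn
  have hn0 : (0 : ℝ) < n := by exact_mod_cast (by omega : 0 < n)
  have hlog : 0 < Real.log n := Real.log_pos (by exact_mod_cast (by omega : 1 < n))
  set T := Real.exp (α * Real.log n) with hT
  have hterm : ∀ m ∈ Finset.Ico 1 n,
      |ρ m| * Real.exp (2 * (|ρ m| / (1 + |ρ m|)) * Real.log n) ≤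
        (if (m : ℝ) < T then Real.exp (β * Real.log n) else 0) +
          ε / α * Real.exp (2 * (ε / α)) / Real.log n := by
    intro m hm
    obtain ⟨hm1, hmn⟩ := Finset.mem_Ico.1 hm
    have hq := hδ m hm1
    have hq0 := abs_nonneg (ρ m)
    split_ifs with hmT
    · have h1 : |ρ m| / (1 + |ρ m|) ≤ δ / (1 + δ) := by
        rw [div_le_div_iff₀ (by linarith) (by linarith)]; nlinarith
      calc _ ≤ 1 * Real.exp (β * Real.log n) := by
            refine mul_le_mul (by linarith) (Real.exp_le_exp.2 ?_) (Real.exp_pos _).le zero_le_one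
            refine mul_le_mul_of_nonneg_right ?_ hlog.le
            rw [hβ]; linarith
        _ ≤ _ := by
            rw [one_mul]
            exact le_add_of_nonneg_right (by positivity)
    · rw [zero_add]
      have hTm : T ≤ m := not_lt.1 hmT
      have hm0 : (0 : ℝ) < m := by exact_mod_cast hm1
      have hmM : M ≤ m := by exact_mod_cast hl.trans hTm
      have h1 := hM m hmM
      rw [Real.dist_eq, sub_zero, abs_mul] at h1
      have h2 : α * Real.log n ≤ Real.log m := by
        have := Real.log_le_log (Real.exp_pos _) hTm
        rwa [Real.log_exp] at this
      have h3 : |ρ m| * (α * Real.log n) ≤ ε := by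
        refine (mul_le_mul_of_nonneg_left (h2.trans (le_abs_self _)) hq0).trans h1.le
      have h4 : |ρ m| * Real.log n ≤ ε / α := by
        rw [le_div_iff₀ hα0]; linarith
      have h5 : |ρ m| / (1 + |ρ m|) ≤ |ρ m| := div_le_self hq0 (by linarith)
      have h6 : |ρ m| ≤ ε / α / Real.log n := by
        rw [le_div_iff₀ hlog]; exact h4
      calc _ ≤ ε / α / Real.log n * Real.exp (2 * (ε / α)) := by
            refine mul_le_mul h6 (Real.exp_le_exp.2 ?_) (Real.exp_pos _).le (by positivity)
            have := mul_le_mul_of_nonneg_right h5 hlog.le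
            nlinarith
        _ = _ := by ring
  have hcard : ∑ m ∈ Finset.Ico 1 n, (if (m : ℝ) < T then Real.exp (β * Real.log n) else 0) ≤
      T * Real.exp (β * Real.log n) := by
    rw [← Finset.sum_filter, Finset.sum_const, nsmul_eq_mul]
    refine mul_le_mul_of_nonneg_right ?_ (Real.exp_pos _).le
    have hsub : (Finset.Ico 1 n).filter (fun m : ℕ => (m : ℝ) < T) ⊆ Finset.Ico 1 ⌈T⌉₊ := by
      intro m hm
      obtain ⟨h1, h2⟩ := Finset.mem_filter.1 hm
      exact Finset.mem_Ico.2 ⟨(Finset.mem_Ico.1 h1).1, Nat.lt_ceil.2 h2⟩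
    have h1 := Finset.card_le_card hsub
    rw [Nat.card_Ico] at h1
    have hT0 : 0 < T := Real.exp_pos _
    have h2 : 0 < ⌈T⌉₊ := Nat.ceil_pos.2 hT0
    calc (((Finset.Ico 1 n).filter (fun m : ℕ => (m : ℝ) < T)).card : ℝ)
        ≤ ((⌈T⌉₊ - 1 : ℕ) : ℝ) := by exact_mod_cast h1
      _ = (⌈T⌉₊ : ℝ) - 1 := by rw [Nat.cast_sub h2, Nat.cast_one]
      _ ≤ T := by linarith [Nat.ceil_lt_add_one hT0.le]
  have hsum := Finset.sum_le_sum hterm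
  rw [Finset.sum_add_distrib, Finset.sum_const, nsmul_eq_mul, Nat.card_Ico] at hsum
  have hnonneg : 0 ≤ Real.log n / n * ∑ m ∈ Finset.Ico 1 n,
      |ρ m| * Real.exp (2 * (|ρ m| / (1 + |ρ m|)) * Real.log n) := by
    refine mul_nonneg (by positivity) (Finset.sum_nonneg fun m _ => by positivity)
  rw [Real.dist_eq, sub_zero, abs_of_nonneg hnonneg]
  have hTn : T * Real.exp (β * Real.log n) = n * Real.exp (-α * Real.log n) := by
    conv_rhs => rw [← Real.exp_log hn0]
    rw [hT, ← Real.exp_add, Real.log_exp, ← Real.exp_add]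
    congr 1
    rw [hα]
    ring
  have hn1 : ((n - 1 : ℕ) : ℝ) ≤ n := by exact_mod_cast Nat.sub_le n 1
  calc _ ≤ Real.log n / n * (n * Real.exp (-α * Real.log n) +
          n * (ε / α * Real.exp (2 * (ε / α)) / Real.log n)) := by
        refine mul_le_mul_of_nonneg_left (hsum.trans ?_) (by positivity)
        exact add_le_add (hcard.trans_eq hTn) (mul_le_mul_of_nonneg_right hn1 (by positivity))
    _ = Real.log n * Real.exp (-α * Real.log n) + ε / α * Real.exp (2 * (ε / α)) := by
        field_simp
    _ < η := by linarith

/-- The bound of `measureReal_upperOrderStat_pair_le` for the probability of a joint exceedance of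
`u`, where `q` bounds the correlation. -/
noncomputable def pairBound (d r : ℕ) (q u : ℝ) : ℝ :=
  (d.choose r : ℝ) ^ 2 * ((1 + q) / (1 - q) * gaussTail (u / √(1 + q)) ^ 2) ^ r

theorem pairBound_nonneg (d r : ℕ) {q : ℝ} (hq : 0 ≤ q) (hq1 : q < 1) (u : ℝ) :
    0 ≤ pairBound d r q u := by
  have : 0 < 1 - q := by linarith
  rw [pairBound]
  positivity

/-- At the levels, the pair bound is at most of order `n ^ (-2 + 2 * q / (1 + q))`, uniformly in the
correlation bound `q`. -/
theorem eventually_pairBound_level_le {d r : ℕ} (hr : 1 ≤ r ∧ r ≤ d) {δ : ℝ} (hδ1 : δ < 1)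
    (x : ℝ) : ∃ K, 0 ≤ K ∧ ∀ᶠ n : ℕ in atTop, ∀ q, 0 ≤ q → q ≤ δ →
      pairBound d r q (level d r n x) ≤
        K * ((n : ℝ)⁻¹ ^ 2 * Real.exp (2 * (q / (1 + q)) * Real.log n)) := by
  have hr0 : (0 : ℝ) < r := by exact_mod_cast hr.1
  obtain ⟨K₀, hK₀⟩ : ∃ K₀ : ℝ, ∀ᶠ n : ℕ in atTop, (n : ℝ) *
      ((level d r n x)⁻¹ * Real.exp (-(level d r n x ^ 2 / 2))) ^ r ≤ K₀ :=
    ⟨_, (tendsto_mul_level_pow hr x).eventually_le_const (lt_add_one _)⟩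
  obtain ⟨t₀, ht₀⟩ := eventually_atTop.1 eventually_gaussTail_le
  refine ⟨(d.choose r : ℝ) ^ 2 * ((2 / (1 - δ)) * 2) ^ r * K₀ ^ 2, ?_, ?_⟩
  · have : (0 : ℝ) < 1 - δ := by linarith
    positivity
  filter_upwards [hK₀, eventually_mul_level_sq_le hr x,
    (tendsto_level_atTop hr x).eventually_gt_atTop 0,
    (tendsto_level_atTop hr x).eventually_ge_atTop (√2 * t₀), eventually_gt_atTop 0]
    with n h1 h2 hu hut hn q hq0 hqδ
  have hn0 : (0 : ℝ) < n := by exact_mod_cast hn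
  set u := level d r n x with hudef
  have h1q : (0 : ℝ) < 1 + q := by linarith
  have hsq : √(1 + q) ≤ √2 := Real.sqrt_le_sqrt (by linarith)
  have hsq0 : 0 < √(1 + q) := Real.sqrt_pos.2 h1q
  have ht : t₀ ≤ u / √(1 + q) := by
    rw [le_div_iff₀ hsq0]
    rcases le_or_gt t₀ 0 with h | h
    · exact (mul_nonpos_of_nonpos_of_nonneg h hsq0.le).trans hu.le
    · calc t₀ * √(1 + q) ≤ t₀ * √2 := mul_le_mul_of_nonneg_left hsq h.le
        _ ≤ u := by rw [mul_comm]; exact hut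
  have hg := ht₀ _ ht
  have hg2 : gaussTail (u / √(1 + q)) ^ 2 ≤
      2 * ((u⁻¹ * Real.exp (-(u ^ 2 / 2))) ^ 2 * Real.exp (q / (1 + q) * u ^ 2)) := by
    calc gaussTail (u / √(1 + q)) ^ 2 ≤ ((u / √(1 + q))⁻¹ *
          Real.exp (-((u / √(1 + q)) ^ 2 / 2))) ^ 2 :=
          pow_le_pow_left₀ (gaussTail_nonneg _) hg 2
      _ = (1 + q) * ((u⁻¹ * Real.exp (-(u ^ 2 / 2))) ^ 2 * Real.exp (q / (1 + q) * u ^ 2)) := by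
          rw [mul_pow, mul_pow, ← Real.exp_nat_mul, ← Real.exp_nat_mul, mul_assoc (u⁻¹ ^ 2),
            ← Real.exp_add, inv_div, div_pow, Real.sq_sqrt h1q.le, div_pow, Real.sq_sqrt h1q.le]
          have : (2 : ℕ) * -(u ^ 2 / (1 + q) / 2) =
              (2 : ℕ) * -(u ^ 2 / 2) + q / (1 + q) * u ^ 2 := by
            push_cast; field_simp; ring
          rw [this]
          field_simp
      _ ≤ _ := mul_le_mul_of_nonneg_right (by linarith) (by positivity)
  have hratio : (1 + q) / (1 - q) ≤ 2 / (1 - δ) :=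
    div_le_div₀ (by norm_num) (by linarith) (by linarith) (by linarith)
  have hδ' : (0 : ℝ) < 1 - δ := by linarith
  have hE : Real.exp (q / (1 + q) * u ^ 2) ^ r ≤ Real.exp (2 * (q / (1 + q)) * Real.log n) := by
    rw [← Real.exp_nat_mul]
    refine Real.exp_le_exp.2 ?_
    have : 0 ≤ q / (1 + q) := by positivity
    nlinarith
  have hA : ((u⁻¹ * Real.exp (-(u ^ 2 / 2))) ^ r) ≤ K₀ * (n : ℝ)⁻¹ := by
    rw [← div_eq_mul_inv, le_div_iff₀ hn0, mul_comm]
    exact h1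
  calc pairBound d r q u ≤ (d.choose r : ℝ) ^ 2 * ((2 / (1 - δ)) *
          (2 * ((u⁻¹ * Real.exp (-(u ^ 2 / 2))) ^ 2 * Real.exp (q / (1 + q) * u ^ 2)))) ^ r := by
        rw [pairBound]
        have : 0 < 1 - q := by linarith
        gcongr
    _ = (d.choose r : ℝ) ^ 2 * ((2 / (1 - δ)) * 2) ^ r *
          (((u⁻¹ * Real.exp (-(u ^ 2 / 2))) ^ r) ^ 2 * Real.exp (q / (1 + q) * u ^ 2) ^ r) := by
        rw [← pow_mul, mul_comm r 2, pow_mul, ← mul_pow, mul_assoc, ← mul_pow]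
        ring
    _ ≤ (d.choose r : ℝ) ^ 2 * ((2 / (1 - δ)) * 2) ^ r *
          ((K₀ * (n : ℝ)⁻¹) ^ 2 * Real.exp (2 * (q / (1 + q)) * Real.log n)) := by
        gcongr
    _ = _ := by ring

/-- Every distance occurs for at most two indices `k'`. -/
theorem sum_erase_dist_le {n : ℕ} (k : Fin n) {F : ℕ → ℝ} (hF : ∀ m, 1 ≤ m → 0 ≤ F m) :
    ∑ k' ∈ Finset.univ.erase k, F (Nat.dist k k') ≤ 2 * ∑ m ∈ Finset.Ico 1 n, F m := by
  have hmaps : ∀ k' ∈ Finset.univ.erase k, Nat.dist (k : ℕ) k' ∈ Finset.Ico 1 n := by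
    intro k' hk'
    have h1 : (k' : ℕ) ≠ k := fun h => Finset.ne_of_mem_erase hk' (Fin.ext h)
    have := k.2
    have := k'.2
    rw [Finset.mem_Ico, Nat.dist]
    omega
  rw [← Finset.sum_fiberwise_of_maps_to hmaps, Finset.mul_sum]
  refine Finset.sum_le_sum fun m hm => ?_
  have hm1 := (Finset.mem_Ico.1 hm).1
  have hcongr : ∑ k' ∈ (Finset.univ.erase k).filter (fun k' : Fin n => Nat.dist (k : ℕ) k' = m),
      F (Nat.dist k k') = ∑ k' ∈ (Finset.univ.erase k).filter
        (fun k' : Fin n => Nat.dist (k : ℕ) k' = m), F m :=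
    Finset.sum_congr rfl fun k' hk' => by rw [(Finset.mem_filter.1 hk').2]
  rw [hcongr, Finset.sum_const, nsmul_eq_mul]
  refine mul_le_mul_of_nonneg_right ?_ (hF m hm1)
  have hsub : ((Finset.univ.erase k).filter (fun k' : Fin n => Nat.dist (k : ℕ) k' = m)).map
      Fin.valEmbedding ⊆ {(k : ℕ) - m, (k : ℕ) + m} := by
    intro j hj
    obtain ⟨k', hk', rfl⟩ := Finset.mem_map.1 hj
    have := (Finset.mem_filter.1 hk').2
    rw [Nat.dist] at this
    simp only [Fin.valEmbedding_apply, Finset.mem_insert, Finset.mem_singleton]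
    omega
  have := (Finset.card_le_card hsub).trans Finset.card_le_two
  rw [Finset.card_map] at this
  exact_mod_cast this

theorem tendsto_pair_sum {ρ : ℕ → ℝ} {δ : ℝ} (hδ1 : δ < 1) (hδ : ∀ m, 1 ≤ m → |ρ m| ≤ δ)
    (hρ : Tendsto (fun n : ℕ => ρ n * Real.log n) atTop (𝓝 0)) {d r : ℕ} (hr : 1 ≤ r ∧ r ≤ d)
    (x : ℝ) :
    Tendsto (fun n : ℕ => scaleConst r n ^ 2 * ∑ k : Fin n, ∑ k' ∈ Finset.univ.erase k,
      |ρ (Nat.dist k k')| * pairBound d r |ρ (Nat.dist k k')| (level d r n x)) atTop (𝓝 0) := by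
  obtain ⟨K, hK0, hK⟩ := eventually_pairBound_level_le hr hδ1 x
  have hlim := (tendsto_correlation_sum hδ1 hδ hρ).const_mul (2 * r * 2 * K)
  rw [mul_zero] at hlim
  have hnn : ∀ n : ℕ, ∀ k : Fin n, ∀ k' ∈ Finset.univ.erase k,
      0 ≤ |ρ (Nat.dist k k')| * pairBound d r |ρ (Nat.dist k k')| (level d r n x) := by
    intro n k k' hk'
    have h1 : (k' : ℕ) ≠ k := fun h => Finset.ne_of_mem_erase hk' (Fin.ext h)
    have h2 : 1 ≤ Nat.dist (k : ℕ) k' := by rw [Nat.dist]; omega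
    exact mul_nonneg (abs_nonneg _)
      (pairBound_nonneg d r (abs_nonneg _) ((hδ _ h2).trans_lt hδ1) _)
  refine tendsto_of_tendsto_of_tendsto_of_le_of_le' tendsto_const_nhds hlim
    (Eventually.of_forall fun n => ?_) ?_
  · exact mul_nonneg (sq_nonneg _) (Finset.sum_nonneg fun k _ => Finset.sum_nonneg (hnn n k))
  filter_upwards [hK, eventually_ge_atTop 1] with n hn hn1
  have hn0 : (0 : ℝ) < n := by exact_mod_cast hn1
  have hlog : 0 ≤ Real.log n := Real.log_nonneg (by exact_mod_cast hn1)
  have hinner : ∀ k : Fin n, ∑ k' ∈ Finset.univ.erase k,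
      |ρ (Nat.dist k k')| * pairBound d r |ρ (Nat.dist k k')| (level d r n x) ≤
      2 * ∑ m ∈ Finset.Ico 1 n, K * ((n : ℝ)⁻¹ ^ 2 * (|ρ m| *
        Real.exp (2 * (|ρ m| / (1 + |ρ m|)) * Real.log n))) := by
    intro k
    refine (sum_erase_dist_le k (F := fun m => |ρ m| * pairBound d r |ρ m| (level d r n x))
      fun m hm => mul_nonneg (abs_nonneg _)
        (pairBound_nonneg d r (abs_nonneg _) ((hδ _ hm).trans_lt hδ1) _)).trans ?_
    refine mul_le_mul_of_nonneg_left (Finset.sum_le_sum fun m hm => ?_) zero_le_two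
    have := mul_le_mul_of_nonneg_left
      (hn |ρ m| (abs_nonneg _) (hδ m (Finset.mem_Ico.1 hm).1)) (abs_nonneg (ρ m))
    refine this.trans_eq ?_
    ring
  calc _ ≤ scaleConst r n ^ 2 * ∑ _k : Fin n, 2 * ∑ m ∈ Finset.Ico 1 n, K * ((n : ℝ)⁻¹ ^ 2 *
        (|ρ m| * Real.exp (2 * (|ρ m| / (1 + |ρ m|)) * Real.log n))) :=
        mul_le_mul_of_nonneg_left (Finset.sum_le_sum fun k _ => hinner k) (sq_nonneg _)
    _ = _ := by
        rw [Finset.sum_const, Finset.card_univ, Fintype.card_fin, nsmul_eq_mul,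
          scaleConst_sq r hn1, ← Finset.mul_sum, ← Finset.mul_sum]
        field_simp

/-! ### Gaussian arrays with independent columns -/

/-- `X` is a centred Gaussian array whose columns `l` are uncorrelated, hence independent, with the
same covariance matrix `R` of the entries of a column. -/
structure IsGaussianArray {Ω κ ι : Type*} [MeasurableSpace Ω] [Fintype κ] [Fintype ι]
    [DecidableEq ι] (P : Measure Ω) (X : Ω → κ → ι → ℝ) (R : κ → κ → ℝ) : Prop where
  measurable : Measurable X
  gaussian : HasGaussianLaw X P
  mean_zero : ∀ k l, ∫ ω, X ω k l ∂P = 0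
  cov_eq : ∀ k l k' l', covariance (fun ω => X ω k l) (fun ω => X ω k' l') P =
    if l' = l then R k k' else 0

namespace IsGaussianArray

variable {Ω κ ι : Type*} [MeasurableSpace Ω] [Fintype κ] [Fintype ι] [DecidableEq ι]
  {P : Measure Ω} {X : Ω → κ → ι → ℝ} {R : κ → κ → ℝ}

theorem memLp (h : IsGaussianArray P X R) (k : κ) (l : ι) : MemLp (fun ω => X ω k l) 2 P :=
  ((h.gaussian.eval k).eval l).memLp_two

theorem measurable_eval (h : IsGaussianArray P X R) (k : κ) (l : ι) :
    Measurable (fun ω => X ω k l) :=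
  (measurable_pi_apply l).comp ((measurable_pi_apply k).comp h.measurable)

theorem variance_eq (h : IsGaussianArray P X R) (k : κ) (l : ι) :
    variance (fun ω => X ω k l) P = R k k := by
  rw [← covariance_self (h.measurable_eval k l).aemeasurable, h.cov_eq, if_pos rfl]

theorem comp_measurePreserving {Ω' : Type*} [MeasurableSpace Ω'] {P' : Measure Ω'}
    (h : IsGaussianArray P X R) {T : Ω' → Ω} (hT : MeasurePreserving T P' P) :
    IsGaussianArray P' (fun ω => X (T ω)) R where
  measurable := h.measurable.comp hT.measurable
  gaussian := by
    refine ⟨?_⟩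
    have : P'.map (fun ω => X (T ω)) = P.map X := by
      rw [← hT.map_eq, Measure.map_map h.measurable hT.measurable]
      rfl
    rw [this]
    exact h.gaussian.isGaussian_map
  mean_zero k l := by
    rw [← h.mean_zero k l, ← hT.map_eq, integral_map hT.measurable.aemeasurable
      (h.measurable_eval k l).aestronglyMeasurable]
  cov_eq k l k' l' := by
    rw [← h.cov_eq k l k' l', ← hT.map_eq, covariance_map_fun
      (h.measurable_eval k l).aestronglyMeasurable (h.measurable_eval k' l').aestronglyMeasurable
      hT.measurable.aemeasurable]

theorem covariance_eq_zero_of_indep {Z : Ω → κ → ι → ℝ} {R' : κ → κ → ℝ}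
    (hX : IsGaussianArray P X R) (hZ : IsGaussianArray P Z R') (hXZ : IndepFun X Z P)
    (k : κ) (l : ι) (k' : κ) (l' : ι) :
    covariance (fun ω => X ω k l) (fun ω => Z ω k' l') P = 0 := by
  have h := hXZ.comp (φ := fun x : κ → ι → ℝ => x k l) (ψ := fun x : κ → ι → ℝ => x k' l')
    (by fun_prop) (by fun_prop)
  exact h.covariance_eq_zero (hX.memLp k l) (hZ.memLp k' l')

theorem interp {Z : Ω → κ → ι → ℝ} {R' : κ → κ → ℝ} (hX : IsGaussianArray P X R)
    (hZ : IsGaussianArray P Z R') (hXZ : IndepFun X Z P) (θ : ℝ) :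
    IsGaussianArray P (RandomReplacing.interp X Z θ)
      (fun k k' => Real.cos θ ^ 2 * R' k k' + Real.sin θ ^ 2 * R k k') := by
  have hprob := hX.gaussian.isProbabilityMeasure
  have e : ∀ ω k l, RandomReplacing.interp X Z θ ω k l =
      Real.cos θ * Z ω k l + Real.sin θ * X ω k l := fun ω k l => by
    simp [RandomReplacing.interp]
  have hj : HasGaussianLaw (fun ω => (X ω, Z ω)) P :=
    IndepFun.hasGaussianLaw hX.gaussian hZ.gaussian hXZ
  refine ⟨?_, hasGaussianLaw_interp hj θ,
    fun k l => ?_, fun k l k' l' => ?_⟩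
  · exact (hZ.measurable.const_smul (Real.cos θ)).add (hX.measurable.const_smul (Real.sin θ))
  · simp only [e]
    rw [integral_add (((hZ.memLp k l).integrable one_le_two).const_mul _)
      (((hX.memLp k l).integrable one_le_two).const_mul _), integral_const_mul,
      integral_const_mul, hX.mean_zero, hZ.mean_zero]
    simp
  · have e' : (fun ω => RandomReplacing.interp X Z θ ω k l) =
        fun ω => Real.cos θ * Z ω k l + Real.sin θ * X ω k l := funext fun ω => e ω k l
    rw [e', covariance_interp hX.memLp hZ.memLp (covariance_eq_zero_of_indep hX hZ hXZ),
      hX.cov_eq, hZ.cov_eq]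
    split_ifs <;> ring

theorem prod_right {Ω' : Type*} [MeasurableSpace Ω'] (P' : Measure Ω') [IsProbabilityMeasure P']
    (hX : IsGaussianArray P X R) : IsGaussianArray (P.prod P') (fun ω => X ω.1) R :=
  hX.comp_measurePreserving measurePreserving_fst

end IsGaussianArray

section StandardNormal

variable (κ ι : Type*) [Fintype κ] [Fintype ι]

/-- The law of an array of independent standard normal variables. -/
noncomputable def stdNormalArray : Measure (κ → ι → ℝ) :=
  Measure.pi fun _ : κ => Measure.pi fun _ : ι => gaussianReal 0 1

instance : IsProbabilityMeasure (stdNormalArray κ ι) := by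
  unfold stdNormalArray; infer_instance

theorem hasGaussianLaw_pi_gaussianReal :
    HasGaussianLaw (fun x : ι → ℝ => x) (Measure.pi fun _ : ι => gaussianReal 0 1) := by
  refine iIndepFun.hasGaussianLaw (X := fun l (x : ι → ℝ) => x l) (fun l => ⟨?_⟩)
    (iIndepFun_pi (X := fun _ => id) fun _ => aemeasurable_id)
  rw [(measurePreserving_eval (fun _ : ι => gaussianReal 0 1) l).map_eq]
  infer_instance

theorem isGaussianArray_stdNormalArray [DecidableEq κ] [DecidableEq ι] :
    IsGaussianArray (stdNormalArray κ ι) (fun z => z) (fun k k' => if k' = k then 1 else 0) := by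
  have hrow : ∀ k : κ, MeasurePreserving (fun z : κ → ι → ℝ => z k) (stdNormalArray κ ι)
      (Measure.pi fun _ : ι => gaussianReal 0 1) := fun k =>
    measurePreserving_eval (fun _ : κ => Measure.pi fun _ : ι => gaussianReal 0 1) k
  have hent : ∀ (k : κ) (l : ι), MeasurePreserving (fun z : κ → ι → ℝ => z k l)
      (stdNormalArray κ ι) (gaussianReal 0 1) := fun k l =>
    (measurePreserving_eval (fun _ : ι => gaussianReal 0 1) l).comp (hrow k)
  have hindrow : iIndepFun (fun k (z : κ → ι → ℝ) => z k) (stdNormalArray κ ι) :=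
    iIndepFun_pi (X := fun _ => id) fun _ => aemeasurable_id
  have hindent : iIndepFun (fun l (x : ι → ℝ) => x l)
      (Measure.pi fun _ : ι => gaussianReal 0 1) :=
    iIndepFun_pi (X := fun _ => id) fun _ => aemeasurable_id
  have hgauss : HasGaussianLaw (fun z : κ → ι → ℝ => z) (stdNormalArray κ ι) := by
    refine iIndepFun.hasGaussianLaw (X := fun k (z : κ → ι → ℝ) => z k) (fun k => ⟨?_⟩) hindrow
    rw [(hrow k).map_eq]
    have := (hasGaussianLaw_pi_gaussianReal ι).isGaussian_map
    rwa [Measure.map_id'] at this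
  have hmem : ∀ k l, MemLp (fun z : κ → ι → ℝ => z k l) 2 (stdNormalArray κ ι) := fun k l =>
    ((hgauss.eval k).eval l).memLp_two
  refine ⟨measurable_id, hgauss, fun k l => ?_, fun k l k' l' => ?_⟩
  · have := integral_map (μ := stdNormalArray κ ι) (φ := fun z : κ → ι → ℝ => z k l)
      (f := fun x : ℝ => x) (hent k l).measurable.aemeasurable (by fun_prop)
    rw [← this, (hent k l).map_eq, integral_id_gaussianReal]
  · by_cases hk : k' = k
    · subst hk
      by_cases hl : l' = l
      · subst hl
        rw [covariance_self (hent k' l').measurable.aemeasurable,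
          ← variance_id_map (hent k' l').measurable.aemeasurable, (hent k' l').map_eq,
          variance_id_gaussianReal]
        simp
      · have h1 := hindent.indepFun (Ne.symm hl)
        have h2 := covariance_map_fun (μ := stdNormalArray κ ι) (Z := fun z : κ → ι → ℝ => z k')
          (X := fun x : ι → ℝ => x l) (Y := fun x : ι → ℝ => x l')
          (measurable_pi_apply l).aestronglyMeasurable
          (measurable_pi_apply l').aestronglyMeasurable (hrow k').measurable.aemeasurable
        rw [(hrow k').map_eq, h1.covariance_eq_zero
          ((hasGaussianLaw_pi_gaussianReal ι).eval l).memLp_two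
          ((hasGaussianLaw_pi_gaussianReal ι).eval l').memLp_two] at h2
        rw [← h2, if_neg hl]
    · have h1 := (hindrow.indepFun (Ne.symm hk)).comp (measurable_pi_apply l)
        (measurable_pi_apply l')
      have h2 := h1.covariance_eq_zero (hmem k l) (hmem k' l')
      simp only [hk, if_false, ite_self]
      exact h2

theorem stdNormalArray_real_pi (S : Finset κ) (B : κ → Set (ι → ℝ)) :
    (stdNormalArray κ ι).real {z | ∀ k ∈ S, z k ∈ B k} =
      ∏ k ∈ S, (Measure.pi fun _ : ι => gaussianReal 0 1).real (B k) := by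
  classical
  have e : {z : κ → ι → ℝ | ∀ k ∈ S, z k ∈ B k} =
      Set.univ.pi fun k => if k ∈ S then B k else Set.univ := by
    ext z
    simp only [Set.mem_ofPred_eq, Set.mem_pi, Set.mem_univ, forall_true_left]
    refine forall_congr' fun k => ?_
    by_cases hk : k ∈ S <;> simp [hk]
  rw [e, measureReal_def, stdNormalArray, Measure.pi_pi, ENNReal.toReal_prod]
  have : ∀ k, ((Measure.pi fun _ : ι => gaussianReal 0 1)
      (if k ∈ S then B k else Set.univ)).toReal =
      if k ∈ S then (Measure.pi fun _ : ι => gaussianReal 0 1).real (B k) else 1 := fun k => by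
    split_ifs
    · rfl
    · simp
  simp only [this, Finset.prod_ite_mem, Finset.univ_inter]

end StandardNormal

/-! ### Asymptotic independence -/

theorem prod_sub_prod_le_sum {κ : Type*} (S : Finset κ) {a b : κ → ℝ} (ha : ∀ k, 0 ≤ a k)
    (hab : ∀ k, a k ≤ b k) (hb : ∀ k, b k ≤ 1) :
    ∏ k ∈ S, b k - ∏ k ∈ S, a k ≤ ∑ k ∈ S, (b k - a k) := by
  classical
  induction S using Finset.induction_on with
  | empty => simp
  | insert k S hk ih =>
    rw [Finset.prod_insert hk, Finset.prod_insert hk, Finset.sum_insert hk]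
    have h1 : ∏ k ∈ S, b k ≤ 1 := Finset.prod_le_one (fun k _ => (ha k).trans (hab k))
      fun k _ => hb k
    have h0 : ∏ k ∈ S, a k ≤ ∏ k ∈ S, b k := Finset.prod_le_prod (fun k _ => ha k)
      fun k _ => hab k
    have h2 := mul_le_of_le_one_left (sub_nonneg.2 h0) ((hab k).trans (hb k))
    have h3 := mul_le_of_le_one_right (sub_nonneg.2 (hab k)) h1
    nlinarith

theorem orderTail_antitone {d r : ℕ} (hr : 1 ≤ r ∧ r ≤ d) : Antitone (orderTail d r hr) :=
  fun _ _ h => measureReal_mono fun _ hx => lt_of_le_of_lt h hx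

theorem orderTail_nonneg {d r : ℕ} (hr : 1 ≤ r ∧ r ≤ d) (u : ℝ) : 0 ≤ orderTail d r hr u :=
  measureReal_nonneg

theorem orderTail_le_one {d r : ℕ} (hr : 1 ≤ r ∧ r ≤ d) (u : ℝ) : orderTail d r hr u ≤ 1 :=
  measureReal_le_one

theorem measureReal_upperOrderStat_le {d r : ℕ} (hr : 1 ≤ r ∧ r ≤ d) (u : ℝ) :
    (Measure.pi fun _ : Fin d => gaussianReal 0 1).real {x | upperOrderStat x r hr ≤ u} =
      1 - orderTail d r hr u := by
  have e : {x : Fin d → ℝ | upperOrderStat x r hr ≤ u} =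
      {x : Fin d → ℝ | u < upperOrderStat x r hr}ᶜ := by
    ext x; simp
  rw [e, probReal_compl_eq_one_sub
    (measurableSet_lt measurable_const (measurable_upperOrderStat r hr)), orderTail]

/-- The sum over all ordered pairs of distinct rows of the correlation times the pair bound at the
level `u`. -/
noncomputable def pairSum (d r n : ℕ) (ρ : ℕ → ℝ) (u : ℝ) : ℝ :=
  ∑ k : Fin n, ∑ k' ∈ Finset.univ.erase k,
    |ρ (Nat.dist k k')| * pairBound d r |ρ (Nat.dist k k')| u

theorem dist_pos_of_ne {n : ℕ} {k k' : Fin n} (h : k ≠ k') : 1 ≤ Nat.dist (k : ℕ) k' := by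
  have h1 : (k : ℕ) ≠ k' := fun h' => h (Fin.ext h')
  rw [Nat.dist]
  omega

theorem measureReal_preimage_le_integral {Ω E : Type*} [MeasurableSpace Ω] [MeasurableSpace E]
    (Q : Measure Ω) [IsProbabilityMeasure Q] {W : Ω → E} (hW : Measurable W) {f : E → ℝ}
    (hf : Measurable f) (hf1 : ∀ x, |f x| ≤ 1) {A A' : Set E} (hA : MeasurableSet A)
    (hA' : MeasurableSet A') (hlow : ∀ x, A.indicator 1 x ≤ f x)
    (hupp : ∀ x, f x ≤ A'.indicator 1 x) :
    Q.real (W ⁻¹' A) ≤ ∫ ω, f (W ω) ∂Q ∧ ∫ ω, f (W ω) ∂Q ≤ Q.real (W ⁻¹' A') := by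
  have hint : Integrable (fun ω => f (W ω)) Q :=
    Integrable.of_bound (hf.comp hW).aestronglyMeasurable 1 (Eventually.of_forall fun ω =>
      hf1 (W ω))
  have hintind : ∀ {C : Set E}, MeasurableSet C →
      Integrable (fun ω => (W ⁻¹' C).indicator (1 : Ω → ℝ) ω) Q := fun hC =>
    (integrable_const (1 : ℝ)).indicator (hW hC)
  constructor
  · refine (integral_indicator_one (hW hA)).symm.le.trans ?_
    exact integral_mono (hintind hA) hint fun ω => hlow (W ω)
  · refine le_trans ?_ (integral_indicator_one (hW hA')).le
    exact integral_mono hint (hintind hA') fun ω => hupp (W ω)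

section

variable {Ω : Type*} [MeasurableSpace Ω] {P : Measure Ω} {d r n : ℕ} {ρ : ℕ → ℝ} {δ : ℝ}
  {X : Ω → Fin n → Fin d → ℝ}

/-- The comparison with independent variables for cutoffs whose gradients vanish unless the order
statistic exceeds `u`. -/
theorem abs_integral_prod_sub_stdNormalArray_le
    (hX : IsGaussianArray P X fun k k' => ρ (Nat.dist k k')) (hρ0 : ρ 0 = 1) (hδ1 : δ < 1)
    (hδ : ∀ m, 1 ≤ m → |ρ m| ≤ δ) (hr : 1 ≤ r ∧ r ≤ d) {g : Fin n → (Fin d → ℝ) → ℝ}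
    (hg : ∀ k, ContDiff ℝ 1 (g k)) (h0 : ∀ k x, 0 ≤ g k x) (h1 : ∀ k x, g k x ≤ 1)
    {B : Fin n → Set (Fin d → ℝ)} (hB : ∀ k, MeasurableSet (B k)) {L : ℝ} (hL0 : 0 ≤ L)
    (hL : ∀ k x l, |fderiv ℝ (g k) x (Pi.single l 1)| ≤ (B k).indicator (fun _ => L) x)
    {u : ℝ} (hu : 0 ≤ u) (hBu : ∀ k, ∀ x ∈ B k, u < upperOrderStat x r hr) :
    |∫ ω, ∏ k, g k (X ω k) ∂P - ∫ z, ∏ k, g k (z k) ∂(stdNormalArray (Fin n) (Fin d))| ≤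
      2 * (d * L ^ 2 * pairSum d r n ρ u) := by
  have hprob := hX.gaussian.isProbabilityMeasure
  set ν := stdNormalArray (Fin n) (Fin d) with hν
  have hX' : IsGaussianArray (P.prod ν) (fun p => X p.1) _ := hX.prod_right ν
  have hZ' : IsGaussianArray (P.prod ν) (fun p => p.2) _ :=
    (isGaussianArray_stdNormalArray (Fin n) (Fin d)).comp_measurePreserving
      (T := fun p : Ω × (Fin n → Fin d → ℝ) => p.2) measurePreserving_snd
  have hind : IndepFun (fun p : Ω × (Fin n → Fin d → ℝ) => X p.1) (fun p => p.2) (P.prod ν) :=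
    indepFun_prod hX.measurable measurable_id
  have hj : HasGaussianLaw (fun p : Ω × (Fin n → Fin d → ℝ) => (X p.1, p.2)) (P.prod ν) :=
    IndepFun.hasGaussianLaw hX'.gaussian hZ'.gaussian hind
  have hmain := abs_integral_prod_sub_le hj hX'.measurable hZ'.measurable hX'.mean_zero
    hZ'.mean_zero (fun k k' => ρ (Nat.dist k k')) (fun k => by rw [Nat.dist_self, hρ0])
    hX'.cov_eq (fun k l k' l' => by rw [hZ'.cov_eq, ite_and])
    (hX'.covariance_eq_zero_of_indep hZ' hind) hg h0 h1 hB hL0 hL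
    (fun k k' => pairBound d r |ρ (Nat.dist k k')| u) (fun θ k k' hkk => ?_)
  · have hmeas : Measurable (fun x : Fin n → Fin d → ℝ => ∏ k, g k (x k)) :=
      Finset.measurable_prod _ fun k _ => (hg k).continuous.measurable.comp (measurable_pi_apply k)
    have e1 : ∫ p : Ω × (Fin n → Fin d → ℝ), ∏ k, g k (X p.1 k) ∂(P.prod ν) =
        ∫ ω, ∏ k, g k (X ω k) ∂P := by
      have := integral_map (μ := P.prod ν) (φ := Prod.fst) (f := fun ω => ∏ k, g k (X ω k))
        measurable_fst.aemeasurable (hmeas.comp hX.measurable).aestronglyMeasurable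
      rw [← this, measurePreserving_fst.map_eq]
    have e2 : ∫ p : Ω × (Fin n → Fin d → ℝ), ∏ k, g k (p.2 k) ∂(P.prod ν) =
        ∫ z, ∏ k, g k (z k) ∂ν := by
      have := integral_map (μ := P.prod ν) (φ := Prod.snd)
        (f := fun z : Fin n → Fin d → ℝ => ∏ k, g k (z k))
        measurable_snd.aemeasurable hmeas.aestronglyMeasurable
      rw [← this, measurePreserving_snd.map_eq]
    rw [e1, e2, Fintype.card_fin] at hmain
    exact hmain
  · have hW := hX'.interp hZ' hind θ
    have hdist := dist_pos_of_ne hkk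
    refine (measureReal_mono ?_ (measure_ne_top _ _)).trans
      (measureReal_upperOrderStat_pair_le hr hW.gaussian hW.mean_zero (fun k l => ?_)
        (fun k l k' l' hl => ?_) (k := k) (k' := k') (q := |ρ (Nat.dist k k')|) (fun l => ?_)
        ((hδ _ hdist).trans_lt hδ1) hu)
    · rintro p ⟨hp, hp'⟩
      exact ⟨hBu k _ hp, hBu k' _ hp'⟩
    · rw [hW.variance_eq, Nat.dist_self, hρ0]
      simp
    · rw [hW.cov_eq, if_neg (Ne.symm hl)]
    · rw [hW.cov_eq, if_pos rfl, if_neg (Ne.symm hkk), mul_zero, zero_add, abs_mul,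
        abs_of_nonneg (sq_nonneg _)]
      exact mul_le_of_le_one_left (abs_nonneg _) (Real.sin_sq_le_one θ)

/-- The joint distribution function of the order statistics lies between those of independent rows
at levels shifted by `w`, up to the error of the comparison for cutoffs of width `w`. -/
theorem exists_smooth_sandwich (hr : 1 ≤ r ∧ r ≤ d) :
    ∃ L : ℝ, 0 ≤ L ∧ ∀ (Ω : Type _) [MeasurableSpace Ω] (P : Measure Ω)
      (n : ℕ) (ρ : ℕ → ℝ) (δ : ℝ) (X : Ω → Fin n → Fin d → ℝ)
      (_ : IsGaussianArray P X fun k k' => ρ (Nat.dist k k')) (_ : ρ 0 = 1) (_ : δ < 1)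
      (_ : ∀ m, 1 ≤ m → |ρ m| ≤ δ) (S : Finset (Fin n)) (v : Fin n → ℝ) (w u : ℝ) (_ : 0 < w)
      (_ : 0 ≤ u) (_ : ∀ k, u ≤ v k),
      P.real {ω | ∀ k ∈ S, upperOrderStat (X ω k) r hr ≤ v k} ≤
          ∏ k ∈ S, (1 - orderTail d r hr (v k + w)) + 2 * (d * (L / w) ^ 2 * pairSum d r n ρ u) ∧
        ∏ k ∈ S, (1 - orderTail d r hr (v k)) - 2 * (d * (L / w) ^ 2 * pairSum d r n ρ u) ≤
          P.real {ω | ∀ k ∈ S, upperOrderStat (X ω k) r hr ≤ v k + w} := by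
  classical
  obtain ⟨L, hL0, hcut⟩ := exists_smooth_cutoff hr
  refine ⟨L, hL0, fun Ω _ P n ρ δ X hX hρ0 hδ1 hδ S v w u hw hu huv => ?_⟩
  have hprob := hX.gaussian.isProbabilityMeasure
  choose g hgC hg0 hg1 hgone hgzero hgL using fun k => hcut (v k) w hw
  set ν := stdNormalArray (Fin n) (Fin d) with hν
  -- rows outside of `S` get the trivial cutoff
  let G : Fin n → (Fin d → ℝ) → ℝ := fun k => if k ∈ S then g k else fun _ => 1
  let B : Fin n → Set (Fin d → ℝ) := fun k =>
    if k ∈ S then {x | v k < upperOrderStat x r hr} else ∅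
  have hGC : ∀ k, ContDiff ℝ 1 (G k) := fun k => by
    simp only [G]; split_ifs
    · exact hgC k
    · exact contDiff_const
  have hG0 : ∀ k x, 0 ≤ G k x := fun k x => by
    simp only [G]; split_ifs
    · exact hg0 k x
    · exact zero_le_one
  have hG1 : ∀ k x, G k x ≤ 1 := fun k x => by
    simp only [G]; split_ifs
    · exact hg1 k x
    · exact le_rfl
  have hBm : ∀ k, MeasurableSet (B k) := fun k => by
    simp only [B]; split_ifs
    · exact measurableSet_lt measurable_const (measurable_upperOrderStat r hr)
    · exact MeasurableSet.empty
  have hGL : ∀ k x l, |fderiv ℝ (G k) x (Pi.single l 1)| ≤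
      (B k).indicator (fun _ => L / w) x := fun k x l => by
    simp only [G, B]; split_ifs
    · exact hgL k x l
    · simp
  have hBu : ∀ k, ∀ x ∈ B k, u < upperOrderStat x r hr := fun k x hx => by
    simp only [B] at hx
    split_ifs at hx
    · exact (huv k).trans_lt hx
    · exact absurd hx (Set.notMem_empty x)
  have hcomp := abs_integral_prod_sub_stdNormalArray_le hX hρ0 hδ1 hδ hr hGC hG0 hG1 hBm
    (div_nonneg hL0 hw.le) hGL hu hBu
  -- the product of cutoffs lies between the indicators of the two events
  have hprodG : ∀ x : Fin n → Fin d → ℝ, ∏ k, G k (x k) = ∏ k ∈ S, g k (x k) := fun x => by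
    simp only [G, ite_apply, Finset.prod_ite_mem, Finset.univ_inter]
  have hlow : ∀ x : Fin n → Fin d → ℝ,
      ({x | ∀ k ∈ S, upperOrderStat (x k) r hr ≤ v k} : Set (Fin n → Fin d → ℝ)).indicator 1 x ≤
        ∏ k, G k (x k) := fun x => by
    by_cases hx : ∀ k ∈ S, upperOrderStat (x k) r hr ≤ v k
    · rw [Set.indicator_of_mem (by exact hx), hprodG,
        Finset.prod_eq_one fun k hk => hgone k _ (hx k hk), Pi.one_apply]
    · rw [Set.indicator_of_notMem (by exact hx)]
      exact Finset.prod_nonneg fun k _ => hG0 k _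
  have hupp : ∀ x : Fin n → Fin d → ℝ, ∏ k, G k (x k) ≤
      ({x | ∀ k ∈ S, upperOrderStat (x k) r hr ≤ v k + w} :
        Set (Fin n → Fin d → ℝ)).indicator 1 x := fun x => by
    by_cases hx : ∀ k ∈ S, upperOrderStat (x k) r hr ≤ v k + w
    · rw [Set.indicator_of_mem (by exact hx)]
      exact Finset.prod_le_one (fun k _ => hG0 k _) fun k _ => hG1 k _
    · rw [Set.indicator_of_notMem (by exact hx), hprodG]
      push Not at hx
      obtain ⟨k, hk, hkx⟩ := hx
      exact (Finset.prod_eq_zero hk (hgzero k _ hkx)).le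
  have hEm : ∀ v : Fin n → ℝ, MeasurableSet
      ({x | ∀ k ∈ S, upperOrderStat (x k) r hr ≤ v k} : Set (Fin n → Fin d → ℝ)) := fun v => by
    have : ({x | ∀ k ∈ S, upperOrderStat (x k) r hr ≤ v k} : Set (Fin n → Fin d → ℝ)) =
        ⋂ k ∈ S, {x | upperOrderStat (x k) r hr ≤ v k} := by
      ext x; simp
    rw [this]
    exact Finset.measurableSet_biInter _ fun k _ => measurableSet_le
      ((measurable_upperOrderStat r hr).comp (measurable_pi_apply k)) measurable_const
  have hGm : Measurable (fun x : Fin n → Fin d → ℝ => ∏ k, G k (x k)) :=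
    Finset.measurable_prod _ fun k _ => (hGC k).continuous.measurable.comp (measurable_pi_apply k)
  have habs : ∀ x : Fin n → Fin d → ℝ, |∏ k, G k (x k)| ≤ 1 := fun x =>
    abs_prod_le_one _ (fun k => hG0 k _) fun k => hG1 k _
  have hP := measureReal_preimage_le_integral P hX.measurable hGm habs (hEm v) (hEm _) hlow hupp
  have hZ := measureReal_preimage_le_integral ν (W := fun z => z) measurable_id hGm habs (hEm v)
    (hEm _) hlow hupp
  have hprodν : ∀ v : Fin n → ℝ, ν.real {z | ∀ k ∈ S, upperOrderStat (z k) r hr ≤ v k} =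
      ∏ k ∈ S, (1 - orderTail d r hr (v k)) := fun v => by
    have := stdNormalArray_real_pi (Fin n) (Fin d) S
      fun k => {x | upperOrderStat x r hr ≤ v k}
    simp only [measureReal_upperOrderStat_le] at this
    exact this
  have hZ1 := (hprodν v).symm.le.trans hZ.1
  have hZ2 := hZ.2.trans (hprodν fun k => v k + w).le
  have hP1 : P.real {ω | ∀ k ∈ S, upperOrderStat (X ω k) r hr ≤ v k} ≤ _ := hP.1
  have hP2 : _ ≤ P.real {ω | ∀ k ∈ S, upperOrderStat (X ω k) r hr ≤ v k + w} := hP.2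
  rw [← hν] at hcomp
  obtain ⟨hc1, hc2⟩ := abs_le.1 hcomp
  exact ⟨by linarith, by linarith⟩

end

theorem level_add {d r n : ℕ} (x κ : ℝ) :
    level d r n (x + κ) = level d r n x + (scaleConst r n)⁻¹ * κ := by
  simp only [level]; ring

theorem level_mono {d r n : ℕ} : Monotone (level d r n) := fun _ _ h =>
  add_le_add_left (mul_le_mul_of_nonneg_left h (inv_nonneg.2 (Real.sqrt_nonneg _))) _

theorem exists_sum_exp_sub_exp_lt (z₁ z₂ : ℝ) {ε : ℝ} (hε : 0 < ε) :
    ∃ κ : ℝ, 0 < κ ∧ (Real.exp (-(z₁ - κ)) - Real.exp (-(z₁ + κ))) +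
      (Real.exp (-(z₂ - κ)) - Real.exp (-(z₂ + κ))) < ε := by
  have hc : Continuous fun κ : ℝ => (Real.exp (-(z₁ - κ)) - Real.exp (-(z₁ + κ))) +
      (Real.exp (-(z₂ - κ)) - Real.exp (-(z₂ + κ))) := by fun_prop
  have h0 := hc.tendsto 0
  simp only [sub_zero, add_zero, sub_self] at h0
  have h1 := (h0.mono_left (nhdsWithin_le_nhds (s := Set.Ioi 0))).eventually (gt_mem_nhds hε)
  obtain ⟨κ, h2, h3⟩ := (h1.and self_mem_nhdsWithin).exists
  exact ⟨κ, h3, h2⟩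

/-- The order statistics of the rows are asymptotically independent, uniformly over the sets of rows
and over the assignments of two levels to them. Cutoffs of width `w = κ / a_n` change the
parameter of a level by `κ`. -/
theorem eventually_abs_measureReal_sub_prod_le {Ω : Type*} [MeasurableSpace Ω] {P : Measure Ω}
    {d r : ℕ} (hr : 1 ≤ r ∧ r ≤ d) {ρ : ℕ → ℝ} {δ : ℝ} {X : ∀ n : ℕ, Ω → Fin n → Fin d → ℝ}
    (hX : ∀ n, IsGaussianArray P (X n) fun k k' => ρ (Nat.dist k k')) (hρ0 : ρ 0 = 1)
    (hδ1 : δ < 1) (hδ : ∀ m, 1 ≤ m → |ρ m| ≤ δ)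
    (hρ : Tendsto (fun n : ℕ => ρ n * Real.log n) atTop (𝓝 0)) (z₁ z₂ : ℝ) {ε : ℝ}
    (hε : 0 < ε) :
    ∀ᶠ n in atTop, ∀ (S : Finset (Fin n)) (z : Fin n → ℝ), (∀ k, z k = z₁ ∨ z k = z₂) →
      |P.real {ω | ∀ k ∈ S, upperOrderStat (X n ω k) r hr ≤ level d r n (z k)} -
        ∏ k ∈ S, (1 - orderTail d r hr (level d r n (z k)))| ≤ ε := by
  obtain ⟨L, hL0, hsand⟩ := exists_smooth_sandwich hr
  obtain ⟨κ, hκ, hκε⟩ := exists_sum_exp_sub_exp_lt z₁ z₂ (half_pos hε)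
  set T := orderTail d r hr with hT
  have hTanti : Antitone T := orderTail_antitone hr
  -- the change of the product when every level moves by `κ / a_n`
  have hD := ((tendsto_mul_orderTail hr (z₁ - κ)).sub (tendsto_mul_orderTail hr (z₁ + κ))).add
    ((tendsto_mul_orderTail hr (z₂ - κ)).sub (tendsto_mul_orderTail hr (z₂ + κ)))
  -- the error of the comparison with independent variables
  have hE : Tendsto (fun n => 2 * (d * (L / ((scaleConst r n)⁻¹ * κ)) ^ 2 *
      pairSum d r n ρ (level d r n (min z₁ z₂ - κ)))) atTop (𝓝 0) := by
    have := (tendsto_pair_sum hδ1 hδ hρ hr (min z₁ z₂ - κ)).const_mul (2 * (d * (L / κ) ^ 2))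
    rw [mul_zero] at this
    refine this.congr fun n => ?_
    rw [pairSum, div_mul_eq_div_div, div_inv_eq_mul]
    ring
  filter_upwards [hD.eventually (gt_mem_nhds hκε), hE.eventually (gt_mem_nhds (half_pos hε)),
    (tendsto_level_atTop hr (min z₁ z₂ - κ)).eventually_ge_atTop 0,
    (tendsto_scaleConst hr.1).eventually_gt_atTop 0] with n hnD hnE hnu hna S z hz
  set w := (scaleConst r n)⁻¹ * κ with hw
  have hw0 : 0 < w := mul_pos (inv_pos.2 hna) hκ
  have hsub : ∀ x, level d r n (x - κ) = level d r n x - w := fun x => by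
    rw [sub_eq_add_neg, level_add, hw]; ring
  have hzmin : ∀ k, level d r n (min z₁ z₂ - κ) ≤ level d r n (z k) - w := fun k => by
    rw [← hsub]
    refine level_mono (sub_le_sub_right ?_ κ)
    rcases hz k with h | h <;> rw [h]
    · exact min_le_left _ _
    · exact min_le_right _ _
  -- the tail of one entry changes by at most the sum of the changes at the two levels
  have hDk : ∀ k, T (level d r n (z k) - w) - T (level d r n (z k) + w) ≤
      (T (level d r n (z₁ - κ)) - T (level d r n (z₁ + κ))) +
        (T (level d r n (z₂ - κ)) - T (level d r n (z₂ + κ))) := fun k => by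
    have a : ∀ x, 0 ≤ T (level d r n (x - κ)) - T (level d r n (x + κ)) := fun x =>
      sub_nonneg.2 (hTanti (level_mono (by linarith)))
    rw [← hsub, hw, ← level_add]
    rcases hz k with h | h <;> rw [h]
    · linarith [a z₂]
    · linarith [a z₁]
  have hsum : ∑ k ∈ S, (T (level d r n (z k) - w) - T (level d r n (z k) + w)) ≤ ε / 2 := by
    have hcard : (S.card : ℝ) ≤ n := by
      exact_mod_cast (Finset.card_le_univ S).trans_eq (Fintype.card_fin n)
    refine (Finset.sum_le_card_nsmul S _ _ fun k _ => hDk k).trans ?_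
    have a : ∀ x, 0 ≤ T (level d r n (x - κ)) - T (level d r n (x + κ)) := fun x =>
      sub_nonneg.2 (hTanti (level_mono (by linarith)))
    rw [nsmul_eq_mul]
    refine (mul_le_mul_of_nonneg_right hcard (add_nonneg (a z₁) (a z₂))).trans ?_
    linarith
  have hT0 : ∀ u, 0 ≤ 1 - T u := fun u => sub_nonneg.2 (orderTail_le_one hr u)
  have hT1 : ∀ u, 1 - T u ≤ 1 := fun u => sub_le_self _ (orderTail_nonneg hr u)
  have hup := (hsand Ω P n ρ δ (X n) (hX n) hρ0 hδ1 hδ S (fun k => level d r n (z k)) w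
    (level d r n (min z₁ z₂ - κ)) hw0 hnu fun k => (hzmin k).trans (by linarith)).1
  have hlo := (hsand Ω P n ρ δ (X n) (hX n) hρ0 hδ1 hδ S (fun k => level d r n (z k) - w) w
    (level d r n (min z₁ z₂ - κ)) hw0 hnu hzmin).2
  simp only [sub_add_cancel] at hlo
  have hpu := prod_sub_prod_le_sum S (a := fun k => 1 - T (level d r n (z k)))
    (b := fun k => 1 - T (level d r n (z k) + w)) (fun k => hT0 _)
    (fun k => sub_le_sub_left (hTanti (by linarith)) 1) fun k => hT1 _
  have hpl := prod_sub_prod_le_sum S (a := fun k => 1 - T (level d r n (z k) - w))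
    (b := fun k => 1 - T (level d r n (z k))) (fun k => hT0 _)
    (fun k => sub_le_sub_left (hTanti (by linarith)) 1) fun k => hT1 _
  have hsu : ∑ k ∈ S, ((1 - T (level d r n (z k) + w)) - (1 - T (level d r n (z k)))) ≤
      ∑ k ∈ S, (T (level d r n (z k) - w) - T (level d r n (z k) + w)) :=
    Finset.sum_le_sum fun k _ => by
      linarith [hTanti (by linarith : level d r n (z k) - w ≤ level d r n (z k))]
  have hsl : ∑ k ∈ S, ((1 - T (level d r n (z k))) - (1 - T (level d r n (z k) - w))) ≤
      ∑ k ∈ S, (T (level d r n (z k) - w) - T (level d r n (z k) + w)) :=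
    Finset.sum_le_sum fun k _ => by
      linarith [hTanti (by linarith : level d r n (z k) ≤ level d r n (z k) + w)]
  rw [abs_le]
  constructor <;> linarith

/-! ### Stationary Gaussian sequences -/

namespace IsStdStationaryGaussian

variable {Ω : Type*} [MeasurableSpace Ω] {P : Measure Ω} {Y Z : ℕ → Ω → ℝ} {ρ : ℕ → ℝ}

theorem of_isCopy (hY : IsStdStationaryGaussian P Y ρ) (hZY : IsCopy P Z Y) :
    IsStdStationaryGaussian P Z ρ where
  gaussian := ⟨fun I => ⟨by
    have h : IdentDistrib (fun ω => I.restrict (Z · ω)) (fun ω => I.restrict (Y · ω)) P P :=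
      hZY.comp (u := fun x : ℕ → ℝ => I.restrict x) (by fun_prop)
    rw [h.map_eq]
    exact (hY.gaussian.hasGaussianLaw I).isGaussian_map⟩⟩
  mean_zero i := by
    rw [← hY.mean_zero i]
    exact (hZY.comp (measurable_pi_apply i)).integral_eq
  variance_one i := by
    rw [← hY.variance_one i]
    exact (hZY.comp (measurable_pi_apply i)).variance_eq
  covariance_eq i k := by
    rw [← hY.covariance_eq i k]
    have h1 := covariance_map_fun (μ := P) (Z := fun ω n => Z n ω) (X := fun x : ℕ → ℝ => x i)
      (Y := fun x : ℕ → ℝ => x (i + k)) (measurable_pi_apply i).aestronglyMeasurable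
      (measurable_pi_apply (i + k)).aestronglyMeasurable hZY.aemeasurable_fst
    have h2 := covariance_map_fun (μ := P) (Z := fun ω n => Y n ω) (X := fun x : ℕ → ℝ => x i)
      (Y := fun x : ℕ → ℝ => x (i + k)) (measurable_pi_apply i).aestronglyMeasurable
      (measurable_pi_apply (i + k)).aestronglyMeasurable hZY.aemeasurable_snd
    rw [hZY.map_eq] at h1
    exact h1.symm.trans h2

theorem memLp (hY : IsStdStationaryGaussian P Y ρ) (i : ℕ) : MemLp (Y i) 2 P :=
  (hY.gaussian.hasGaussianLaw_eval i).memLp_two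

theorem covariance_dist (hY : IsStdStationaryGaussian P Y ρ) (i k : ℕ) :
    covariance (Y i) (Y k) P = ρ (Nat.dist i k) := by
  rcases le_total i k with h | h
  · rw [Nat.dist_eq_sub_of_le h, ← hY.covariance_eq i, Nat.add_sub_cancel' h]
  · rw [Nat.dist_eq_sub_of_le_right h, ← hY.covariance_eq k, Nat.add_sub_cancel' h,
      covariance_comm]

theorem covariance_zero (hY : IsStdStationaryGaussian P Y ρ) : ρ 0 = 1 := by
  rw [← hY.variance_one 0, ← covariance_self (hY.gaussian.aemeasurable 0), hY.covariance_dist]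
  rfl

theorem variance_sub_mul (hY : IsStdStationaryGaussian P Y ρ) (s : ℝ) (i m : ℕ) :
    variance (fun ω => Y (i + m) ω - s * Y i ω) P = 1 - 2 * s * ρ m + s ^ 2 := by
  have hprob := hY.gaussian.isProbabilityMeasure
  have h := variance_fun_sub (hY.memLp (i + m)) ((hY.memLp i).const_mul s)
  rw [h, variance_const_mul, hY.variance_one, hY.variance_one, covariance_const_mul_right,
    covariance_comm, hY.covariance_eq]
  ring

theorem abs_covariance_le_one (hY : IsStdStationaryGaussian P Y ρ) (m : ℕ) : |ρ m| ≤ 1 := by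
  have h1 := variance_nonneg (fun ω => Y (0 + m) ω - 1 * Y 0 ω) P
  have h2 := variance_nonneg (fun ω => Y (0 + m) ω - (-1) * Y 0 ω) P
  rw [hY.variance_sub_mul] at h1 h2
  rw [abs_le]
  constructor <;> linarith

/-- A correlation of modulus one at lag `m` forces `Y (i + m) = ρ m * Y i` almost surely, hence
correlations of modulus one at all multiples of `m`. -/
theorem covariance_mul (hY : IsStdStationaryGaussian P Y ρ) {m : ℕ} (hm : |ρ m| = 1) (j : ℕ) :
    ρ (j * m) = ρ m ^ j := by
  have hprob := hY.gaussian.isProbabilityMeasure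
  induction j with
  | zero => simp [hY.covariance_zero]
  | succ j ih =>
    have hsq : ρ m ^ 2 = 1 := by rw [← sq_abs, hm, one_pow]
    have hL : MemLp (fun ω => Y (j * m + m) ω - ρ m * Y (j * m) ω) 2 P :=
      (hY.memLp _).sub ((hY.memLp _).const_mul _)
    have hv := hY.variance_sub_mul (ρ m) (j * m) m
    have hae := ae_eq_integral_of_variance_eq_zero hL (by rw [hv]; nlinarith)
    have hc : covariance (Y 0) (fun ω => Y (j * m + m) ω - ρ m * Y (j * m) ω) P = 0 := by
      refine integral_eq_zero_of_ae ?_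
      filter_upwards [hae] with ω hω
      rw [hω, sub_self, mul_zero, Pi.zero_apply]
    rw [covariance_fun_sub_right (hY.memLp _) (hY.memLp _) ((hY.memLp _).const_mul _),
      covariance_const_mul_right, hY.covariance_dist, hY.covariance_dist] at hc
    simp only [Nat.dist_zero_left] at hc
    rw [Nat.succ_mul, pow_succ, ← ih]
    linarith

theorem tendsto_covariance_zero
    (hρ : Tendsto (fun n : ℕ => ρ n * Real.log n) atTop (𝓝 0)) : Tendsto ρ atTop (𝓝 0) := by
  refine (hρ.div_atTop tendsto_log_natCast).congr' ?_
  filter_upwards [tendsto_log_natCast.eventually_gt_atTop 0] with n hn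
  rw [mul_div_cancel_right₀ _ hn.ne']

theorem abs_covariance_lt_one (hY : IsStdStationaryGaussian P Y ρ)
    (hρ : Tendsto ρ atTop (𝓝 0)) {m : ℕ} (hm : 1 ≤ m) : |ρ m| < 1 := by
  refine (hY.abs_covariance_le_one m).lt_of_ne fun h => ?_
  have h1 : Tendsto (fun j : ℕ => |ρ (j * m)|) atTop (𝓝 0) := by
    simpa using (hρ.comp (tendsto_id.atTop_mul_const' hm)).abs
  have h2 : (fun j : ℕ => |ρ (j * m)|) = fun _ => (1 : ℝ) := by
    ext j
    rw [hY.covariance_mul h, abs_pow, h, one_pow]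
  rw [h2] at h1
  exact one_ne_zero (tendsto_nhds_unique tendsto_const_nhds h1)

/-- The correlations at positive lags are bounded away from one in modulus: each is less than one,
and they tend to zero. -/
theorem exists_abs_covariance_le (hY : IsStdStationaryGaussian P Y ρ)
    (hρ : Tendsto ρ atTop (𝓝 0)) : ∃ δ < 1, ∀ m, 1 ≤ m → |ρ m| ≤ δ := by
  have h1 : ∀ᶠ m in atTop, |ρ m| ≤ 1 / 2 := by
    have := hρ.abs
    rw [abs_zero] at this
    exact this.eventually_le_const (by norm_num)
  obtain ⟨N, hN⟩ := eventually_atTop.1 h1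
  have h2 : ∀ N : ℕ, ∃ δ < (1 : ℝ), ∀ m, 1 ≤ m → m < N → |ρ m| ≤ δ := fun N => by
    induction N with
    | zero => exact ⟨0, one_pos, fun m _ h => absurd h (Nat.not_lt_zero m)⟩
    | succ N ih =>
      obtain ⟨δ, hδ1, hδ⟩ := ih
      rcases Nat.eq_zero_or_pos N with rfl | hN
      · exact ⟨δ, hδ1, fun m h1 h2 => absurd h2 (by omega)⟩
      · refine ⟨max δ |ρ N|, max_lt hδ1 (hY.abs_covariance_lt_one hρ hN), fun m h1 h2 => ?_⟩
        rcases Nat.lt_succ_iff_lt_or_eq.1 h2 with h | rfl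
        · exact (hδ m h1 h).trans (le_max_left _ _)
        · exact le_max_right _ _
  obtain ⟨δ, hδ1, hδ⟩ := h2 N
  refine ⟨max δ (1 / 2), max_lt hδ1 (by norm_num), fun m hm => ?_⟩
  rcases lt_or_ge m N with h | h
  · exact (hδ m hm h).trans (le_max_left _ _)
  · exact (hN m h).trans (le_max_right _ _)

theorem hasGaussianLaw_fin (hY : IsStdStationaryGaussian P Y ρ) (n : ℕ) :
    HasGaussianLaw (fun ω (k : Fin n) => Y k ω) P := by
  let L : (Finset.range n → ℝ) →L[ℝ] (Fin n → ℝ) :=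
    ContinuousLinearMap.pi fun k => ContinuousLinearMap.proj ⟨k, Finset.mem_range.2 k.2⟩
  exact (hY.gaussian.hasGaussianLaw (Finset.range n)).map_fun L

theorem isGaussianArray (hY : IsStdStationaryGaussian P Y ρ) {d : ℕ} {Yc : Fin d → ℕ → Ω → ℝ}
    (hmeas : ∀ j n, Measurable (Yc j n)) (hcopy : ∀ j, IsCopy P (Yc j) Y)
    (hindep : iIndepFun (fun j ω n => Yc j n ω) P) (n : ℕ) :
    IsGaussianArray P (fun ω (k : Fin n) (l : Fin d) => Yc l k ω)
      (fun k k' => ρ (Nat.dist k k')) where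
  measurable := measurable_pi_lambda _ fun k => measurable_pi_lambda _ fun l => hmeas l k
  gaussian := by
    have hcol : iIndepFun (fun (l : Fin d) ω (k : Fin n) => Yc l k ω) P :=
      hindep.comp (fun _ (x : ℕ → ℝ) (k : Fin n) => x k) fun _ =>
        measurable_pi_lambda _ fun k => measurable_pi_apply _
    have h := iIndepFun.hasGaussianLaw
      (fun l => (hY.of_isCopy (hcopy l)).hasGaussianLaw_fin n) hcol
    let L : (Fin d → Fin n → ℝ) →L[ℝ] (Fin n → Fin d → ℝ) :=
      ContinuousLinearMap.pi fun k => ContinuousLinearMap.pi fun l =>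
        (ContinuousLinearMap.proj (R := ℝ) (φ := fun _ : Fin n => ℝ) k).comp
          (ContinuousLinearMap.proj (R := ℝ) (φ := fun _ : Fin d => Fin n → ℝ) l)
    exact h.map_fun L
  mean_zero k l := (hY.of_isCopy (hcopy l)).mean_zero k
  cov_eq k l k' l' := by
    have hprob := hY.gaussian.isProbabilityMeasure
    split_ifs with h
    · subst h
      exact (hY.of_isCopy (hcopy l')).covariance_dist k k'
    · exact ((hindep.indepFun (Ne.symm h)).comp (measurable_pi_apply (k : ℕ))
        (measurable_pi_apply (k' : ℕ))).covariance_eq_zero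
          ((hY.of_isCopy (hcopy l)).memLp k) ((hY.of_isCopy (hcopy l')).memLp k')

end IsStdStationaryGaussian

/-! ### Conditioning on the replacement indicators -/

theorem partialMax_le_iff {Ω : Type*} (X : ℕ → Ω → ℝ) {n : ℕ} (hn : 1 ≤ n) (ω : Ω) (u : ℝ) :
    partialMax X n ω ≤ u ↔ ∀ k : Fin n, X k ω ≤ u := by
  have : Nonempty (Fin n) := ⟨⟨0, hn⟩⟩
  exact ciSup_le_iff (Set.finite_range _).bddAbove

open scoped Classical in
/-- The set of indices `k < n` with `e k = 1`. -/
noncomputable def ones (n : ℕ) (e : ℕ → ℝ) : Finset (Fin n) := Finset.univ.filter fun k => e k = 1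

theorem mem_ones {n : ℕ} {e : ℕ → ℝ} {k : Fin n} : k ∈ ones n e ↔ e k = 1 := by
  simp [ones]

theorem measurableSet_forall_mem {n : ℕ} {B : Fin n → Set ℝ} (hB : ∀ k, MeasurableSet (B k)) :
    MeasurableSet {e : ℕ → ℝ | ∀ k : Fin n, e k ∈ B k} := by
  have h : {e : ℕ → ℝ | ∀ k : Fin n, e k ∈ B k} = ⋂ k : Fin n, (fun e : ℕ → ℝ => e k) ⁻¹' B k := by
    ext e; simp
  rw [h]
  exact MeasurableSet.iInter fun k => measurable_pi_apply (k : ℕ) (hB k)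

theorem measurableSet_ones_eq {n : ℕ} (A : Finset (Fin n)) :
    MeasurableSet {e : ℕ → ℝ | ones n e = A} := by
  classical
  have h : {e : ℕ → ℝ | ones n e = A} =
      {e : ℕ → ℝ | ∀ k : Fin n, e k ∈ (if k ∈ A then {1} else {1}ᶜ : Set ℝ)} := by
    ext e
    simp only [Set.mem_ofPred_eq, Finset.ext_iff, mem_ones]
    refine forall_congr' fun k => ?_
    by_cases hk : k ∈ A <;> simp [hk]
  rw [h]
  refine measurableSet_forall_mem fun k => ?_
  split_ifs
  · exact measurableSet_singleton 1
  · exact (measurableSet_singleton 1).compl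

/-- The sequences that are bounded by `u k` at the indices `k ∈ S`. -/
def below {n : ℕ} (S : Finset (Fin n)) (u : Fin n → ℝ) : Set (ℕ → ℝ) :=
  {o | ∀ k ∈ S, o k ≤ u k}

theorem measurableSet_below {n : ℕ} (S : Finset (Fin n)) (u : Fin n → ℝ) :
    MeasurableSet (below S u) := by
  classical
  have h : below S u = {e : ℕ → ℝ | ∀ k : Fin n, e k ∈ (if k ∈ S then Set.Iic (u k) else Set.univ)}
      := by
    ext e
    simp only [below, Set.mem_ofPred_eq]
    refine forall_congr' fun k => ?_
    by_cases hk : k ∈ S <;> simp [hk]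
  rw [h]
  refine measurableSet_forall_mem fun k => ?_
  split_ifs
  · exact measurableSet_Iic
  · exact MeasurableSet.univ

theorem integral_comp_finite {Ω F : Type*} [MeasurableSpace Ω] [Finite F] {P : Measure Ω}
    [IsFiniteMeasure P] {f : Ω → F} (hf : ∀ a, MeasurableSet (f ⁻¹' {a})) (φ : F → ℝ) :
    Integrable (fun ω => φ (f ω)) P ∧
      ∀ [Fintype F], ∫ ω, φ (f ω) ∂P = ∑ a, P.real (f ⁻¹' {a}) * φ a := by
  let _ : MeasurableSpace F := ⊤
  have hfm : Measurable f := measurable_to_countable' hf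
  have hφ : Measurable φ := measurable_from_top
  have hint : Integrable φ (P.map f) := .of_finite
  refine ⟨hint.comp_measurable hfm, fun {_} => ?_⟩
  rw [← integral_map hfm.aemeasurable hφ.aestronglyMeasurable, integral_fintype hint]
  refine Finset.sum_congr rfl fun a _ => ?_
  rw [map_measureReal_apply hfm (measurableSet_singleton a), smul_eq_mul]

open scoped Classical in
/-- The probability that the `n` members in `A` of the sequence `O` stay below `u` and `v`, the
others below `v`, and that those of an independent copy outside of `A` stay below `u`. -/
noncomputable def patternProb {Ω : Type*} [MeasurableSpace Ω] (P : Measure Ω) (O : ℕ → Ω → ℝ)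
    {n : ℕ} (u v : ℝ) (A : Finset (Fin n)) : ℝ :=
  P.real {ω | (fun m => O m ω) ∈ below Finset.univ fun k => if k ∈ A then min u v else v} *
    P.real {ω | (fun m => O m ω) ∈ below Aᶜ fun _ => u}

section

variable {Ω : Type*} [MeasurableSpace Ω] {P : Measure Ω} [IsProbabilityMeasure P]
  {O O' ε : ℕ → Ω → ℝ}

open scoped Classical in
/-- The probability of the joint event, as the expectation of its conditional probability given the
replacement pattern of the first `n` members. -/
theorem measureReal_partialMax_replaced (hcopy : IsCopy P O' O)
    (hindep : IndepFun (fun ω n => O n ω) (fun ω n => O' n ω) P)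
    (hO : Measurable fun ω n => O n ω) (hO' : Measurable fun ω n => O' n ω)
    (hε : Measurable fun ω n => ε n ω) (hbern : ∀ n, ∀ᵐ ω ∂P, ε n ω = 0 ∨ ε n ω = 1)
    (hεindep : IndepFun (fun ω n => ε n ω)
      (fun ω => ((fun n => O n ω), (fun n => O' n ω))) P) {n : ℕ} (hn : 1 ≤ n) (u v : ℝ) :
    P.real {ω | partialMax (replaced ε O O') n ω ≤ u ∧ partialMax O n ω ≤ v} =
      ∫ ω, patternProb P O u v (ones n fun m => ε m ω) ∂P := by
  have hones : ∀ A : Finset (Fin n), MeasurableSet ((fun ω => ones n fun m => ε m ω) ⁻¹' {A}) :=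
    fun A => hε (measurableSet_ones_eq A)
  rw [(integral_comp_finite hones (patternProb P O u v)).2]
  -- the event with pattern `A`
  let G : Finset (Fin n) → Set Ω := fun A =>
    (fun ω => ones n fun m => ε m ω) ⁻¹' {A} ∩
      (((fun ω m => O m ω) ⁻¹' below Finset.univ fun k => if k ∈ A then min u v else v) ∩
        (fun ω m => O' m ω) ⁻¹' below Aᶜ fun _ => u)
  have hG : ({ω | partialMax (replaced ε O O') n ω ≤ u ∧ partialMax O n ω ≤ v} : Set Ω) =ᵐ[P]
      ⋃ A ∈ (Finset.univ : Finset (Finset (Fin n))), G A := by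
    filter_upwards [ae_all_iff.2 hbern] with ω hω
    refine propext ?_
    change (partialMax (replaced ε O O') n ω ≤ u ∧ partialMax O n ω ≤ v) ↔
      ω ∈ ⋃ A ∈ (Finset.univ : Finset (Finset (Fin n))), G A
    simp only [Set.mem_iUnion, Finset.mem_univ, exists_const, G, Set.mem_inter_iff,
      Set.mem_preimage, Set.mem_singleton_iff, exists_eq_left', below,
      Set.mem_ofPred_eq, forall_true_left, Finset.mem_compl, mem_ones, partialMax_le_iff _ hn,
      replaced, ← forall_and]
    refine forall_congr' fun k => ?_
    rcases hω k with h | h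
    · simp [h, and_comm]
    · simp [h]
  have hGm : ∀ A, MeasurableSet (G A) := fun A => (hones A).inter
    ((hO (measurableSet_below _ _)).inter (hO' (measurableSet_below _ _)))
  have hdisj : Set.PairwiseDisjoint (↑(Finset.univ : Finset (Finset (Fin n)))) G := by
    intro A _ B _ hAB
    refine Set.disjoint_left.2 fun ω hA hB => hAB ?_
    exact hA.1.symm.trans hB.1
  rw [measureReal_congr hG, measureReal_biUnion_finset hdisj fun A _ => hGm A]
  refine Finset.sum_congr rfl fun A _ => ?_
  have h1 := hεindep.measure_inter_preimage_eq_mul _ _ (measurableSet_ones_eq A)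
    ((measurableSet_below Finset.univ fun k => if k ∈ A then min u v else v).prod
      (measurableSet_below Aᶜ fun _ => u))
  have h2 := hindep.measure_inter_preimage_eq_mul _ _
    (measurableSet_below Finset.univ fun k => if k ∈ A then min u v else v)
    (measurableSet_below Aᶜ fun _ => u)
  have h3 := hcopy.measure_mem_eq (measurableSet_below Aᶜ fun _ => u)
  have h4 : P (G A) = P ((fun ω => ones n fun m => ε m ω) ⁻¹' {A}) *
      (P ((fun ω m => O m ω) ⁻¹' below Finset.univ fun k => if k ∈ A then min u v else v) *
        P ((fun ω m => O m ω) ⁻¹' below Aᶜ fun _ => u)) := by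
    rw [← h3, ← h2]
    exact h1
  rw [measureReal_def, h4, ENNReal.toReal_mul, ENNReal.toReal_mul]
  rfl

end

/-! ### The limit -/

theorem abs_exp_sub_exp_le {a b : ℝ} (ha : a ≤ 0) (hb : b ≤ 0) :
    |Real.exp a - Real.exp b| ≤ |a - b| := by
  have key : ∀ {a b : ℝ}, a ≤ 0 → Real.exp a - Real.exp b ≤ |a - b| := fun {a b} ha => by
    have h1 : Real.exp b = Real.exp a * Real.exp (b - a) := by rw [← Real.exp_add]; ring_nf
    have h2 := Real.add_one_le_exp (b - a)
    have h3 := Real.exp_le_one_iff.2 ha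
    have h4 := Real.exp_pos a
    have h5 := neg_abs_le (b - a)
    rw [abs_sub_comm] at h5
    nlinarith [abs_nonneg (a - b)]
  refine abs_sub_le_iff.2 ⟨key ha, ?_⟩
  rw [abs_sub_comm]
  exact key hb

theorem tendsto_mul_log_one_sub_orderTail {d r : ℕ} (hr : 1 ≤ r ∧ r ≤ d) (z : ℝ) :
    Tendsto (fun n : ℕ => (n : ℝ) * Real.log (1 - orderTail d r hr (level d r n z))) atTop
      (𝓝 (-Real.exp (-z))) := by
  have h := (tendsto_mul_orderTail hr z).neg
  simp only [← mul_neg] at h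
  exact Real.tendsto_nat_mul_log_one_add_of_tendsto h

/-- The limiting probability of the joint event, given that the limiting frequency of
unreplaced members is `t`. -/
noncomputable def limitValue (x y t : ℝ) : ℝ :=
  Real.exp (-(t * Real.exp (-min x y) + (1 - t) * (Real.exp (-x) + Real.exp (-y))))

theorem limitValue_eq (x y t : ℝ) : limitValue x y t =
    Real.exp (-Real.exp (-min x y)) * Real.exp (-((1 - t) * Real.exp (-max x y))) := by
  rw [limitValue, ← Real.exp_add]
  congr 1
  rcases le_total x y with h | h
  · rw [min_eq_left h, max_eq_right h]; ring
  · rw [min_eq_right h, max_eq_left h]; ring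

theorem continuous_limitValue (x y : ℝ) : Continuous (limitValue x y) := by
  unfold limitValue; fun_prop

theorem abs_limitValue_le_one (x y : ℝ) {t : ℝ} (h0 : 0 ≤ t) (h1 : t ≤ 1) :
    |limitValue x y t| ≤ 1 := by
  rw [limitValue, abs_of_pos (Real.exp_pos _), Real.exp_le_one_iff, neg_nonpos]
  have := sub_nonneg.2 h1
  positivity

open scoped Classical in
/-- The probability of the joint event for independent variables, given that the members in `A`
are not replaced, is uniformly close to the limit at the frequency `A.card / n`. -/
theorem eventually_abs_prod_sub_limitValue_le {d r : ℕ} (hr : 1 ≤ r ∧ r ≤ d) (x y : ℝ) {η : ℝ}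
    (hη : 0 < η) : ∀ᶠ n in atTop, ∀ A : Finset (Fin n),
      |(∏ k, (1 - orderTail d r hr (level d r n (if k ∈ A then min x y else y)))) *
        (∏ _k ∈ Aᶜ, (1 - orderTail d r hr (level d r n x))) -
        limitValue x y ((A.card : ℝ) / n)| ≤ η := by
  have hL := tendsto_mul_log_one_sub_orderTail hr
  have hlim : Tendsto (fun n : ℕ =>
      |(n : ℝ) * Real.log (1 - orderTail d r hr (level d r n (min x y))) -
        -Real.exp (-min x y)| +
      (|(n : ℝ) * Real.log (1 - orderTail d r hr (level d r n x)) - -Real.exp (-x)| +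
      |(n : ℝ) * Real.log (1 - orderTail d r hr (level d r n y)) - -Real.exp (-y)|)) atTop
      (𝓝 0) := by
    have h : ∀ z, Tendsto (fun n : ℕ => |(n : ℝ) *
        Real.log (1 - orderTail d r hr (level d r n z)) - -Real.exp (-z)|) atTop (𝓝 0) :=
      fun z => by simpa using ((hL z).sub_const (-Real.exp (-z))).abs
    simpa using (h (min x y)).add ((h x).add (h y))
  have hpos : ∀ z, ∀ᶠ n in atTop, 0 < 1 - orderTail d r hr (level d r n z) := fun z => by
    have h0 := (tendsto_mul_orderTail hr z).div_atTop tendsto_natCast_atTop_atTop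
    filter_upwards [h0.eventually (gt_mem_nhds one_pos), eventually_ge_atTop 1] with n h1 h2
    rw [mul_div_cancel_left₀ _ (by exact_mod_cast (by omega : n ≠ 0))] at h1
    linarith
  filter_upwards [hlim.eventually_le_const hη, hpos (min x y), hpos x, hpos y,
    eventually_ge_atTop 1] with n hn hm hx hy hn1 A
  refine le_trans ?_ hn
  have hn0 : (0 : ℝ) < n := by exact_mod_cast hn1
  have hcard : (A.card : ℝ) ≤ n := by
    exact_mod_cast (Finset.card_le_univ A).trans_eq (Fintype.card_fin n)
  set p : ℝ → ℝ := fun z => 1 - orderTail d r hr (level d r n z) with hp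
  have hp1 : ∀ z, 0 < p z → Real.log (p z) ≤ 0 := fun z hz =>
    Real.log_nonpos hz.le (sub_le_self _ (orderTail_nonneg hr _))
  set c : ℝ := A.card / n with hc
  have hc0 : 0 ≤ c := by positivity
  have hc1 : 0 ≤ 1 - c := sub_nonneg.2 ((div_le_one hn0).2 hcard)
  have hpow : ∀ z (m : ℕ), 0 < p z → p z ^ m = Real.exp (m * Real.log (p z)) := fun z m hz => by
    rw [Real.exp_nat_mul, Real.exp_log hz]
  have hcompl : ((Aᶜ.card : ℕ) : ℝ) = n - A.card := by
    rw [Finset.card_compl, Fintype.card_fin, Nat.cast_sub (by exact_mod_cast hcard)]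
  have hprod : (∏ k, (1 - orderTail d r hr (level d r n (if k ∈ A then min x y else y)))) *
      (∏ _k ∈ Aᶜ, (1 - orderTail d r hr (level d r n x))) =
      Real.exp (c * (n * Real.log (p (min x y))) +
        (1 - c) * (n * Real.log (p x) + n * Real.log (p y))) := by
    have h1 : ∏ k ∈ A, (1 - orderTail d r hr (level d r n (if k ∈ A then min x y else y))) =
        p (min x y) ^ A.card := by
      rw [← Finset.prod_const]
      exact Finset.prod_congr rfl fun k hk => by rw [if_pos hk]
    have h2 : ∏ k ∈ Aᶜ, (1 - orderTail d r hr (level d r n (if k ∈ A then min x y else y))) =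
        p y ^ Aᶜ.card := by
      rw [← Finset.prod_const]
      exact Finset.prod_congr rfl fun k hk => by rw [if_neg (Finset.mem_compl.1 hk)]
    have h3 : ∏ _k ∈ Aᶜ, (1 - orderTail d r hr (level d r n x)) = p x ^ Aᶜ.card :=
      Finset.prod_const _
    rw [← Finset.prod_mul_prod_compl A, h1, h2, h3, hpow _ _ hm, hpow _ _ hy,
      hpow _ _ hx, ← Real.exp_add, ← Real.exp_add, hcompl, hc]
    congr 1
    field_simp
    ring
  rw [hprod, limitValue]
  have hlm := mul_nonpos_of_nonneg_of_nonpos hn0.le (hp1 _ hm)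
  have hlx := mul_nonpos_of_nonneg_of_nonpos hn0.le (hp1 _ hx)
  have hly := mul_nonpos_of_nonneg_of_nonpos hn0.le (hp1 _ hy)
  refine (abs_exp_sub_exp_le (by nlinarith) (neg_nonpos.2 (by positivity))).trans ?_
  have e : c * (n * Real.log (p (min x y))) +
        (1 - c) * (n * Real.log (p x) + n * Real.log (p y)) -
      -(c * Real.exp (-min x y) + (1 - c) * (Real.exp (-x) + Real.exp (-y))) =
      c * (n * Real.log (p (min x y)) - -Real.exp (-min x y)) +
      ((1 - c) * (n * Real.log (p x) - -Real.exp (-x)) +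
        (1 - c) * (n * Real.log (p y) - -Real.exp (-y))) := by ring
  have hmul : ∀ {s a : ℝ}, 0 ≤ s → s ≤ 1 → |s * a| ≤ |a| := fun {s a} h0 h1 => by
    rw [abs_mul, abs_of_nonneg h0]
    exact mul_le_of_le_one_left (abs_nonneg a) h1
  rw [e]
  refine (abs_add_le _ _).trans (add_le_add (hmul hc0 (by linarith)) ?_)
  exact (abs_add_le _ _).trans (add_le_add (hmul hc1 (by linarith)) (hmul hc1 (by linarith)))

/-- Bounded convergence for convergence in measure. -/
theorem tendsto_integral_comp_of_tendstoInMeasure {Ω : Type*} [MeasurableSpace Ω] {P : Measure Ω}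
    [IsProbabilityMeasure P] {f : ℕ → Ω → ℝ} {g : Ω → ℝ} (hf : ∀ n, Measurable (f n))
    (hfg : TendstoInMeasure P f atTop g) {h : ℝ → ℝ} (hh : Continuous h) {C : ℝ}
    (hC : ∀ n, ∀ᵐ ω ∂P, |h (f n ω)| ≤ C) :
    Tendsto (fun n => ∫ ω, h (f n ω) ∂P) atTop (𝓝 (∫ ω, h (g ω) ∂P)) := by
  refine tendsto_of_subseq_tendsto fun ns hns => ?_
  have hsub : TendstoInMeasure P (fun n => f (ns n)) atTop g := fun ε hε => (hfg ε hε).comp hns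
  obtain ⟨ms, -, hms⟩ := hsub.exists_seq_tendsto_ae
  refine ⟨ms, tendsto_integral_of_dominated_convergence (fun _ => C)
    (fun n => (hh.measurable.comp (hf _)).aestronglyMeasurable) (integrable_const C)
    (fun n => hC _) ?_⟩
  filter_upwards [hms] with ω hω
  exact (hh.tendsto _).comp hω

theorem sum_range_eq_card_ones {e : ℕ → ℝ} (he : ∀ k, e k = 0 ∨ e k = 1) (n : ℕ) :
    ∑ k ∈ Finset.range n, e k = (ones n e).card := by
  rw [Finset.sum_range, ones, Finset.card_filter, Nat.cast_sum]
  refine Finset.sum_congr rfl fun k _ => ?_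
  rcases he k with h | h <;> simp [h]

theorem abs_mul_sub_mul_le {a b a' b' : ℝ} (hb : 0 ≤ b) (hb1 : b ≤ 1) (ha' : 0 ≤ a')
    (ha1' : a' ≤ 1) : |a * b - a' * b'| ≤ |a - a'| + |b - b'| := by
  have e : a * b - a' * b' = (a - a') * b + a' * (b - b') := by ring
  rw [e]
  refine (abs_add_le _ _).trans (add_le_add ?_ ?_)
  · rw [abs_mul, abs_of_nonneg hb]
    exact mul_le_of_le_one_right (abs_nonneg _) hb1
  · rw [abs_mul, abs_of_nonneg ha']
    exact mul_le_of_le_one_left (abs_nonneg _) ha1'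

open scoped Classical in
/-- The conditional probability given the pattern `A` is close to the limit at the frequency
`A.card / n`, once the joint distribution functions are close to products. -/
theorem abs_patternProb_sub_le {Ω : Type*} [MeasurableSpace Ω] {P : Measure Ω}
    [IsProbabilityMeasure P] {d r : ℕ} (hr : 1 ≤ r ∧ r ≤ d) (Yc : Fin d → ℕ → Ω → ℝ) (x y : ℝ)
    {n : ℕ} {η : ℝ}
    (h1 : ∀ (S : Finset (Fin n)) (z : Fin n → ℝ), (∀ k, z k = min x y ∨ z k = y) →
      |P.real {ω | ∀ k ∈ S, upperOrderStat (fun l => Yc l k ω) r hr ≤ level d r n (z k)} -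
        ∏ k ∈ S, (1 - orderTail d r hr (level d r n (z k)))| ≤ η)
    (h2 : ∀ (S : Finset (Fin n)) (z : Fin n → ℝ), (∀ k, z k = x ∨ z k = x) →
      |P.real {ω | ∀ k ∈ S, upperOrderStat (fun l => Yc l k ω) r hr ≤ level d r n (z k)} -
        ∏ k ∈ S, (1 - orderTail d r hr (level d r n (z k)))| ≤ η)
    (h3 : ∀ A : Finset (Fin n),
      |(∏ k, (1 - orderTail d r hr (level d r n (if k ∈ A then min x y else y)))) *
        (∏ _k ∈ Aᶜ, (1 - orderTail d r hr (level d r n x))) -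
        limitValue x y ((A.card : ℝ) / n)| ≤ η) (A : Finset (Fin n)) :
    |patternProb P (orderStatSeq Yc r hr) (level d r n x) (level d r n y) A -
      limitValue x y ((A.card : ℝ) / n)| ≤ 3 * η := by
  have a1 := h1 Finset.univ (fun k => if k ∈ A then min x y else y) fun k => by
    by_cases hk : k ∈ A <;> simp [hk]
  have a2 := h2 Aᶜ (fun _ => x) fun _ => Or.inl rfl
  have hlev : ∀ k : Fin n, (if k ∈ A then min (level d r n x) (level d r n y) else level d r n y) =
      level d r n (if k ∈ A then min x y else y) := fun k => by
    split_ifs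
    · rw [level_mono.map_min]
    · rfl
  simp only [patternProb, hlev]
  have hp0 : ∀ u, 0 ≤ 1 - orderTail d r hr u := fun u => sub_nonneg.2 (orderTail_le_one hr u)
  have hp1 : ∀ u, 1 - orderTail d r hr u ≤ 1 := fun u => sub_le_self _ (orderTail_nonneg hr u)
  refine (abs_sub_le _ _ _).trans ((add_le_add (abs_mul_sub_mul_le measureReal_nonneg
    measureReal_le_one (Finset.prod_nonneg fun k _ => hp0 _)
    (Finset.prod_le_one (fun k _ => hp0 _) fun k _ => hp1 _)) (h3 A)).trans ?_)
  refine (add_le_add_left (add_le_add a1 a2) η).trans ?_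
  linarith

end RandomReplacing

theorem theorem2p4 {Ω : Type*} [MeasurableSpace Ω] (P : Measure Ω) [IsProbabilityMeasure P]
    -- the Gaussian sequence
    (Y : ℕ → Ω → ℝ) (ρ : ℕ → ℝ)
    (hY : RandomReplacing.IsStdStationaryGaussian P Y ρ)
    (hρ : Tendsto (fun n : ℕ => ρ n * Real.log n) atTop (𝓝 0))
    -- its independent copies and their order statistics
    (d r : ℕ) (hr : 1 ≤ r ∧ r ≤ d)
    (Yc : Fin d → ℕ → Ω → ℝ)
    (hYc_meas : ∀ j n, Measurable (Yc j n))
    (hYc_copy : ∀ j, RandomReplacing.IsCopy P (Yc j) Y)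
    (hYc_indep : iIndepFun (fun j ω n => Yc j n ω) P)
    (O O' : ℕ → Ω → ℝ)
    (hO : O = RandomReplacing.orderStatSeq Yc r hr)
    -- an independent copy of the order statistics sequence
    (hO'_meas : ∀ n, Measurable (O' n))
    (hO'_copy : RandomReplacing.IsCopy P O' O)
    (hO'_indep : IndepFun (fun ω n => O n ω) (fun ω n => O' n ω) P)
    -- the replacement indicators, independent of both
    (ε : ℕ → Ω → ℝ)
    (hε_meas : ∀ n, Measurable (ε n))
    (hε_bern : ∀ n, ∀ᵐ ω ∂P, ε n ω = 0 ∨ ε n ω = 1)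
    (hε_indep : IndepFun (fun ω n => ε n ω)
      (fun ω => ((fun n => O n ω), (fun n => O' n ω))) P)
    (lam : Ω → ℝ) (hlam_meas : Measurable lam)
    (hlam : ∀ᵐ ω ∂P, lam ω ∈ Set.Icc (0 : ℝ) 1)
    (hS : TendstoInMeasure P
      (fun (n : ℕ) ω => (∑ k ∈ Finset.range n, ε k ω) / (n : ℝ)) atTop lam)
    (x y : ℝ) :
    Tendsto
      (fun n : ℕ => P.real {ω |
        RandomReplacing.partialMax (RandomReplacing.replaced ε O O') n ω ≤
            (RandomReplacing.scaleConst r n)⁻¹ * x + RandomReplacing.centerConst d r n ∧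
        RandomReplacing.partialMax O n ω ≤
            (RandomReplacing.scaleConst r n)⁻¹ * y + RandomReplacing.centerConst d r n})
      atTop
      (𝓝 (Real.exp (-Real.exp (-min x y)) *
        ∫ ω, Real.exp (-((1 - lam ω) * Real.exp (-max x y))) ∂P)) := by
    open RandomReplacing in
  have hρ0 := IsStdStationaryGaussian.tendsto_covariance_zero hρ
  obtain ⟨δ, hδ1, hδ⟩ := hY.exists_abs_covariance_le hρ0
  have hX := hY.isGaussianArray hYc_meas hYc_copy hYc_indep
  have hOm : Measurable fun ω n => O n ω := by
    subst hO
    exact measurable_pi_lambda _ fun n => (measurable_upperOrderStat r hr).comp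
      (measurable_pi_lambda _ fun j => hYc_meas j n)
  have hO'm : Measurable fun ω n => O' n ω := measurable_pi_lambda _ hO'_meas
  have hεm : Measurable fun ω n => ε n ω := measurable_pi_lambda _ hε_meas
  have hbern := ae_all_iff.2 hε_bern
  have hfreqm : ∀ n : ℕ, Measurable fun ω => (∑ k ∈ Finset.range n, ε k ω) / (n : ℝ) := fun n =>
    (Finset.measurable_sum _ fun k _ => hε_meas k).div_const _
  have hfreq : ∀ᵐ ω ∂P, ∀ n : ℕ, (∑ k ∈ Finset.range n, ε k ω) / (n : ℝ) =
      ((ones n fun m => ε m ω).card : ℝ) / n := by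
    filter_upwards [hbern] with ω hω n
    rw [sum_range_eq_card_ones hω]
  have hbound : ∀ n : ℕ, ∀ᵐ ω ∂P, |limitValue x y ((∑ k ∈ Finset.range n, ε k ω) / (n : ℝ))| ≤ 1 :=
    fun n => by
      filter_upwards [hfreq] with ω hω
      rw [hω]
      refine abs_limitValue_le_one x y (by positivity) (div_le_one_of_le₀ ?_ (by positivity))
      exact_mod_cast (Finset.card_le_univ _).trans_eq (Fintype.card_fin n)
  have hlim := tendsto_integral_comp_of_tendstoInMeasure hfreqm hS (continuous_limitValue x y)
    hbound
  simp only [limitValue_eq] at hlim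
  rw [integral_const_mul] at hlim
  simp only [← limitValue_eq] at hlim
  refine hlim.congr_dist ?_
  -- it remains to compare with the expectation of the limit value at the frequency of ones
  refine tendsto_order.2 ⟨fun a ha => Eventually.of_forall fun n => ha.trans_le dist_nonneg,
    fun η hη => ?_⟩
  have hη4 : 0 < η / 4 := by positivity
  filter_upwards [eventually_abs_measureReal_sub_prod_le hr hX hY.covariance_zero hδ1 hδ hρ
      (min x y) y hη4,
    eventually_abs_measureReal_sub_prod_le hr hX hY.covariance_zero hδ1 hδ hρ x x hη4,
    eventually_abs_prod_sub_limitValue_le hr x y hη4, eventually_ge_atTop 1] with n h1 h2 h3 hn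
  have hpat := abs_patternProb_sub_le hr Yc x y h1 h2 h3
  rw [← hO] at hpat
  have hev := measureReal_partialMax_replaced hO'_copy hO'_indep hOm hO'm hεm hε_bern hε_indep hn
    (level d r n x) (level d r n y)
  have hones : ∀ A : Finset (Fin n), MeasurableSet ((fun ω => ones n fun m => ε m ω) ⁻¹' {A}) :=
    fun A => hεm (measurableSet_ones_eq A)
  have hint := (integral_comp_finite (P := P) hones
    (patternProb P O (level d r n x) (level d r n y))).1
  have hint' : Integrable (fun ω => limitValue x y ((∑ k ∈ Finset.range n, ε k ω) / (n : ℝ))) P :=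
    Integrable.of_bound
      ((continuous_limitValue x y).measurable.comp (hfreqm n)).aestronglyMeasurable 1 (hbound n)
  refine lt_of_le_of_lt ?_ (by linarith : 3 * (η / 4) < η)
  rw [dist_comm]
  refine (congrArg (fun t => dist t _) hev).le.trans ?_
  rw [Real.dist_eq, ← integral_sub hint hint']
  have hle : ∀ᵐ ω ∂P, ‖patternProb P O (level d r n x) (level d r n y) (ones n fun m => ε m ω) -
      limitValue x y ((∑ k ∈ Finset.range n, ε k ω) / (n : ℝ))‖ ≤ 3 * (η / 4) := by
    filter_upwards [hfreq] with ω hω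
    rw [hω n]
    exact hpat _
  have hnorm := norm_integral_le_of_norm_le_const hle
  rwa [probReal_univ, mul_one] at hnorm
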